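/- Let $\mathfrak g=\mathfrak g_0\oplus\mathfrak g_1$ be a basic classical Lie superalgebra over $\mathbb C$, that is, one isomorphic to $\mathfrak{sl}(m|n)$ with $m\neq n$, $\mathfrak{gl}(m|n)$, $\mathfrak{osp}(m|2n)$, $D(2|1;a)$ with $a\ne 0,-1$, $F(4)$ or $G(3)$. Let $G_0$ be a connected group with Lie algebra $\mathfrak g_0$, acting on $\mathfrak g_1$ by the adjoint action (so its image in $GL(\mathfrak g_1)$ is generated by the operators $\exp(\operatorname{ad}u)$, $u\in\mathfrak g_0$), and let $X=\{x\in\mathfrak g_1 : [x,x]=0\}$. Let $\mathfrak t\subset\mathfrak g_0$ be a Cartan subalgebra, and let $\Delta_0,\Delta_1\subset\mathfrak t^*\setminus\{0\}$ be the sets of nonzero weights of $\mathfrak t$ on $\mathfrak g_0$ and on $\mathfrak g_1$. Let $A\subset\Delta_1$ be an iso-set: $A$ is linearly independent, and $\alpha+\beta\notin\Delta_0$ for all $\alpha,\beta\in\Delta_1\cap(A\cup -A)$. Choose nonzero $x_\beta\in(\mathfrak g_1)_\beta$ for $\beta\in A$, and let $\Phi(A)=G_0x$ be the $G_0$-orbit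 of $x=\sum_{\beta\in A}x_\beta$. Then $\Phi(A)\subset X$; there is a nondegenerate even supersymmetric invariant bilinear form on $\mathfrak g$; and for every such form, if $A^\perp\subset\mathfrak t^*$ denotes the set of weights orthogonal to all elements of $A$ with respect to the induced form on $\mathfrak t^*$, then $$\dim\Phi(A)=\frac{|\Delta_1\setminus A^\perp|}{2}+|A| .$$ Here the dimension of the orbit is its dimension as an algebraic variety. -/

import Mathlib

open scoped TensorProduct

noncomputable section

-- associative algebras of matrices and of endomorphisms are Lie algebras under the commutator
attribute [local instance] LieRing.ofAssociativeRing

namespace LieSuper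

/-! ### Lie superalgebras -/

/-- A complex Lie superalgebra `g = g₀ ⊕ g₁`, given by its even part `g₀` (a Lie algebra), its odd
part `g₁` (a `g₀`-module) and the bracket of two odd elements, which is symmetric, `g₀`-equivariant
and satisfies the super Jacobi identity for three odd elements. -/
class LieSuperalgebra (g₀ g₁ : Type*) [LieRing g₀] [LieAlgebra ℂ g₀] [AddCommGroup g₁]
    [Module ℂ g₁] [LieRingModule g₀ g₁] [LieModule ℂ g₀ g₁] where
  /-- The bracket `[x, y]` of two odd elements. -/
  oddBracket : g₁ →ₗ[ℂ] g₁ →ₗ[ℂ] g₀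
  oddBracket_symm : ∀ x y : g₁, oddBracket x y = oddBracket y x
  lie_oddBracket : ∀ (u : g₀) (x y : g₁),
    ⁅u, oddBracket x y⁆ = oddBracket ⁅u, x⁆ y + oddBracket x ⁅u, y⁆
  oddBracket_jacobi : ∀ x y z : g₁,
    ⁅oddBracket x y, z⁆ + ⁅oddBracket y z, x⁆ + ⁅oddBracket z x, y⁆ = 0

/-! ### The series `gl(m|n)`, `sl(m|n)` and `osp(m|2n)` -/

section Matrices

/-- `g` is isomorphic to the sub-superalgebra of `gl(ι₀|ι₁)` whose even part is the set `E` and whose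
odd part is the set `O` of matrices, with the supercommutator as the bracket. -/
def IsMatrixSuperalgebra (g₀ g₁ : Type*) [LieRing g₀] [LieAlgebra ℂ g₀] [AddCommGroup g₁]
    [Module ℂ g₁] [LieRingModule g₀ g₁] [LieModule ℂ g₀ g₁] [LieSuperalgebra g₀ g₁]
    {ι₀ ι₁ : Type} [Fintype ι₀] [Fintype ι₁] (E O : Set (Matrix (ι₀ ⊕ ι₁) (ι₀ ⊕ ι₁) ℂ)) : Prop :=
  ∃ (ρ₀ : g₀ →ₗ[ℂ] Matrix (ι₀ ⊕ ι₁) (ι₀ ⊕ ι₁) ℂ) (ρ₁ : g₁ →ₗ[ℂ] Matrix (ι₀ ⊕ ι₁) (ι₀ ⊕ ι₁) ℂ),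
    Function.Injective ρ₀ ∧ Function.Injective ρ₁ ∧ Set.range ρ₀ = E ∧ Set.range ρ₁ = O ∧
    (∀ u v : g₀, ρ₀ ⁅u, v⁆ = ρ₀ u * ρ₀ v - ρ₀ v * ρ₀ u) ∧
    (∀ (u : g₀) (x : g₁), ρ₁ ⁅u, x⁆ = ρ₀ u * ρ₁ x - ρ₁ x * ρ₀ u) ∧
    (∀ x y : g₁, ρ₀ (LieSuperalgebra.oddBracket x y) = ρ₁ x * ρ₁ y + ρ₁ y * ρ₁ x)

/-- Even part of `gl(m|n)`: block diagonal matrices. -/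
def glEven (m n : ℕ) : Set (Matrix (Fin m ⊕ Fin n) (Fin m ⊕ Fin n) ℂ) :=
  {X | ∃ (P : Matrix (Fin m) (Fin m) ℂ) (S : Matrix (Fin n) (Fin n) ℂ),
    X = Matrix.fromBlocks P 0 0 S}

/-- Odd part of `gl(m|n)` and of `sl(m|n)`: block off-diagonal matrices. -/
def glOdd (m n : ℕ) : Set (Matrix (Fin m ⊕ Fin n) (Fin m ⊕ Fin n) ℂ) :=
  {X | ∃ (Q : Matrix (Fin m) (Fin n) ℂ) (R : Matrix (Fin n) (Fin m) ℂ),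
    X = Matrix.fromBlocks 0 Q R 0}

/-- Even part of `sl(m|n)`: block diagonal matrices with supertrace zero. -/
def slEven (m n : ℕ) : Set (Matrix (Fin m ⊕ Fin n) (Fin m ⊕ Fin n) ℂ) :=
  {X | ∃ (P : Matrix (Fin m) (Fin m) ℂ) (S : Matrix (Fin n) (Fin n) ℂ),
    X = Matrix.fromBlocks P 0 0 S ∧ P.trace - S.trace = 0}

/-- Even part `so(m) ⊕ sp(2n)` of `osp(m|2n)`, the superalgebra of all `X` with
`(X v, w) + (-1)^(|X| |v|) (v, X w) = 0`, where the form on `ℂ^(m|2n)` has the Gram matrix `1` on the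
even part and `J` on the odd part. -/
def ospEven (m n : ℕ) :
    Set (Matrix (Fin m ⊕ (Fin n ⊕ Fin n)) (Fin m ⊕ (Fin n ⊕ Fin n)) ℂ) :=
  {X | ∃ (P : Matrix (Fin m) (Fin m) ℂ) (S : Matrix (Fin n ⊕ Fin n) (Fin n ⊕ Fin n) ℂ),
    X = Matrix.fromBlocks P 0 0 S ∧ P.transpose + P = 0 ∧
      S.transpose * Matrix.J (Fin n) ℂ + Matrix.J (Fin n) ℂ * S = 0}

/-- Odd part of `osp(m|2n)`. -/
def ospOdd (m n : ℕ) :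
    Set (Matrix (Fin m ⊕ (Fin n ⊕ Fin n)) (Fin m ⊕ (Fin n ⊕ Fin n)) ℂ) :=
  {X | ∃ (Q : Matrix (Fin m) (Fin n ⊕ Fin n) ℂ) (R : Matrix (Fin n ⊕ Fin n) (Fin m) ℂ),
    X = Matrix.fromBlocks 0 Q R 0 ∧ Q.transpose = Matrix.J (Fin n) ℂ * R}

end Matrices

/-! ### The family `D(2|1;a)` -/

/-- The Lie algebra `sl(2)`. -/
abbrev sl2 : LieSubalgebra ℂ (Matrix (Fin 2) (Fin 2) ℂ) := LieAlgebra.SpecialLinear.sl (Fin 2) ℂ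

/-- The standard symplectic form on `ℂ²`. -/
def symp (v w : Fin 2 → ℂ) : ℂ := v 0 * w 1 - v 1 * w 0

/-- The `sl(2)`-equivariant symmetric map `ℂ² × ℂ² → sl(2)`,
`sympSq v w : z ↦ symp w z • v + symp v z • w`. -/
def sympSq (v w : Fin 2 → ℂ) : Matrix (Fin 2) (Fin 2) ℂ :=
  Matrix.vecMulVec v ![-w 1, w 0] + Matrix.vecMulVec w ![-v 1, v 0]

/-- `g` is isomorphic to `D(2|1;a)`: the even part is `sl(2) × sl(2) × sl(2)`, the odd part is
`ℂ² ⊗ ℂ² ⊗ ℂ²`, and the bracket of odd elements is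
`[v₁⊗v₂⊗v₃, w₁⊗w₂⊗w₃] = ∑ i, σᵢ (∏ j ≠ i, symp vⱼ wⱼ) sympSq vᵢ wᵢ`
with `(σ₁, σ₂, σ₃) = (-(1 + a), 1, a)`; the sum of the `σᵢ` is zero. -/
def IsD21 (a : ℂ) (g₀ g₁ : Type*) [LieRing g₀] [LieAlgebra ℂ g₀] [AddCommGroup g₁]
    [Module ℂ g₁] [LieRingModule g₀ g₁] [LieModule ℂ g₀ g₁] [LieSuperalgebra g₀ g₁] : Prop :=
  ∃ (e₀ : g₀ ≃ₗ⁅ℂ⁆ (sl2 × sl2 × sl2))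
    (e₁ : g₁ ≃ₗ[ℂ] ((Fin 2 → ℂ) ⊗[ℂ] ((Fin 2 → ℂ) ⊗[ℂ] (Fin 2 → ℂ)))),
    (∀ (u : g₀) (v₁ v₂ v₃ : Fin 2 → ℂ),
      e₁ ⁅u, e₁.symm (v₁ ⊗ₜ (v₂ ⊗ₜ v₃))⁆ =
        ((e₀ u).1 : Matrix (Fin 2) (Fin 2) ℂ).mulVec v₁ ⊗ₜ (v₂ ⊗ₜ v₃) +
        v₁ ⊗ₜ (((e₀ u).2.1 : Matrix (Fin 2) (Fin 2) ℂ).mulVec v₂ ⊗ₜ v₃) +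
        v₁ ⊗ₜ (v₂ ⊗ₜ ((e₀ u).2.2 : Matrix (Fin 2) (Fin 2) ℂ).mulVec v₃)) ∧
    (∀ v₁ v₂ v₃ w₁ w₂ w₃ : Fin 2 → ℂ, ∀ b : g₀,
      b = LieSuperalgebra.oddBracket (e₁.symm (v₁ ⊗ₜ (v₂ ⊗ₜ v₃))) (e₁.symm (w₁ ⊗ₜ (w₂ ⊗ₜ w₃))) →
      ((e₀ b).1 : Matrix (Fin 2) (Fin 2) ℂ) =
        (-(1 + a) * symp v₂ w₂ * symp v₃ w₃) • sympSq v₁ w₁ ∧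
      ((e₀ b).2.1 : Matrix (Fin 2) (Fin 2) ℂ) =
        (symp v₁ w₁ * symp v₃ w₃) • sympSq v₂ w₂ ∧
      ((e₀ b).2.2 : Matrix (Fin 2) (Fin 2) ℂ) =
        (a * symp v₁ w₁ * symp v₂ w₂) • sympSq v₃ w₃)

/-! ### Complex octonions -/

/-- Complex octonions as Zorn vector matrices `(α, a; b, β)`, stored as `(α, a, b, β)`. -/
abbrev Oct : Type := ℂ × (Fin 3 → ℂ) × (Fin 3 → ℂ) × ℂ

namespace Oct

/-- Zorn's product of octonions. -/
def mul (x y : Oct) : Oct :=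
  (x.1 * y.1 + x.2.1 ⬝ᵥ y.2.2.1,
   x.1 • y.2.1 + y.2.2.2 • x.2.1 - crossProduct x.2.2.1 y.2.2.1,
   y.1 • x.2.2.1 + x.2.2.2 • y.2.2.1 + crossProduct x.2.1 y.2.1,
   x.2.2.2 * y.2.2.2 + x.2.2.1 ⬝ᵥ y.2.1)

/-- Octonion conjugation. -/
def conj (x : Oct) : Oct := (x.2.2.2, -x.2.1, -x.2.2.1, x.1)

/-- The polarization `N(x + y) - N(x) - N(y)` of the octonion norm `N(x) = α β - a ⬝ b`. -/
def form (x y : Oct) : ℂ :=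
  x.1 * y.2.2.2 + x.2.2.2 * y.1 - x.2.1 ⬝ᵥ y.2.2.1 - x.2.2.1 ⬝ᵥ y.2.1

/-- The commutator of octonions. -/
def comm (x y : Oct) : Oct := mul x y - mul y x

/-- The associator of octonions. -/
def assoc (x y z : Oct) : Oct := mul (mul x y) z - mul x (mul y z)

/-- Imaginary octonions: those of trace `α + β = 0`. -/
def imag : Submodule ℂ Oct where
  carrier := {x | x.1 + x.2.2.2 = 0}
  zero_mem' := by simp
  add_mem' := by
    intro x y hx hy
    simp only [Set.mem_ofPred_eq, Prod.fst_add, Prod.snd_add] at *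
    linear_combination hx + hy
  smul_mem' := by
    intro c x hx
    simp only [Set.mem_ofPred_eq, Prod.smul_fst, Prod.smul_snd, smul_eq_mul] at *
    linear_combination c * hx

theorem mul_add (x y z : Oct) : mul x (y + z) = mul x y + mul x z := by
  simp only [mul, Prod.fst_add, Prod.snd_add, dotProduct_add, map_add, Prod.mk_add_mk, Prod.mk.injEq,
    smul_add, add_smul]
  refine ⟨by ring, by abel, by abel, by ring⟩

theorem add_mul (x y z : Oct) : mul (x + y) z = mul x z + mul y z := by
  simp only [mul, Prod.fst_add, Prod.snd_add, add_dotProduct, map_add, Prod.mk_add_mk, Prod.mk.injEq,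
    smul_add, add_smul, LinearMap.add_apply]
  refine ⟨by ring, by abel, by abel, by ring⟩

theorem mul_smul (c : ℂ) (x y : Oct) : mul x (c • y) = c • mul x y := by
  simp only [mul, Prod.smul_fst, Prod.smul_snd, dotProduct_smul, map_smul, Prod.smul_mk,
    Prod.mk.injEq, smul_add, smul_sub, smul_eq_mul, smul_smul]
  refine ⟨by ring, by rw [mul_comm], by rw [mul_comm x.2.2.2], by ring⟩

theorem smul_mul (c : ℂ) (x y : Oct) : mul (c • x) y = c • mul x y := by
  simp only [mul, Prod.smul_fst, Prod.smul_snd, smul_dotProduct, map_smul, Prod.smul_mk,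
    Prod.mk.injEq, smul_add, smul_sub, smul_eq_mul, smul_smul, LinearMap.smul_apply]
  refine ⟨by ring, by rw [mul_comm c y.2.2.2], by rw [mul_comm c y.1], by ring⟩

/-- Left multiplication by an octonion. -/
def mulLeft (x : Oct) : Module.End ℂ Oct where
  toFun := mul x
  map_add' := mul_add x
  map_smul' c y := mul_smul c x y

/-- The Lie algebra `G₂` of derivations of the octonions. -/
def derivations : LieSubalgebra ℂ (Module.End ℂ Oct) where
  carrier := {d | ∀ x y : Oct, d (mul x y) = mul (d x) y + mul x (d y)}
  zero_mem' := by
    intro x y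
    simp [mul]
    rfl
  add_mem' := by
    intro d e hd he x y
    simp only [LinearMap.add_apply, hd x y, he x y, mul_add, add_mul]
    abel
  smul_mem' := by
    intro c d hd x y
    simp only [LinearMap.smul_apply, hd x y, mul_smul, smul_mul, smul_add]
  lie_mem' := by
    intro d e hd he x y
    have hsub : ∀ a b c : Oct, mul (a - b) c = mul a c - mul b c := by
      intro a b c
      rw [eq_sub_iff_add_eq, ← add_mul, sub_add_cancel]
    have hsub' : ∀ a b c : Oct, mul a (b - c) = mul a b - mul a c := by
      intro a b c
      rw [eq_sub_iff_add_eq, ← mul_add, sub_add_cancel]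
    simp only [LieRing.of_associative_ring_bracket, LinearMap.sub_apply, Module.End.mul_apply,
      hd _ _, he _ _, map_add, hsub, hsub']
    abel

/-- The Lie algebra `so(7)` in its spin representation on the octonions. The left multiplications by
imaginary octonions satisfy the Clifford relations `L_x ^ 2 = - N(x)`, and `so(7)` is spanned by
their commutators. -/
def spin7 : LieSubalgebra ℂ (Module.End ℂ Oct) :=
  LieSubalgebra.lieSpan ℂ (Module.End ℂ Oct)
    {f | ∃ x ∈ imag, ∃ y ∈ imag, f = ⁅mulLeft x, mulLeft y⁆}

/-- The standard derivation `z ↦ [[x, y], z] - 3 ((x y) z - x (y z))` of the octonions. -/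
def stdDer (x y z : Oct) : Oct := comm (comm x y) z - (3 : ℂ) • assoc x y z

/-- The (up to a factor unique) `so(7)`-equivariant alternating map from pairs of spinors to
`so(7)`, where `(x, y)` is sent to the endomorphism `z ↦ spinMap x y z`. -/
def spinMap (x y z : Oct) : Oct :=
  (3 : ℂ) • (form y z • x - form x z • y) -
    (mul (mul x (conj y)) z - mul (mul z (conj y)) x)

end Oct

/-! ### The exceptional superalgebras `G(3)` and `F(4)` -/

/-- `g` is isomorphic to the superalgebra with even part `K × sl(2)` and odd part `V ⊗ ℂ²` (as pairs
`(x 0, x 1)` of elements of `V`, standing for `x 0 ⊗ e₀ + x 1 ⊗ e₁`), where `K` is a Lie algebra of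
endomorphisms of the octonions that preserves the subspace `V`, and the bracket of odd elements is
`[x ⊗ v, y ⊗ w] = (symp v w • D x y, (c * (x, y)) • sympSq v w)`. -/
def IsOctonionic (K : LieSubalgebra ℂ (Module.End ℂ Oct)) (V : Submodule ℂ Oct)
    (D : Oct → Oct → Oct → Oct) (c : ℂ) (g₀ g₁ : Type*) [LieRing g₀] [LieAlgebra ℂ g₀]
    [AddCommGroup g₁] [Module ℂ g₁] [LieRingModule g₀ g₁] [LieModule ℂ g₀ g₁]
    [LieSuperalgebra g₀ g₁] : Prop :=
  ∃ (e₀ : g₀ ≃ₗ⁅ℂ⁆ (K × sl2)) (ρ₁ : g₁ →ₗ[ℂ] (Fin 2 → Oct)),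
    Function.Injective ρ₁ ∧ Set.range ρ₁ = {f | ∀ i, f i ∈ V} ∧
    (∀ (u : g₀) (x : g₁) (i : Fin 2),
      ρ₁ ⁅u, x⁆ i = ((e₀ u).1 : Module.End ℂ Oct) (ρ₁ x i) +
        ∑ j, ((e₀ u).2 : Matrix (Fin 2) (Fin 2) ℂ) i j • ρ₁ x j) ∧
    (∀ (x y : g₁) (z : Oct),
      ((e₀ (LieSuperalgebra.oddBracket x y)).1 : Module.End ℂ Oct) z =
        ∑ i, ∑ j, symp (Pi.single i 1) (Pi.single j 1) • D (ρ₁ x i) (ρ₁ y j) z) ∧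
    (∀ x y : g₁,
      ((e₀ (LieSuperalgebra.oddBracket x y)).2 : Matrix (Fin 2) (Fin 2) ℂ) =
        ∑ i, ∑ j, (c * Oct.form (ρ₁ x i) (ρ₁ y j)) • sympSq (Pi.single i 1) (Pi.single j 1))

/-- `g` is isomorphic to `G(3)`: even part `G₂ × sl(2)`, odd part (7-dimensional) `⊗ ℂ²`. -/
def IsG3 (g₀ g₁ : Type*) [LieRing g₀] [LieAlgebra ℂ g₀] [AddCommGroup g₁]
    [Module ℂ g₁] [LieRingModule g₀ g₁] [LieModule ℂ g₀ g₁] [LieSuperalgebra g₀ g₁] : Prop :=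
  IsOctonionic Oct.derivations Oct.imag Oct.stdDer (-2) g₀ g₁

/-- `g` is isomorphic to `F(4)`: even part `so(7) × sl(2)`, odd part (8-dimensional spinors)
`⊗ ℂ²`. -/
def IsF4 (g₀ g₁ : Type*) [LieRing g₀] [LieAlgebra ℂ g₀] [AddCommGroup g₁]
    [Module ℂ g₁] [LieRingModule g₀ g₁] [LieModule ℂ g₀ g₁] [LieSuperalgebra g₀ g₁] : Prop :=
  IsOctonionic Oct.spin7 ⊤ Oct.spinMap 3 g₀ g₁

/-- Basic classical Lie superalgebras: `sl(m|n)` with `m ≠ n`, `gl(m|n)`, `osp(m|2n)`, `D(2|1;a)` with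
`a ≠ 0, -1`, `F(4)` and `G(3)`, up to isomorphism. -/
def IsBasicClassical (g₀ g₁ : Type*) [LieRing g₀] [LieAlgebra ℂ g₀] [AddCommGroup g₁]
    [Module ℂ g₁] [LieRingModule g₀ g₁] [LieModule ℂ g₀ g₁] [LieSuperalgebra g₀ g₁] : Prop :=
  (∃ m n : ℕ, m ≠ n ∧ IsMatrixSuperalgebra g₀ g₁ (slEven m n) (glOdd m n)) ∨
  (∃ m n : ℕ, IsMatrixSuperalgebra g₀ g₁ (glEven m n) (glOdd m n)) ∨
  (∃ m n : ℕ, IsMatrixSuperalgebra g₀ g₁ (ospEven m n) (ospOdd m n)) ∨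
  (∃ a : ℂ, a ≠ 0 ∧ a ≠ -1 ∧ IsD21 a g₀ g₁) ∨
  IsF4 g₀ g₁ ∨ IsG3 g₀ g₁

/-! ### Roots and iso-sets -/

section Roots

variable {g₀ : Type*} [LieRing g₀] [LieAlgebra ℂ g₀]

/-- The nonzero weights of a Cartan subalgebra `t` of `g₀` on a `g₀`-module `M`. For `M = g₀` this is
the set `Δ₀` of even roots, for `M = g₁` the set `Δ₁` of odd roots. -/
def rootSet (t : LieSubalgebra ℂ g₀) [t.IsCartanSubalgebra] (M : Type*) [AddCommGroup M]
    [Module ℂ M] [LieRingModule g₀ M] [LieModule ℂ g₀ M] : Set (Module.Dual ℂ t) :=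
  {α | α ≠ 0 ∧ LieModule.weightSpace M (α : t → ℂ) ≠ ⊥}

/-- Iso-sets: linearly independent sets `A` of odd roots such that `α + β` is not an even root
whenever `α` and `β` are odd roots in `A ∪ -A`. -/
structure IsIsoSet (t : LieSubalgebra ℂ g₀) [t.IsCartanSubalgebra] (g₁ : Type*) [AddCommGroup g₁]
    [Module ℂ g₁] [LieRingModule g₀ g₁] [LieModule ℂ g₀ g₁]
    (A : Finset (Module.Dual ℂ t)) : Prop where
  subset : ∀ α ∈ A, α ∈ rootSet t g₁
  linearIndep : LinearIndependent ℂ (fun α : A => (α : Module.Dual ℂ t))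
  add_notMem : ∀ α ∈ rootSet t g₁, ∀ β ∈ rootSet t g₁,
    (α ∈ A ∨ -α ∈ A) → (β ∈ A ∨ -β ∈ A) → α + β ∉ rootSet t g₀

/-- `B₀` on `g₀` and `B₁` on `g₁` form an even, supersymmetric, invariant, nondegenerate bilinear form
on `g = g₀ ⊕ g₁` (for which `g₀` and `g₁` are orthogonal). -/
structure IsInvariantForm {g₁ : Type*} [AddCommGroup g₁] [Module ℂ g₁] [LieRingModule g₀ g₁]
    [LieModule ℂ g₀ g₁] [LieSuperalgebra g₀ g₁]
    (B₀ : LinearMap.BilinForm ℂ g₀) (B₁ : LinearMap.BilinForm ℂ g₁) : Prop where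
  symm : ∀ u v : g₀, B₀ u v = B₀ v u
  skew : ∀ x y : g₁, B₁ x y = -B₁ y x
  lie_even : ∀ u v w : g₀, B₀ ⁅u, v⁆ w = B₀ u ⁅v, w⁆
  lie_odd : ∀ (u : g₀) (x y : g₁), B₁ ⁅u, x⁆ y = B₀ u (LieSuperalgebra.oddBracket x y)
  nondegenerate_even : B₀.Nondegenerate
  nondegenerate_odd : B₁.Nondegenerate

/-- `A^⊥`, the set of weights `μ` with `(μ, β) = 0` for all `β ∈ A`, i.e. with `μ b = 0` where `b ∈ t`
is the element that corresponds to `β` under the isomorphism `t → t^*` induced by the form. -/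
def perp (t : LieSubalgebra ℂ g₀) (B₀ : LinearMap.BilinForm ℂ g₀)
    (A : Finset (Module.Dual ℂ t)) : Set (Module.Dual ℂ t) :=
  {μ | ∀ β ∈ A, ∀ b : t, (∀ h : t, B₀ (b : g₀) (h : g₀) = β h) → μ b = 0}

end Roots

/-! ### The action of `G₀` and dimensions of orbits -/

/-- The exponential of an endomorphism of a finite-dimensional complex vector space, computed in a
basis (it does not depend on the basis). -/
def expEnd {V : Type*} [AddCommGroup V] [Module ℂ V] [Module.Finite ℂ V] (f : Module.End ℂ V) :
    Module.End ℂ V :=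
  LinearMap.toMatrix (Module.finBasis ℂ V) (Module.finBasis ℂ V) |>.symm
    (NormedSpace.exp (LinearMap.toMatrix (Module.finBasis ℂ V) (Module.finBasis ℂ V) f))

/-- The image in `GL(g₁)` of the connected group `G₀` with Lie algebra `g₀`: the subgroup generated
by the operators `exp (ad u)` with `u ∈ g₀`. -/
def adjointGroup (g₀ g₁ : Type*) [LieRing g₀] [LieAlgebra ℂ g₀] [AddCommGroup g₁]
    [Module ℂ g₁] [LieRingModule g₀ g₁] [LieModule ℂ g₀ g₁] [Module.Finite ℂ g₁] :
    Subgroup (LinearMap.GeneralLinearGroup ℂ g₁) :=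
  Subgroup.closure {T | ∃ u : g₀, (T : Module.End ℂ g₁) = expEnd (LieModule.toEnd ℂ g₀ g₁ u)}

/-- The orbit `G₀ x` of an odd element `x`. -/
def orbit (g₀ : Type*) {g₁ : Type*} [LieRing g₀] [LieAlgebra ℂ g₀] [AddCommGroup g₁]
    [Module ℂ g₁] [LieRingModule g₀ g₁] [LieModule ℂ g₀ g₁] [Module.Finite ℂ g₁] (x : g₁) : Set g₁ :=
  MulAction.orbit (adjointGroup g₀ g₁) x

/-- The ring of polynomial functions on a subset `S` of a complex vector space: the subalgebra of all
functions on `S` that is generated by the restrictions of linear forms. If the space is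
finite-dimensional, it is the coordinate ring of the Zariski closure of `S`. -/
def polyFunctionRing {V : Type*} [AddCommGroup V] [Module ℂ V] (S : Set V) :
    Subalgebra ℂ (S → ℂ) :=
  Algebra.adjoin ℂ (Set.range fun (φ : Module.Dual ℂ V) (s : S) => φ (s : V))

/-- The dimension of a subset `S` of a finite-dimensional complex vector space as an algebraic variety:
the Krull dimension of the coordinate ring of its Zariski closure. -/
def algDim {V : Type*} [AddCommGroup V] [Module ℂ V] (S : Set V) : WithBot ℕ∞ :=
  ringKrullDim (polyFunctionRing S)

end LieSuper

end

/-! Write `X` for the sum of the vectors `x β`. An orbit has the dimension of its tangent space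
`[g₀, X]`, so the formula is a rank computation together with a comparison between the algebraic
dimension and the tangent space.

Rank (`two_mul_finrank_tangent`). Nondegeneracy of the form gives vectors `y_β` of weight `-β` for
which `h_β = [x_β, y_β]` lies in `t` and represents `β`. The iso-set condition and the Jacobi
identity give `[X, X] = 0`, `β(h_γ) = 0`, and `[x_β, y_γ] = 0` for `β ≠ γ`. Take a generic
combination `H = ∑ c_β h_β` and put `Y = ∑ c_β y_β`. Then `[X, Y] = H`, so `ad X` is a differential
and `ad Y` is a homotopy from `0` to `D = ad H`. Therefore `ad X` is exact on the image of `D`. Its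
two components `g₀ → g₁` and `g₁ → g₀` are adjoint for the form, so this image contributes half the
rank of `D` on `g₁` to the tangent space. On the kernel of `D` the tangent space is just the span of
the `x_β`: a root `α` with `α(H) = 0` vanishes on all `h_β`, and then an `sl(2)` argument
(`lie_eq_zero_of_isotropic`) shows that its root vectors kill every `x_β`. This span contributes
`|A|`.

Multiplicities. The rank of `D` on `g₁` is the number of odd roots outside `A^⊥` because odd weights
are simple. In each family some even element has simple spectrum on `g₁`. Nonvanishing of a
discriminant is polynomial and conjugation invariant, and the conjugates of a Cartan subalgebra
contain an open set, so every Cartan subalgebra contains such an element.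

Dimension (`algDim_orbit_eq_finrank_tangent`). The closure of the orbit is the closure of the image
of a polynomial map: the torus orbit `∑ c_i x_i`, moved by finitely many unipotent one-parameter
groups. A map whose vanishing ideal has minimal height has an ideal stable under all of `g₀`. The
coordinate ring is then a finitely generated subalgebra of a polynomial ring, with Krull dimension
bounded above by the Jacobian rank, hence by the tangent space. It is bounded below because some
linear forms map the orbit onto a set with interior.

The classification enters only through `IsQuadraticWithSimpleSpectrum`, which is checked for each
family. -/

/-! ### Krull dimension of subalgebras of polynomial rings and Jacobian rank -/

theorem ringKrullDim_eq_of_isIntegral_of_injective {R S : Type*} [CommRing R] [CommRing S]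
    [Algebra R S] [Algebra.IsIntegral R S] (hinj : Function.Injective (algebraMap R S)) :
    ringKrullDim S = ringKrullDim R := by
  apply le_antisymm
  -- Incomparability bounds chains of `S` by chains of `R`; lying over and going up lift chains
  -- back.
  · refine Order.krullDim_le_of_strictMono (PrimeSpectrum.comap (algebraMap R S)) ?_
    intro p q hpq
    exact Ideal.IsIntegral.comap_lt_comap (R := R) (I := p.asIdeal) (J := q.asIdeal) hpq
  · refine iSup_le fun l => ?_
    obtain ⟨Q, -, hQ, hQl⟩ := Ideal.exists_ideal_over_prime_of_isIntegral (S := S) l.head.asIdeal ⊥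
      (by
        intro r hr
        have : r = 0 := hinj (by simpa using hr)
        simp [this])
    have : Q.LiesOver l.head.asIdeal := ⟨hQl.symm⟩
    obtain ⟨L, hL, -, -⟩ := Ideal.exists_ltSeries_of_hasGoingUp l Q
    rw [← hL]
    exact le_iSup (fun p : LTSeries (PrimeSpectrum S) => (p.length : WithBot ℕ∞)) L

theorem MvPolynomial.exists_eval_ne_zero {K σ : Type*} [Field K] [Infinite K] {p : MvPolynomial σ K}
    (hp : p ≠ 0) : ∃ z, MvPolynomial.eval z p ≠ 0 := by
  by_contra! h
  exact hp (MvPolynomial.funext fun z => by simpa using h z)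

section Jacobian

open MvPolynomial

variable {K σ : Type*} [Field K] 

/-- The gradient of a polynomial, as a derivation with values in vectors of rational functions. -/
noncomputable def gradFrac (K σ : Type*) [Field K] [DecidableEq σ] :
    Derivation K (MvPolynomial σ K) (σ → FractionRing (MvPolynomial σ K)) :=
  mkDerivation K fun i => Pi.single i 1

theorem gradFrac_apply [DecidableEq σ] (p : MvPolynomial σ K) (j : σ) :
    gradFrac K σ p j = algebraMap _ (FractionRing (MvPolynomial σ K)) (pderiv j p) := by
  let ev : (σ → FractionRing (MvPolynomial σ K)) →ₗ[MvPolynomial σ K]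
      FractionRing (MvPolynomial σ K) := LinearMap.proj j
  let al : MvPolynomial σ K →ₗ[MvPolynomial σ K] FractionRing (MvPolynomial σ K) :=
    Algebra.linearMap _ _
  have : ev.compDer (gradFrac K σ) = al.compDer (pderiv j) := by
    apply MvPolynomial.derivation_ext
    intro i
    change gradFrac K σ (X i) j =
      algebraMap (MvPolynomial σ K) (FractionRing (MvPolynomial σ K)) (pderiv j (X i))
    rw [gradFrac, mkDerivation_X, pderiv_X]
    by_cases h : i = j
    · subst h; simp
    · rw [Pi.single_eq_of_ne (Ne.symm h), Pi.single_eq_of_ne h]; simp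
  exact Derivation.congr_fun this p

theorem Derivation.mem_span_of_mem_adjoin {K A L M : Type*} [CommRing K] [CommRing A] [Algebra K A] [Field L]
    [Algebra A L] [AddCommGroup M] [Module K M] [Module A M] [Module L M]
    [IsScalarTower A L M] (d : Derivation K A M) {T : Set A} {a : A} (ha : a ∈ Algebra.adjoin K T) :
    d a ∈ Submodule.span L (d '' T) := by
  induction ha using Algebra.adjoin_induction with
  | mem x hx => exact Submodule.subset_span ⟨x, hx, rfl⟩
  | algebraMap r => simp
  | add x y _ _ hx hy => rw [map_add]; exact add_mem hx hy
  | mul x y _ _ hx hy =>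
    rw [d.leibniz, ← algebraMap_smul L x, ← algebraMap_smul L y]
    exact add_mem (Submodule.smul_mem _ _ hy) (Submodule.smul_mem _ _ hx)

/-- Differentiate a relation `P(a) = 0` of minimal degree: `P'(a) da` is minus the sum of the `a^k
dP_k`. Minimality and characteristic zero make `P'(a)` nonzero, so it can be divided out over `L`.
-/
theorem Derivation.mem_span_of_isAlgebraic {K A L M : Type*} [Field K] [CharZero K] [CommRing A]
    [IsDomain A] [Algebra K A] [Field L]
    [Algebra A L] [FaithfulSMul A L] [AddCommGroup M] [Module K M] [Module A M] [Module L M]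
    [IsScalarTower A L M] (d : Derivation K A M) {T : Set A} {a : A}
    (ha : IsAlgebraic (Algebra.adjoin K T) a) :
    d a ∈ Submodule.span L (d '' T) := by
  classical
  have hex : ∃ n, ∃ P : Polynomial (Algebra.adjoin K T), P ≠ 0 ∧ Polynomial.aeval a P = 0 ∧
      P.natDegree = n := by
    obtain ⟨P, hP, h⟩ := ha
    exact ⟨_, P, hP, h, rfl⟩
  obtain ⟨P, hP, hPa, hdeg⟩ := Nat.find_spec hex
  have hmin := fun m => Nat.find_min hex (m := m)
  set n := Nat.find hex
  have hn : n ≠ 0 := by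
    intro h0
    rw [h0] at hdeg
    rw [Polynomial.eq_C_of_natDegree_eq_zero hdeg] at hPa hP
    rw [Polynomial.aeval_C] at hPa
    apply hP
    have : P.coeff 0 = 0 := by
      apply Subtype.ext
      simpa using hPa
    rw [this, map_zero]
  have hder : Polynomial.aeval a P.derivative ≠ 0 := by
    intro h
    refine hmin P.derivative.natDegree ?_ ⟨P.derivative, ?_, h, rfl⟩
    · rw [← hdeg]; exact Polynomial.natDegree_derivative_lt (by omega)
    · intro h0
      have : P.coeff n * n = 0 := by
        have := congrArg (fun Q => Q.coeff (n - 1)) h0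
        simp only [Polynomial.coeff_derivative, Polynomial.coeff_zero] at this
        rwa [Nat.sub_add_cancel (by omega), ← Nat.cast_add_one, Nat.sub_add_cancel (by omega)] at this
      rcases mul_eq_zero.1 this with h | h
      · rw [← hdeg, Polynomial.coeff_natDegree, Polynomial.leadingCoeff_eq_zero] at h
        exact hP h
      · have h2 := congrArg (algebraMap (Algebra.adjoin K T) A) h
        rw [map_zero] at h2
        have h2 : ((n : ℕ) : A) = 0 := by simpa using h2
        rw [← _root_.map_natCast (algebraMap K A)] at h2
        exact hn (Nat.cast_eq_zero.1 ((map_eq_zero_iff _ (algebraMap K A).injective).1 h2))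
  have hsum : d (Polynomial.aeval a P) = ∑ k ∈ Finset.range (P.natDegree + 1),
      ((a ^ k) • d (P.coeff k : A)) + (Polynomial.aeval a P.derivative) • d a := by
    rw [Polynomial.derivative_apply, Polynomial.sum_over_range' _ _ (P.natDegree + 1) (by omega),
      Polynomial.aeval_eq_sum_range, map_sum, map_sum, Finset.sum_smul, ← Finset.sum_add_distrib]
    · refine Finset.sum_congr rfl fun k _ => ?_
      rw [Algebra.smul_def, d.leibniz, d.leibniz_pow, add_comm]
      simp only [map_mul, Polynomial.aeval_C, Polynomial.aeval_X_pow,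
        _root_.map_natCast]
      congr 1
      rw [← Nat.cast_smul_eq_nsmul A, smul_smul, smul_smul]
    · simp
  rw [hPa, map_zero] at hsum
  have h2 : (Polynomial.aeval a P.derivative) • d a = - ∑ k ∈ Finset.range (P.natDegree + 1),
      ((a ^ k) • d (P.coeff k : A)) := by
    rw [eq_neg_iff_add_eq_zero, add_comm]; exact hsum.symm
  have h3 : (Polynomial.aeval a P.derivative) • d a ∈ Submodule.span L (d '' T) := by
    rw [h2]
    refine neg_mem (sum_mem fun k _ => ?_)
    rw [← algebraMap_smul L (a ^ k)]
    exact Submodule.smul_mem _ _ (d.mem_span_of_mem_adjoin (P.coeff k).2)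
  rw [← algebraMap_smul L] at h3
  refine (Submodule.smul_mem_iff _ ?_).1 h3
  simpa using hder

/-- Enlarge `f` by variables to a transcendence basis `T`. Each variable is algebraic over `T`, so
the gradients of `T` span everything; there are exactly as many of them as variables, so they are
independent. -/
theorem AlgebraicIndependent.linearIndependent_gradFrac [CharZero K] [Fintype σ] [DecidableEq σ]
    {ι : Type*} {f : ι → MvPolynomial σ K} (hf : AlgebraicIndependent K f) :
    LinearIndependent (FractionRing (MvPolynomial σ K)) fun i => gradFrac K σ (f i) := by
  classical
  set L := FractionRing (MvPolynomial σ K)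
  have halg : Algebra.IsAlgebraic
      (Algebra.adjoin K (Set.range f ∪ Set.range (X : σ → MvPolynomial σ K)))
      (MvPolynomial σ K) := by
    refine ⟨fun p => isAlgebraic_algebraMap (⟨p, ?_⟩ :
      Algebra.adjoin K (Set.range f ∪ Set.range (X : σ → MvPolynomial σ K)))⟩
    have : p ∈ Algebra.adjoin K (Set.range (X : σ → MvPolynomial σ K)) := by
      rw [MvPolynomial.adjoin_range_X]; trivial
    exact Algebra.adjoin_mono Set.subset_union_right this
  obtain ⟨T, hfT, -, hT⟩ := exists_isTranscendenceBasis_between (R := K) (Set.range f)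
    (Set.range f ∪ Set.range (X : σ → MvPolynomial σ K)) Set.subset_union_left
    hf.to_subtype_range
  have hcard := hT.lift_cardinalMk_eq_trdeg
  rw [MvPolynomial.trdeg_of_isDomain] at hcard
  have hTfin : Finite T := by
    have : Cardinal.mk T < Cardinal.aleph0 := by
      rw [← Cardinal.lift_lt_aleph0, hcard]
      simp
    exact Cardinal.lt_aleph0_iff_finite.1 this
  have := Fintype.ofFinite T
  have hcard' : Fintype.card T = Module.finrank L (σ → L) := by
    rw [Module.finrank_fintype_fun_eq_card]
    have := congrArg Cardinal.toNat hcard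
    simpa using this
  have hspan : ⊤ ≤ Submodule.span L (Set.range fun t : T => gradFrac K σ (t : MvPolynomial σ K)) := by
    have hX : ∀ i, (Pi.single i 1 : σ → L) ∈
        Submodule.span L (Set.range fun t : T => gradFrac K σ (t : MvPolynomial σ K)) := by
      intro i
      have h := hT.isAlgebraic
      rw [Subtype.range_coe] at h
      have h2 := Derivation.mem_span_of_isAlgebraic (L := L) (gradFrac K σ) (h.isAlgebraic (X i))
      rw [gradFrac, mkDerivation_X, Set.image_eq_range] at h2
      exact h2
    rw [← (Pi.basisFun L σ).span_eq, Submodule.span_le]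
    rintro _ ⟨i, rfl⟩
    rw [Pi.basisFun_apply]
    exact hX i
  have hli := linearIndependent_of_top_le_span_of_card_eq_finrank hspan hcard'
  exact hli.comp (fun i => (⟨f i, hfT ⟨i, rfl⟩⟩ : T)) fun i j hij =>
    hf.injective (congrArg Subtype.val hij)

/-- Independence over the fraction field gives a one-sided inverse of the Jacobian matrix. After
clearing denominators, Jacobian times `B` equals `b` times the identity, an identity of polynomials
that can be specialized wherever `b` does not vanish. -/
theorem exists_forall_linearIndependent_eval [Fintype σ] [DecidableEq σ]
    {ι : Type*} [Finite ι] {f : ι → MvPolynomial σ K}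
    (hf : LinearIndependent (FractionRing (MvPolynomial σ K)) fun i => gradFrac K σ (f i)) :
    ∃ s : MvPolynomial σ K, s ≠ 0 ∧ ∀ z, eval z s ≠ 0 →
      LinearIndependent K fun i j => eval z (pderiv j (f i)) := by
  classical
  have := Fintype.ofFinite ι
  set L := FractionRing (MvPolynomial σ K)
  obtain ⟨g, hg⟩ := ((Fintype.linearCombination L fun i => gradFrac K σ (f i))).exists_leftInverse_of_injective
    (LinearMap.ker_eq_bot.2 (linearIndependent_iff_injective_fintypeLinearCombination.1 hf))
  obtain ⟨b, hb⟩ := IsLocalization.exist_integer_multiples_of_finite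
    (nonZeroDivisors (MvPolynomial σ K)) (fun p : σ × ι => g (Pi.single p.1 1) p.2)
  choose B hB using hb
  have key : ∀ i k, ∑ j, pderiv j (f i) * B (j, k) = if i = k then (b : MvPolynomial σ K) else 0 := by
    intro i k
    apply IsFractionRing.injective (MvPolynomial σ K) L
    have h1 := congrFun (LinearMap.congr_fun hg (Pi.single i 1)) k
    simp only [LinearMap.comp_apply, LinearMap.id_apply, Fintype.linearCombination_apply_single,
      one_smul] at h1
    have h2 : gradFrac K σ (f i) = ∑ j, gradFrac K σ (f i) j • (Pi.single j 1 : σ → L) := by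
      exact pi_eq_sum_univ' _
    rw [h2, map_sum, Finset.sum_apply] at h1
    simp only [map_smul, Pi.smul_apply, smul_eq_mul, gradFrac_apply] at h1
    simp only [map_sum, map_mul, hB]
    simp only [Algebra.smul_def, mul_left_comm _ (algebraMap _ L (b : MvPolynomial σ K))]
    rw [← Finset.mul_sum, h1]
    by_cases h : i = k
    · subst h; simp
    · rw [Pi.single_eq_of_ne (Ne.symm h), if_neg h]; simp
  refine ⟨b, nonZeroDivisors.ne_zero b.2, fun z hz => ?_⟩
  rw [Fintype.linearIndependent_iff]
  intro c hc k
  have h1 : ∑ j, (∑ i, c i * eval z (pderiv j (f i))) * eval z (B (j, k)) = 0 := by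
    refine Finset.sum_eq_zero fun j _ => ?_
    have := congrFun hc j
    simp only [Finset.sum_apply, Pi.smul_apply, smul_eq_mul, Pi.zero_apply] at this
    rw [this, zero_mul]
  simp only [Finset.sum_mul] at h1
  rw [Finset.sum_comm] at h1
  have h2 : ∀ i, ∑ j, c i * eval z (pderiv j (f i)) * eval z (B (j, k)) =
      c i * if i = k then eval z (b : MvPolynomial σ K) else 0 := by
    intro i
    have := congrArg (eval z) (key i k)
    rw [map_sum, apply_ite (eval z), map_zero] at this
    rw [← this, Finset.mul_sum]
    refine Finset.sum_congr rfl fun j _ => ?_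
    rw [map_mul, mul_assoc]
  simp only [h2] at h1
  simpa [hz] using h1

/-- The gradients of the `f i` are independent and lie in the span of the gradients of the `φ k`, so
the generic Jacobian rank of `φ` is at least the number of the `f i`. A point avoiding both bad loci
compares it with `r`. -/
theorem card_le_of_algebraicIndependent_adjoin [CharZero K] [Fintype σ] [DecidableEq σ]
    {κ ι : Type*} [Finite κ] [Fintype ι] {φ : κ → MvPolynomial σ K} {q : MvPolynomial σ K}
    (hq : q ≠ 0) {r : ℕ}
    (hr : ∀ z, eval z q ≠ 0 → Module.finrank K
      (Submodule.span K (Set.range fun i j => eval z (pderiv j (φ i)))) ≤ r)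
    {f : ι → MvPolynomial σ K} (hf : AlgebraicIndependent K f)
    (hφ : ∀ i, f i ∈ Algebra.adjoin K (Set.range φ)) : Fintype.card ι ≤ r := by
  classical
  set L := FractionRing (MvPolynomial σ K)
  have hli := hf.linearIndependent_gradFrac
  have hmem : ∀ i, gradFrac K σ (f i) ∈ Submodule.span L (Set.range fun k => gradFrac K σ (φ k)) := by
    intro i
    have := Derivation.mem_span_of_mem_adjoin (L := L) (gradFrac K σ) (hφ i)
    rwa [← Set.range_comp] at this
  obtain ⟨b, hb, hspan, hbli⟩ := exists_linearIndependent L (Set.range fun k => gradFrac K σ (φ k))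
  choose c hc using hb
  have hcard : Fintype.card ι ≤ Nat.card b := by
    have hfin : Finite b := (Set.finite_range fun k => gradFrac K σ (φ k)).subset
      (fun x hx => ⟨_, hc hx⟩)
    have := Fintype.ofFinite b
    have h1 : Fintype.card ι ≤ Module.finrank L (Submodule.span L b) := by
      have := (LinearIndependent.of_comp (Submodule.span L b).subtype
        (v := fun i => (⟨gradFrac K σ (f i), hspan ▸ hmem i⟩ : Submodule.span L b)) hli)
      exact this.fintype_card_le_finrank
    rw [Nat.card_eq_fintype_card]
    refine h1.trans (le_of_eq ?_)
    have := finrank_span_eq_card hbli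
    rwa [Subtype.range_coe] at this
  refine hcard.trans ?_
  have hfin : Finite b := (Set.finite_range fun k => gradFrac K σ (φ k)).subset
      (fun x hx => ⟨_, hc hx⟩)
  have := Fintype.ofFinite b
  have hli2 : LinearIndependent L fun x : b => gradFrac K σ (φ (c x.2)) := by
    have : (fun x : b => gradFrac K σ (φ (c x.2))) = Subtype.val := funext fun x => hc x.2
    rw [this]
    exact hbli
  obtain ⟨s, hs, hsz⟩ := exists_forall_linearIndependent_eval hli2
  obtain ⟨z, hz⟩ := MvPolynomial.exists_eval_ne_zero (mul_ne_zero hs hq)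
  rw [map_mul] at hz
  have h3 := hsz z (left_ne_zero_of_mul hz)
  refine le_trans ?_ (hr z (right_ne_zero_of_mul hz))
  rw [Nat.card_eq_fintype_card, ← finrank_span_eq_card h3]
  refine Submodule.finrank_mono (Submodule.span_mono ?_)
  rintro _ ⟨x, rfl⟩
  exact ⟨_, rfl⟩

/-- Noether normalization makes the algebra integral over a polynomial ring in `k` variables. The
Jacobian bound gives `k ≤ r`, and transcendence degree gives `r ≤ k`. -/
theorem ringKrullDim_adjoin_eq [CharZero K] [Fintype σ] [DecidableEq σ]
    {κ : Type*} [Finite κ] {φ : κ → MvPolynomial σ K} {q : MvPolynomial σ K}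
    (hq : q ≠ 0) {r : ℕ}
    (hr : ∀ z, eval z q ≠ 0 → Module.finrank K
      (Submodule.span K (Set.range fun i j => eval z (pderiv j (φ i)))) ≤ r)
    {f : Fin r → MvPolynomial σ K} (hf : AlgebraicIndependent K f)
    (hφ : ∀ i, f i ∈ Algebra.adjoin K (Set.range φ)) :
    ringKrullDim (Algebra.adjoin K (Set.range φ)) = r := by
  set R := Algebra.adjoin K (Set.range φ)
  have : Algebra.FiniteType K R := by
    rw [← Subalgebra.fg_iff_finiteType]
    exact Subalgebra.fg_def.2 ⟨_, Set.finite_range φ, rfl⟩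
  obtain ⟨k, g, hg, hint⟩ := exists_integral_inj_algHom_of_fg K R
  let := g.toRingHom.toAlgebra
  have : Algebra.IsIntegral (MvPolynomial (Fin k) K) R := ⟨hint⟩
  have : IsScalarTower K (MvPolynomial (Fin k) K) R := IsScalarTower.of_algHom g
  have hinj : Function.Injective (algebraMap (MvPolynomial (Fin k) K) R) := hg
  rw [ringKrullDim_eq_of_isIntegral_of_injective hinj,
    MvPolynomial.ringKrullDim_of_isNoetherianRing, ringKrullDim_eq_zero_of_field, zero_add]
  have hgX : AlgebraicIndependent K fun i => g (X i) := by
    have := (MvPolynomial.algebraicIndependent_X (Fin k) K).map' (f := g) hg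
    exact this
  have hk : k ≤ r := by
    have := card_le_of_algebraicIndependent_adjoin (f := fun i => ((g (X i) : R) : MvPolynomial σ K))
      hq hr (hgX.map' (f := R.val) Subtype.val_injective) (fun i => (g (X i)).2)
    simpa using this
  have hk' : r ≤ k := by
    have hf' : AlgebraicIndependent K fun i => (⟨f i, hφ i⟩ : R) :=
      AlgebraicIndependent.of_comp R.val hf
    have htr : IsTranscendenceBasis K fun i => g (X i) := by
      refine (AlgebraicIndependent.isTranscendenceBasis_iff_isAlgebraic hgX).2 ⟨fun x => ?_⟩
      let g' : MvPolynomial (Fin k) K →+* Algebra.adjoin K (Set.range fun i => g (X i)) :=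
        (g.codRestrict _ fun p => by
          rw [Algebra.adjoin_range_eq_range_aeval]
          refine ⟨p, ?_⟩
          change aeval _ p = g p
          exact (DFunLike.congr_fun (MvPolynomial.aeval_unique g) p).symm).toRingHom
      obtain ⟨p, hp, hpx⟩ := Algebra.IsIntegral.isIntegral (R := MvPolynomial (Fin k) K) x
      refine IsIntegral.isAlgebraic ⟨p.map g', hp.map g', ?_⟩
      rw [Polynomial.eval₂_map]
      exact hpx
    have h1 := hf'.lift_cardinalMk_le_trdeg
    rw [← htr.lift_cardinalMk_eq_trdeg] at h1
    simpa using h1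
  have : k = r := le_antisymm hk hk'
  simp [this]

end Jacobian

/-! ### Exponentials of endomorphisms -/

noncomputable section

namespace LieSuper

section Exponential

theorem eq_of_forall_dual {V : Type*} [AddCommGroup V] [Module ℂ V] {v w : V} (h : ∀ l : Module.Dual ℂ V, l v = l w) : v = w := by
  rw [← sub_eq_zero, ← Module.forall_dual_apply_eq_zero_iff ℂ]
  intro l
  rw [map_sub, h, sub_self]

theorem toLin_toMatrix_pow {V ι : Type*} [AddCommGroup V] [Module ℂ V] [Fintype ι] [DecidableEq ι]
    (b : Module.Basis ι ℂ V) (f : Module.End ℂ V) (k : ℕ) :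
    Matrix.toLin b b (LinearMap.toMatrix b b f ^ k) = f ^ k := by
  induction k with
  | zero => simp [Module.End.one_eq_id]
  | succ k ih => rw [pow_succ, Matrix.toLin_mul b b b, ih, Matrix.toLin_toMatrix, pow_succ]; rfl

variable {V W : Type*} [AddCommGroup V] [Module ℂ V] [Module.Finite ℂ V]
  [AddCommGroup W] [Module ℂ W] [Module.Finite ℂ W]

-- Analysis is done after applying a linear functional, so that no norm on `V` has to be chosen;
-- functionals separate points.
open scoped Matrix.Norms.Operator in
theorem hasSum_dual_expEnd (f : Module.End ℂ V) (l : Module.Dual ℂ V) (v : V) :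
    HasSum (fun k : ℕ => ((k.factorial : ℂ)⁻¹) * l ((f ^ k) v)) (l (expEnd f v)) := by
  set b := Module.finBasis ℂ V
  set M := LinearMap.toMatrix b b f
  let F : Matrix _ _ ℂ →ₗ[ℂ] ℂ := l ∘ₗ (LinearMap.applyₗ v) ∘ₗ (Matrix.toLin b b).toLinearMap
  have hF : Continuous F := LinearMap.continuous_of_finiteDimensional F
  have h1 := NormedSpace.exp_series_hasSum_exp' (𝕂 := ℂ) M
  have h2 := h1.map F hF
  have h3 : ∀ k : ℕ, F (M ^ k) = l ((f ^ k) v) := by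
    intro k
    change l ((Matrix.toLin b b (LinearMap.toMatrix b b f ^ k)) v) = _
    exact congrArg (fun g : Module.End ℂ V => l (g v)) (toLin_toMatrix_pow b f k)
  have h4 : (fun k : ℕ => ((k.factorial : ℂ)⁻¹) * l ((f ^ k) v)) =
      F ∘ fun k : ℕ => (k.factorial : ℂ)⁻¹ • M ^ k := by
    ext k
    rw [Function.comp_apply, map_smul, h3, smul_eq_mul]
  rw [h4]
  exact h2

theorem expEnd_intertwine {f : Module.End ℂ V} {g : Module.End ℂ W} (φ : V →ₗ[ℂ] W)
    (h : ∀ v, φ (f v) = g (φ v)) (v : V) : φ (expEnd f v) = expEnd g (φ v) := by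
  have hk : ∀ (k : ℕ) v, φ ((f ^ k) v) = (g ^ k) (φ v) := by
    intro k
    induction k with
    | zero => simp
    | succ k ih => intro v; rw [pow_succ', pow_succ', Module.End.mul_apply, Module.End.mul_apply, h, ih]
  refine eq_of_forall_dual fun l => ?_
  have h1 := hasSum_dual_expEnd f (l ∘ₗ φ) v
  have h2 := hasSum_dual_expEnd g l (φ v)
  simp only [LinearMap.comp_apply, hk] at h1
  exact h1.unique h2

theorem expEnd_apply_of_eigenvector {f : Module.End ℂ V} {c : ℂ} {v : V} (h : f v = c • v) :
    expEnd f v = Complex.exp c • v := by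
  have hk : ∀ k : ℕ, (f ^ k) v = c ^ k • v := by
    intro k
    induction k with
    | zero => simp
    | succ k ih => rw [pow_succ', Module.End.mul_apply, ih, map_smul, h, smul_smul, pow_succ]
  refine eq_of_forall_dual fun l => ?_
  have h1 := hasSum_dual_expEnd f l v
  simp only [hk, map_smul, smul_eq_mul] at h1 ⊢
  refine h1.unique ?_
  have h2 := (NormedSpace.exp_series_hasSum_exp' (𝕂 := ℂ) c).mul_right (l v)
  rw [← Complex.exp_eq_exp_ℂ] at h2
  simp only [smul_eq_mul, mul_assoc] at h2
  exact h2

theorem expEnd_apply_of_pow_eq_zero {f : Module.End ℂ V} {N : ℕ} (h : f ^ N = 0) (v : V) :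
    expEnd f v = ∑ k ∈ Finset.range N, ((k.factorial : ℂ)⁻¹) • (f ^ k) v := by
  refine eq_of_forall_dual fun l => ?_
  refine (hasSum_dual_expEnd f l v).unique ?_
  rw [map_sum]
  simp only [map_smul, smul_eq_mul]
  refine hasSum_sum_of_ne_finset_zero fun k hk => ?_
  have : f ^ k = 0 := pow_eq_zero_of_le (by simpa using hk) h
  simp [this]

theorem expEnd_zero : expEnd (0 : Module.End ℂ V) = 1 := by
  ext v
  rw [expEnd_apply_of_pow_eq_zero (N := 1) (by simp)]
  simp

theorem expEnd_add {f g : Module.End ℂ V} (h : Commute f g) :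
    expEnd (f + g) = expEnd f * expEnd g := by
  set b := Module.finBasis ℂ V
  have h1 : Commute (LinearMap.toMatrix b b f) (LinearMap.toMatrix b b g) := by
    rw [Commute, SemiconjBy, ← LinearMap.toMatrix_mul, ← LinearMap.toMatrix_mul, h.eq]
  change Matrix.toLin b b (NormedSpace.exp _) =
    Matrix.toLin b b (NormedSpace.exp _) * Matrix.toLin b b (NormedSpace.exp _)
  rw [map_add, Matrix.exp_add_of_commute _ _ h1, Matrix.toLin_mul b b b]
  rfl

theorem expEnd_mul_neg (f : Module.End ℂ V) : expEnd f * expEnd (-f) = 1 := by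
  rw [← expEnd_add (Commute.refl f).neg_right, add_neg_cancel, expEnd_zero]

theorem expEnd_neg_mul (f : Module.End ℂ V) : expEnd (-f) * expEnd f = 1 := by
  simpa using expEnd_mul_neg (-f)

open scoped Matrix.Norms.Operator in
theorem hasDerivAt_dual_expEnd (f : Module.End ℂ V) (l : Module.Dual ℂ V) (v : V) (s : ℂ) :
    HasDerivAt (fun s : ℂ => l (expEnd (s • f) v)) (l (f (expEnd (s • f) v))) s := by
  set b := Module.finBasis ℂ V
  set M := LinearMap.toMatrix b b f
  let F : Matrix _ _ ℂ →ₗ[ℂ] ℂ := l ∘ₗ (LinearMap.applyₗ v) ∘ₗ (Matrix.toLin b b).toLinearMap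
  have h1 := hasDerivAt_exp_smul_const' (𝕂 := ℂ) M s
  have h2 := (LinearMap.toContinuousLinearMap F).hasFDerivAt.comp_hasDerivAt s h1
  have h3 : l (f (expEnd (s • f) v)) = F (M * NormedSpace.exp (s • M)) := by
    change _ = l (Matrix.toLin b b (M * NormedSpace.exp (s • M)) v)
    rw [Matrix.toLin_mul b b b, LinearMap.comp_apply, Matrix.toLin_toMatrix,
      ← map_smul (LinearMap.toMatrix b b)]
    rfl
  have h4 : (fun s : ℂ => l (expEnd (s • f) v)) =
      LinearMap.toContinuousLinearMap F ∘ fun s => NormedSpace.exp (s • M) := by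
    ext s
    change l (Matrix.toLin b b (NormedSpace.exp (LinearMap.toMatrix b b (s • f))) v) = _
    rw [map_smul]
    rfl
  rw [h4, h3]
  exact h2

open scoped Matrix.Norms.Operator in
theorem hasStrictFDerivAt_dual_expEnd {E : Type*} [NormedAddCommGroup E] [NormedSpace ℂ E]
    [FiniteDimensional ℂ E] (L : E →ₗ[ℂ] Module.End ℂ V) (l : Module.Dual ℂ V) (v : V) :
    HasStrictFDerivAt (fun a : E => l (expEnd (L a) v))
      (LinearMap.toContinuousLinearMap (l ∘ₗ (LinearMap.applyₗ v) ∘ₗ L)) 0 := by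
  set b := Module.finBasis ℂ V
  let F : Matrix _ _ ℂ →ₗ[ℂ] ℂ := l ∘ₗ (LinearMap.applyₗ v) ∘ₗ (Matrix.toLin b b).toLinearMap
  let G : E →ₗ[ℂ] Matrix _ _ ℂ := (LinearMap.toMatrix b b).toLinearMap ∘ₗ L
  have h1 := hasStrictFDerivAt_exp_zero (𝕂 := ℂ) (𝔸 := Matrix (Fin (Module.finrank ℂ V)) (Fin (Module.finrank ℂ V)) ℂ)
  rw [show (0 : Matrix (Fin (Module.finrank ℂ V)) (Fin (Module.finrank ℂ V)) ℂ) =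
    LinearMap.toContinuousLinearMap G 0 by simp] at h1
  have h2 := (LinearMap.toContinuousLinearMap F).hasStrictFDerivAt.comp (0 : E) (h1.comp (0 : E)
    (LinearMap.toContinuousLinearMap G).hasStrictFDerivAt)
  refine h2.congr_fderiv ?_
  ext a
  change l (Matrix.toLin b b (LinearMap.toMatrix b b (L a)) v) = l (L a v)
  rw [Matrix.toLin_toMatrix]

end Exponential

end LieSuper
end

/-! ### The group generated by exponentials, its orbits and their tangent spaces -/

noncomputable section

namespace LieSuper

section Group

attribute [local irreducible] expEnd

variable {U V W : Type*} [AddCommGroup U] [Module ℂ U] [Module.Finite ℂ U]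
  [AddCommGroup V] [Module ℂ V] [Module.Finite ℂ V]
  [AddCommGroup W] [Module ℂ W] [Module.Finite ℂ W]

/-- The exponential of a compatible triple of derivations is compatible with a bilinear map. -/
theorem expEnd_bilinear (B : U →ₗ[ℂ] V →ₗ[ℂ] W) {f : Module.End ℂ U} {g : Module.End ℂ V}
    {h : Module.End ℂ W} (hB : ∀ u v, h (B u v) = B (f u) v + B u (g v)) (u : U) (v : V) :
    expEnd h (B u v) = B (expEnd f u) (expEnd g v) := by
  -- On the tensor product, the sum of the commuting maps `F` and `G` is intertwined with `h` by the
  -- lift of `B`, and the exponential of that sum splits as a product.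
  let F : Module.End ℂ (U ⊗[ℂ] V) := TensorProduct.map f LinearMap.id
  let G : Module.End ℂ (U ⊗[ℂ] V) := TensorProduct.map LinearMap.id g
  have hc : Commute F G := by
    refine TensorProduct.ext' fun u v => ?_
    simp [F, G, Module.End.mul_apply]
  have hlift : ∀ w, TensorProduct.lift B ((F + G) w) = h (TensorProduct.lift B w) := by
    intro w
    induction w with
    | zero => simp
    | add a b ha hb => rw [map_add, map_add, ha, hb, map_add, map_add]
    | tmul u v => simp [F, G, hB]
  have h1 := expEnd_intertwine (TensorProduct.lift B) hlift (u ⊗ₜ v)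
  have h2 : expEnd G (u ⊗ₜ v) = u ⊗ₜ[ℂ] expEnd g v :=
    (expEnd_intertwine (f := g) (g := G) (TensorProduct.mk ℂ U V u) (fun v => by simp [G]) v).symm
  have h3 : expEnd F (u ⊗ₜ expEnd g v) = expEnd f u ⊗ₜ[ℂ] expEnd g v :=
    (expEnd_intertwine (f := f) (g := F) ((TensorProduct.mk ℂ U V).flip (expEnd g v))
      (fun v => by simp [F]) u).symm
  rw [expEnd_add hc, Module.End.mul_apply, h2, h3] at h1
  simpa using h1.symm

variable (g₀ : Type*) {g₁ : Type*} [LieRing g₀] [LieAlgebra ℂ g₀] [AddCommGroup g₁]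
    [Module ℂ g₁] [LieRingModule g₀ g₁] [LieModule ℂ g₀ g₁] [Module.Finite ℂ g₁]

/-- The action of `exp u` on a module. -/
abbrev expAct {g₀ : Type*} (g₁ : Type*) [LieRing g₀] [LieAlgebra ℂ g₀] [AddCommGroup g₁]
    [Module ℂ g₁] [LieRingModule g₀ g₁] [LieModule ℂ g₀ g₁] [Module.Finite ℂ g₁] (u : g₀) :
    Module.End ℂ g₁ :=
  expEnd (LieModule.toEnd ℂ g₀ g₁ u)

theorem expAct_neg_apply (u : g₀) (y : g₁) : expAct g₁ (-u) (expAct g₁ u y) = y := by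
  have := expEnd_neg_mul (LieModule.toEnd ℂ g₀ g₁ u)
  rw [← map_neg] at this
  exact LinearMap.congr_fun this y

theorem expAct_apply_neg (u : g₀) (y : g₁) : expAct g₁ u (expAct g₁ (-u) y) = y := by
  simpa using expAct_neg_apply g₀ (-u) y

theorem expAct_lie [Module.Finite ℂ g₀] (u v : g₀) (y : g₁) :
    expAct g₁ u ⁅v, y⁆ = ⁅expAct g₀ u v, expAct g₁ u y⁆ :=
  expEnd_bilinear (LieModule.toEnd ℂ g₀ g₁ : g₀ →ₗ[ℂ] Module.End ℂ g₁)
    (f := LieModule.toEnd ℂ g₀ g₀ u) (g := LieModule.toEnd ℂ g₀ g₁ u)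
    (h := LieModule.toEnd ℂ g₀ g₁ u) (fun v y => by simp) v y

theorem expAct_oddBracket [Module.Finite ℂ g₀] [LieSuperalgebra g₀ g₁] (u : g₀) (x y : g₁) :
    expAct g₀ u (LieSuperalgebra.oddBracket x y) =
      LieSuperalgebra.oddBracket (expAct g₁ u x) (expAct g₁ u y) :=
  expEnd_bilinear (LieSuperalgebra.oddBracket (g₀ := g₀) (g₁ := g₁))
    (f := LieModule.toEnd ℂ g₀ g₁ u) (g := LieModule.toEnd ℂ g₀ g₁ u)
    (h := LieModule.toEnd ℂ g₀ g₀ u) (fun x y => by simp [LieSuperalgebra.lie_oddBracket]) x y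

theorem mem_orbit_self (x : g₁) : x ∈ orbit g₀ x := MulAction.mem_orbit_self x

/-- The action of `exp u` as an invertible operator. -/
def expUnit (u : g₀) : LinearMap.GeneralLinearGroup ℂ g₁ where
  val := expAct g₁ u
  inv := expAct g₁ (-u)
  val_inv := LinearMap.ext (expAct_apply_neg g₀ u)
  inv_val := LinearMap.ext (expAct_neg_apply g₀ u)

theorem expAct_mem_orbit {x y : g₁} (hy : y ∈ orbit g₀ x) (u : g₀) :
    expAct g₁ u y ∈ orbit g₀ x := by
  have hT : expUnit g₀ (g₁ := g₁) u ∈ adjointGroup g₀ g₁ := Subgroup.subset_closure ⟨u, rfl⟩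
  obtain ⟨S, rfl⟩ := hy
  exact ⟨⟨expUnit g₀ u, hT⟩ * S, mul_smul _ _ _⟩

theorem orbit_induction {x : g₁} {p : g₁ → Prop} (hx : p x)
    (hexp : ∀ (u : g₀) y, p y → p (expAct g₁ u y)) {y : g₁} (hy : y ∈ orbit g₀ x) : p y := by
  obtain ⟨⟨S, hS⟩, rfl⟩ := hy
  suffices h : ∀ y, p y → p (S • y) from h x hx
  have hcl : ∀ S ∈ {T : LinearMap.GeneralLinearGroup ℂ g₁ | ∃ u : g₀,
      (T : Module.End ℂ g₁) = expEnd (LieModule.toEnd ℂ g₀ g₁ u)}, ∃ u : g₀, S = expUnit g₀ u := by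
    rintro T ⟨u, hu⟩
    exact ⟨u, Units.ext hu⟩
  induction hS using Subgroup.closure_induction'' with
  | mem T hT =>
    obtain ⟨u, rfl⟩ := hcl T hT
    exact fun y hy => hexp u y hy
  | inv_mem T hT =>
    obtain ⟨u, rfl⟩ := hcl T hT
    exact fun y hy => hexp (-u) y hy
  | one => intro y hy; rwa [one_smul]
  | mul S T _ _ h1 h2 => intro y hy; rw [mul_smul]; exact h1 _ (h2 _ hy)

theorem oddBracket_self_of_mem_orbit [Module.Finite ℂ g₀] [LieSuperalgebra g₀ g₁] {x : g₁}
    (hx : LieSuperalgebra.oddBracket x x = (0 : g₀)) {y : g₁} (hy : y ∈ orbit g₀ x) :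
    LieSuperalgebra.oddBracket y y = (0 : g₀) := by
  refine orbit_induction g₀ (p := fun y => LieSuperalgebra.oddBracket y y = (0 : g₀)) hx
    (fun u y hy => ?_) hy
  rw [← expAct_oddBracket, hy, map_zero]

/-- The tangent space `[g₀, x]` of the orbit. -/
def tangent (x : g₁) : Submodule ℂ g₁ :=
  LinearMap.range ((LieModule.toEnd ℂ g₀ g₁ : g₀ →ₗ[ℂ] Module.End ℂ g₁).flip x)

theorem mem_tangent {g₀ g₁ : Type*} [LieRing g₀] [LieAlgebra ℂ g₀] [AddCommGroup g₁]
    [Module ℂ g₁] [LieRingModule g₀ g₁] [LieModule ℂ g₀ g₁] {x v : g₁} : v ∈ tangent g₀ x ↔ ∃ u : g₀, ⁅u, x⁆ = v := Iff.rfl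

/-- The operator `exp u` is injective and carries the tangent space at `y` onto the one at its
image, because it is compatible with the adjoint action of `exp u` on `g₀`. -/
theorem finrank_tangent_of_mem_orbit [Module.Finite ℂ g₀] {x y : g₁} (hy : y ∈ orbit g₀ x) :
    Module.finrank ℂ (tangent g₀ y) = Module.finrank ℂ (tangent g₀ x) := by
  refine orbit_induction g₀
    (p := fun y => Module.finrank ℂ (tangent g₀ y) = Module.finrank ℂ (tangent g₀ x)) rfl
    (fun u y hy => ?_) hy
  have h1 : tangent g₀ (expAct g₁ u y) = (tangent g₀ y).map (expAct g₁ u) := by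
    ext v
    rw [mem_tangent, Submodule.mem_map]
    constructor
    · rintro ⟨w, rfl⟩
      refine ⟨⁅expAct g₀ (-u) w, y⁆, ⟨_, rfl⟩, ?_⟩
      rw [expAct_lie, expAct_apply_neg]
    · rintro ⟨_, ⟨w, rfl⟩, rfl⟩
      exact ⟨expAct g₀ u w, (expAct_lie g₀ u w y).symm⟩
  rw [← hy, h1]
  refine LinearEquiv.finrank_eq (Submodule.equivMapOfInjective (expAct g₁ u) ?_ _).symm
  exact Function.LeftInverse.injective (expAct_neg_apply g₀ u)
end Group

end LieSuper
end

/-! ### Polynomial parametrizations of pieces of the orbit -/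

noncomputable section

namespace LieSuper

section Parametrization

open MvPolynomial

attribute [local irreducible] expEnd

theorem hasDerivAt_eval {ι : Type*} [Fintype ι] (f : MvPolynomial ι ℂ) {c : ℂ → ι → ℂ} {c' : ι → ℂ}
    {s : ℂ} (hc : ∀ i, HasDerivAt (fun s => c s i) (c' i) s) :
    HasDerivAt (fun s => eval (c s) f) (∑ i, eval (c s) (pderiv i f) * c' i) s := by
  classical
  induction f using MvPolynomial.induction_on with
  | C a => simpa using hasDerivAt_const s a
  | add p q hp hq =>
    have h1 : ∑ i, eval (c s) (pderiv i (p + q)) * c' i =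
        ∑ i, eval (c s) (pderiv i p) * c' i + ∑ i, eval (c s) (pderiv i q) * c' i := by
      rw [← Finset.sum_add_distrib]
      exact Finset.sum_congr rfl fun i _ => by rw [map_add, map_add, add_mul]
    have h2 : (fun s => eval (c s) (p + q)) = fun s => eval (c s) p + eval (c s) q :=
      funext fun s => map_add _ _ _
    rw [h1, h2]
    exact hp.add hq
  | mul_X p i hp =>
    have h2 : (fun s => eval (c s) (p * X i)) = fun s => eval (c s) p * c s i :=
      funext fun s => by rw [map_mul, eval_X]
    have h3 : ∑ j, eval (c s) (pderiv j (p * X i)) * c' j =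
        (∑ j, eval (c s) (pderiv j p) * c' j) * c s i + eval (c s) p * c' i := by
      simp only [pderiv_mul, map_add, map_mul, eval_X, add_mul, Finset.sum_add_distrib,
        Finset.sum_mul]
      congr 1
      · exact Finset.sum_congr rfl fun j _ => by ring
      · rw [Finset.sum_eq_single i]
        · simp
        · intro j _ hj
          rw [pderiv_X_of_ne (Ne.symm hj)]; simp
        · simp
    rw [h2, h3]
    exact hp.mul (hc i)

/-- The relation `T E = E (T + a)` says that `E` intertwines `T + a` with `T`, and the scalar `a`
exponentiates separately. -/
theorem expEnd_mul_of_commutator {V : Type*} [AddCommGroup V] [Module ℂ V] [Module.Finite ℂ V]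
    {T E : Module.End ℂ V} {a : ℂ} (h : ∀ v, T (E v) = E (T v) + a • E v) (v : V) :
    expEnd T (E v) = Complex.exp a • E (expEnd T v) := by
  have h1 := expEnd_intertwine (f := T + a • 1) (g := T) E (fun v => by simp [h]) v
  rw [expEnd_add ((Commute.one_right T).smul_right a), Module.End.mul_apply,
    expEnd_apply_of_eigenvector (f := a • 1) (c := a) (by simp), map_smul, map_smul] at h1
  exact h1.symm

/-- The joint evaluation map is surjective because its transpose is injective, which is linear
independence. -/
theorem exists_forall_apply_eq {V κ : Type*} [AddCommGroup V] [Module ℂ V] [Finite κ]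
    {β : κ → Module.Dual ℂ V} (hβ : LinearIndependent ℂ β) (c : κ → ℂ) :
    ∃ v, ∀ i, β i v = c i := by
  have := Fintype.ofFinite κ
  classical
  have h1 : Function.Surjective (LinearMap.pi β) := by
    rw [← LinearMap.dualMap_injective_iff, injective_iff_map_eq_zero]
    intro ψ hψ
    rw [Fintype.linearIndependent_iff] at hβ
    refine (Pi.basisFun ℂ κ).ext fun i => ?_
    rw [Pi.basisFun_apply, LinearMap.zero_apply]
    refine hβ (fun i => ψ (Pi.single i 1)) ?_ i
    · ext τ
      have h2 := LinearMap.congr_fun hψ τ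
      rw [LinearMap.dualMap_apply, pi_eq_sum_univ' (LinearMap.pi β τ), map_sum] at h2
      simpa [mul_comm] using h2
  obtain ⟨v, hv⟩ := h1 c
  exact ⟨v, fun i => congrFun hv i⟩

variable {V : Type*} [AddCommGroup V] [Module ℂ V]

/-- Polynomial maps into a vector space. -/
def IsPolyMap {n : ℕ} (φ : (Fin n → ℂ) → V) : Prop :=
  ∀ l : Module.Dual ℂ V, ∃ p : MvPolynomial (Fin n) ℂ, ∀ z, eval z p = l (φ z)

theorem IsPolyMap.sum {n : ℕ} {κ : Type*} (s : Finset κ) {φ : κ → (Fin n → ℂ) → V}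
    (h : ∀ k ∈ s, IsPolyMap (φ k)) : IsPolyMap fun z => ∑ k ∈ s, φ k z := by
  intro l
  choose! p hp using fun k (hk : k ∈ s) => h k hk l
  refine ⟨∑ k ∈ s, p k, fun z => ?_⟩
  rw [map_sum, map_sum]
  exact Finset.sum_congr rfl fun k hk => hp k hk z

theorem IsPolyMap.smul {n : ℕ} {φ : (Fin n → ℂ) → V} (h : IsPolyMap φ)
    (q : MvPolynomial (Fin n) ℂ) : IsPolyMap fun z => eval z q • φ z := by
  intro l
  obtain ⟨p, hp⟩ := h l
  exact ⟨q * p, fun z => by rw [map_mul, hp, map_smul, smul_eq_mul]⟩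

theorem IsPolyMap.linear {n : ℕ} {W : Type*} [AddCommGroup W] [Module ℂ W]
    {φ : (Fin n → ℂ) → V} (h : IsPolyMap φ)
    (f : V →ₗ[ℂ] W) : IsPolyMap fun z => f (φ z) :=
  fun l => h (l ∘ₗ f)

theorem isPolyMap_const {n : ℕ} (v : V) : IsPolyMap fun _ : Fin n → ℂ => v :=
  fun l => ⟨C (l v), fun z => by simp⟩

theorem IsPolyMap.comp_tail {n : ℕ} {φ : (Fin n → ℂ) → V} (h : IsPolyMap φ) :
    IsPolyMap fun z : Fin (n + 1) → ℂ => φ (Fin.tail z) := by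
  intro l
  obtain ⟨p, hp⟩ := h l
  exact ⟨rename Fin.succ p, fun z => by rw [eval_rename, ← hp]; rfl⟩

variable {g₀ g₁ : Type*} [LieRing g₀] [LieAlgebra ℂ g₀] [AddCommGroup g₁]
    [Module ℂ g₁] [LieRingModule g₀ g₁] [LieModule ℂ g₀ g₁] [Module.Finite ℂ g₁]

/-- `e` acts on `g₁` as a nilpotent weight vector for `t`. -/
structure IsNilWeightVector (t : LieSubalgebra ℂ g₀) (g₁ : Type*) [AddCommGroup g₁]
    [Module ℂ g₁] [LieRingModule g₀ g₁] [LieModule ℂ g₀ g₁] (e : g₀) : Prop where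
  nilpotent : IsNilpotent (LieModule.toEnd ℂ g₀ g₁ e)
  weight : ∃ α : t → ℂ, ∀ (τ : t) (v : g₁), ⁅(τ : g₀), ⁅e, v⁆⁆ = ⁅e, ⁅(τ : g₀), v⁆⁆ + α τ • ⁅e, v⁆

/-- Parametrizations of pieces of the orbit of `∑ i, x i`: the torus orbit `∑ i, c i • x i`, moved
by finitely many one-parameter unipotent groups. -/
inductive OrbitParam (t : LieSubalgebra ℂ g₀) {k : ℕ} (x : Fin k → g₁) :
    ∀ n : ℕ, ((Fin n → ℂ) → g₁) → Prop
  | base : OrbitParam t x k fun c => ∑ i, c i • x i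
  | step {n : ℕ} {φ : (Fin n → ℂ) → g₁} (e : g₀) (he : IsNilWeightVector t g₁ e)
      (h : OrbitParam t x n φ) :
      OrbitParam t x (n + 1) fun z => expAct g₁ (z 0 • e) (φ (Fin.tail z))

variable {t : LieSubalgebra ℂ g₀} {k : ℕ} {x : Fin k → g₁}

theorem OrbitParam.isPolyMap {n : ℕ} {φ : (Fin n → ℂ) → g₁} (h : OrbitParam t x n φ) :
    IsPolyMap φ := by
  induction h with
  | base =>
    refine IsPolyMap.sum _ fun i _ => ?_
    have := (isPolyMap_const (n := k) (x i)).smul (X i)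
    simpa using this
  | @step n φ e he h ih =>
    obtain ⟨N, hN⟩ := he.nilpotent
    have h1 : (fun z : Fin (n + 1) → ℂ => expAct g₁ (z 0 • e) (φ (Fin.tail z))) = fun z =>
        ∑ j ∈ Finset.range N, eval z (C ((j.factorial : ℂ)⁻¹) * X 0 ^ j) •
          ((LieModule.toEnd ℂ g₀ g₁ e) ^ j) (φ (Fin.tail z)) := by
      ext z
      rw [expAct, map_smul, expEnd_apply_of_pow_eq_zero (N := N) (by rw [smul_pow, hN, smul_zero])]
      refine Finset.sum_congr rfl fun j _ => ?_
      rw [smul_pow, LinearMap.smul_apply, smul_smul]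
      simp
    rw [h1]
    exact IsPolyMap.sum _ fun j _ => (ih.comp_tail.linear _).smul _

theorem OrbitParam.sum_mem_range {n : ℕ} {φ : (Fin n → ℂ) → g₁} (h : OrbitParam t x n φ) :
    ∃ z, φ z = ∑ i, x i := by
  induction h with
  | base => exact ⟨1, by simp⟩
  | @step n φ e he h ih =>
    obtain ⟨z, hz⟩ := ih
    refine ⟨Fin.cons 0 z, ?_⟩
    beta_reduce
    rw [Fin.cons_zero, Fin.tail_cons, hz, zero_smul, expAct, map_zero, expEnd_zero]
    rfl

/-- The derivatives of `φ` at `z` are tangent to the `g₀`-orbit. -/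
def IsTangentAt (g₀ : Type*) {g₁ : Type*} [LieRing g₀] [LieAlgebra ℂ g₀] [AddCommGroup g₁]
    [Module ℂ g₁] [LieRingModule g₀ g₁] [LieModule ℂ g₀ g₁] {n : ℕ} (φ : (Fin n → ℂ) → g₁)
    (z : Fin n → ℂ) : Prop :=
  ∀ j, ∃ u : g₀, ∀ l : Module.Dual ℂ g₁,
    HasDerivAt (fun s => l (φ (Function.update z j s))) (l ⁅u, φ z⁆) (z j)

/-- The image of the parametrization is not contained in the orbit, since torus coordinates may
vanish; away from a hypersurface it is, with derivatives in the directions `[u, φ z]`. -/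
theorem OrbitParam.generic [Module.Finite ℂ g₀] {β : Fin k → Module.Dual ℂ t}
    (hβ : LinearIndependent ℂ β)
    (hx : ∀ (i : Fin k) (τ : t), ⁅(τ : g₀), x i⁆ = β i τ • x i)
    {n : ℕ} {φ : (Fin n → ℂ) → g₁} (h : OrbitParam t x n φ) :
    ∃ q : MvPolynomial (Fin n) ℂ, q ≠ 0 ∧ ∀ z, eval z q ≠ 0 →
      φ z ∈ orbit g₀ (∑ i, x i) ∧ IsTangentAt g₀ φ z := by
  induction h with
  | base =>
    have hsurj := exists_forall_apply_eq hβ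
    -- Off the coordinate hyperplanes, independence of the weights allows `exp τ` with `β i τ = log
    -- (z i)` to move `∑ x i` to `∑ z i • x i`.
    refine ⟨∏ i, X i, Finset.prod_ne_zero_iff.2 fun i _ => X_ne_zero i, fun z hz => ⟨?_, ?_⟩⟩
    · rw [map_prod, Finset.prod_ne_zero_iff] at hz
      simp only [eval_X] at hz
      obtain ⟨τ, hτ⟩ := hsurj fun i => Complex.log (z i)
      have := expAct_mem_orbit g₀ (mem_orbit_self g₀ (∑ i, x i)) (τ : g₀)
      rw [map_sum] at this
      convert this using 2 with i
      rw [expAct, expEnd_apply_of_eigenvector (c := β i τ) (hx i τ), hτ, Complex.exp_log (hz i (by simp))]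
    · rw [map_prod, Finset.prod_ne_zero_iff] at hz
      simp only [eval_X] at hz
      intro j
      -- This `τ` scales `x j` by the inverse of its current coordinate and kills the other terms,
      -- so it moves the point in the direction `x j`.
      obtain ⟨τ, hτ⟩ := hsurj (Pi.single j (z j)⁻¹)
      refine ⟨τ, fun l => ?_⟩
      have h1 : ⁅(τ : g₀), ∑ i, z i • x i⁆ = x j := by
        rw [lie_sum, Finset.sum_eq_single j]
        · rw [lie_smul, hx, hτ, Pi.single_eq_same, smul_smul, mul_inv_cancel₀ (hz j (by simp)), one_smul]
        · intro i _ hi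
          rw [lie_smul, hx, hτ, Pi.single_eq_of_ne hi, zero_smul, smul_zero]
        · simp
      rw [h1]
      have h2 : (fun s => l (∑ i, Function.update z j s i • x i)) =
          fun s => (s - z j) * l (x j) + l (∑ i, z i • x i) := by
        ext s
        have : Function.update z j s = z + Pi.single j (s - z j) := by
          ext i
          by_cases hi : i = j
          · subst hi; simp
          · simp [hi]
        simp only [this, Pi.add_apply, add_smul, Finset.sum_add_distrib, map_add]
        rw [add_comm]
        congr 1
        rw [Finset.sum_eq_single j]
        · simp
        · intro i _ hi
          rw [Pi.single_eq_of_ne hi, zero_smul]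
        · simp
      rw [h2]
      simpa using (((hasDerivAt_id (z j)).sub_const (z j)).mul_const (l (x j))).add_const (l (∑ i, z i • x i))
  | @step n φ e he h ih =>
    obtain ⟨q, hq, hqz⟩ := ih
    -- No condition falls on the new variable. Its derivative direction is `e` itself; the old
    -- directions are transported by the new exponential.
    refine ⟨rename Fin.succ q, ?_, fun z hz => ?_⟩
    · rw [Ne, ← map_zero (rename Fin.succ), (rename_injective _ (Fin.succ_injective n)).eq_iff]
      exact hq
    · rw [eval_rename] at hz
      obtain ⟨h1, h2⟩ := hqz (Fin.tail z) hz
      refine ⟨expAct_mem_orbit g₀ h1 _, fun j => ?_⟩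
      refine Fin.cases ?_ (fun j => ?_) j
      · refine ⟨e, fun l => ?_⟩
        have := hasDerivAt_dual_expEnd (LieModule.toEnd ℂ g₀ g₁ e) l (φ (Fin.tail z)) (z 0)
        simp only [← map_smul] at this
        convert this using 1
        · ext s
          beta_reduce
          rw [Function.update_self, Fin.tail_update_zero]
        · rfl
      · obtain ⟨u, hu⟩ := h2 j
        refine ⟨expAct g₀ (z 0 • e) u, fun l => ?_⟩
        have := hu (l ∘ₗ expAct g₁ (z 0 • e))
        rw [← expAct_lie]
        convert this using 1
        · ext s
          beta_reduce
          rw [Function.update_of_ne (Fin.succ_ne_zero j).symm, Fin.tail_update_succ]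
          rfl
        · rfl
        · rfl

/-- The torus normalizes each unipotent factor: conjugation by `exp τ` rescales its parameter by
`exp (α τ)`, while the torus coordinates are rescaled by `exp (β i τ)`. -/
theorem OrbitParam.torus_stable {β : Fin k → Module.Dual ℂ t}
    (hx : ∀ (i : Fin k) (τ : t), ⁅(τ : g₀), x i⁆ = β i τ • x i)
    {n : ℕ} {φ : (Fin n → ℂ) → g₁} (h : OrbitParam t x n φ) (τ : t) (z : Fin n → ℂ) :
    ∃ z', expAct g₁ (τ : g₀) (φ z) = φ z' := by
  induction h with
  | base =>
    refine ⟨fun i => Complex.exp (β i τ) * z i, ?_⟩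
    rw [map_sum]
    refine Finset.sum_congr rfl fun i _ => ?_
    rw [map_smul, expAct, expEnd_apply_of_eigenvector (c := β i τ) (hx i τ), smul_smul, mul_comm]
  | @step n φ e he h ih =>
    obtain ⟨z', hz'⟩ := ih (Fin.tail z)
    obtain ⟨α, hα⟩ := he.weight
    refine ⟨Fin.cons (Complex.exp (α τ) * z 0) z', ?_⟩
    beta_reduce
    rw [Fin.cons_zero, Fin.tail_cons, ← hz']
    refine expEnd_intertwine (expAct g₁ (τ : g₀)) (fun v => ?_) _
    have h1 := expEnd_mul_of_commutator (T := LieModule.toEnd ℂ g₀ g₁ τ)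
      (E := LieModule.toEnd ℂ g₀ g₁ e) (a := α τ) (hα τ) v
    simp only [map_smul, LinearMap.smul_apply]
    rw [h1, smul_smul, mul_comm]

end Parametrization

end LieSuper
end

/-! ### Vanishing ideals and the closure of the orbit -/

noncomputable section

namespace LieSuper

section OrbitDimension

open MvPolynomial

attribute [local irreducible] expEnd

variable {V ι : Type*} [AddCommGroup V] [Module ℂ V] [Fintype ι] (b : Module.Basis ι ℂ V)

/-- The ideal of polynomials in the coordinates that vanish on a set. -/
def vanIdeal (S : Set V) : Ideal (MvPolynomial ι ℂ) where
  carrier := {f | ∀ y ∈ S, eval (b.equivFun y) f = 0}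
  zero_mem' := fun y _ => map_zero _
  add_mem' := fun {f g} hf hg y hy => by rw [map_add, hf y hy, hg y hy, add_zero]
  smul_mem' := fun c f hf y hy => by rw [smul_eq_mul, map_mul, hf y hy, mul_zero]

theorem mem_vanIdeal {S : Set V} {f : MvPolynomial ι ℂ} :
    f ∈ vanIdeal b S ↔ ∀ y ∈ S, eval (b.equivFun y) f = 0 := Iff.rfl

theorem eval_aeval_polynomials {n : ℕ} {κ : Type*} (p : κ → MvPolynomial (Fin n) ℂ) (f : MvPolynomial κ ℂ)
    (z : Fin n → ℂ) : eval z (aeval p f) = eval (fun i => eval z (p i)) f := by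
  induction f using MvPolynomial.induction_on with
  | C a => simp
  | add f g hf hg => rw [map_add, map_add, hf, hg, map_add]
  | mul_X f i hf => rw [map_mul, map_mul, hf, map_mul, aeval_X, eval_X]

/-- A polynomial function on affine space over an infinite field vanishes only if the polynomial
does. Consequently the ideal is prime, and the coordinate ring embeds in a polynomial ring. -/
theorem vanIdeal_range_eq_ker {n : ℕ} {φ : (Fin n → ℂ) → V} {p : ι → MvPolynomial (Fin n) ℂ}
    (hp : ∀ i z, eval z (p i) = b.equivFun (φ z) i) :
    vanIdeal b (Set.range φ) = RingHom.ker (aeval p : MvPolynomial ι ℂ →ₐ[ℂ] MvPolynomial (Fin n) ℂ) := by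
  have key : ∀ z f, eval z (aeval p f) = eval (b.equivFun (φ z)) f := by
    intro z f
    rw [eval_aeval_polynomials]
    congr 2
    exact funext fun i => hp i z
  ext f
  rw [mem_vanIdeal, RingHom.mem_ker]
  constructor
  · intro h
    refine MvPolynomial.funext fun z => ?_
    rw [map_zero]
    exact (key z f).trans (h _ ⟨z, rfl⟩)
  · rintro h _ ⟨z, rfl⟩
    rw [← key]
    exact (congrArg (eval z) h).trans (map_zero _)

theorem IsPolyMap.exists_coordinates {n : ℕ} {φ : (Fin n → ℂ) → V} (h : IsPolyMap φ) :
    ∃ p : ι → MvPolynomial (Fin n) ℂ, ∀ i z, eval z (p i) = b.equivFun (φ z) i := by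
  choose p hp using fun i => h (b.coord i)
  exact ⟨p, fun i z => by rw [hp]; rfl⟩

theorem IsPolyMap.isPrime_vanIdeal {n : ℕ} {φ : (Fin n → ℂ) → V} (h : IsPolyMap φ) :
    (vanIdeal b (Set.range φ)).IsPrime := by
  obtain ⟨p, hp⟩ := h.exists_coordinates b
  rw [vanIdeal_range_eq_ker b hp]
  exact RingHom.ker_isPrime _

theorem ringKrullDim_polyFunctionRing_eq {S : Set V} {A : Type*} [CommRing A] [Algebra ℂ A]
    (Φ : MvPolynomial ι ℂ →ₐ[ℂ] A) (hΦ : vanIdeal b S = RingHom.ker Φ) :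
    algDim S = ringKrullDim Φ.range := by
  let Θ : MvPolynomial ι ℂ →ₐ[ℂ] (S → ℂ) := aeval fun i s => b.equivFun (s : V) i
  have hΘ : ∀ f s, Θ f s = eval (b.equivFun (s : V)) f := by
    intro f s
    induction f using MvPolynomial.induction_on with
    | C a => simp [Θ]
    | add f g hf hg => rw [map_add, map_add, Pi.add_apply, hf, hg]
    | mul_X f i hf => rw [map_mul, map_mul, Pi.mul_apply, hf, eval_X]; simp [Θ]
  have hker : RingHom.ker Θ = RingHom.ker Φ := by
    rw [← hΦ]
    ext f
    rw [RingHom.mem_ker, mem_vanIdeal]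
    constructor
    · intro h y hy
      rw [← hΘ f ⟨y, hy⟩, h]; rfl
    · intro h
      ext s
      rw [hΘ]; exact h _ s.2
  have hrange : polyFunctionRing S = Θ.range := by
    rw [← Algebra.adjoin_range_eq_range_aeval]
    refine le_antisymm (Algebra.adjoin_le ?_) (Algebra.adjoin_mono ?_)
    · rintro _ ⟨l, rfl⟩
      have : (fun s : S => l (s : V)) = ∑ i, l (b i) • fun s : S => b.equivFun (s : V) i := by
        ext s
        conv_lhs => rw [← b.sum_equivFun (s : V), map_sum]
        simp [mul_comm]
      simp only [this]
      exact Subalgebra.sum_mem _ fun i _ => Subalgebra.smul_mem _ (Algebra.subset_adjoin (Set.mem_range_self i)) _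
    · rintro _ ⟨i, rfl⟩
      exact ⟨b.coord i, rfl⟩
  rw [algDim, hrange]
  exact ringKrullDim_eq_of_ringEquiv (((Ideal.quotientKerEquivRange Θ).symm.toRingEquiv.trans
    (Ideal.quotEquivOfEq hker)).trans (Ideal.quotientKerEquivRange Φ).toRingEquiv)

variable {g₀ g₁ : Type*} [LieRing g₀] [LieAlgebra ℂ g₀] [AddCommGroup g₁]
    [Module ℂ g₁] [LieRingModule g₀ g₁] [LieModule ℂ g₀ g₁] (b : Module.Basis ι ℂ g₁)

/-- The derivation of the polynomial ring given by the linear vector field of `u`. -/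
def lieDeriv : g₀ →ₗ[ℂ] MvPolynomial ι ℂ →ₗ[ℂ] MvPolynomial ι ℂ where
  toFun u := ∑ i, LinearMap.mulRight ℂ (∑ j, C (b.repr ⁅u, b j⁆ i) * X j) ∘ₗ (pderiv i).toLinearMap
  map_add' u v := by
    refine LinearMap.ext fun f => ?_
    simp [add_lie, add_mul, mul_add, Finset.sum_add_distrib]
  map_smul' c u := by
    refine LinearMap.ext fun f => ?_
    simp [Finset.smul_sum, Finset.mul_sum, mul_assoc, smul_eq_C_mul, mul_left_comm]

theorem eval_lieDeriv (u : g₀) (f : MvPolynomial ι ℂ) (y : g₁) :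
    eval (b.equivFun y) (lieDeriv b u f) =
      ∑ i, eval (b.equivFun y) (pderiv i f) * b.equivFun ⁅u, y⁆ i := by
  have h : ∀ i, b.equivFun ⁅u, y⁆ i = ∑ j, b.repr ⁅u, b j⁆ i * b.equivFun y j := by
    intro i
    conv_lhs => rw [← b.sum_equivFun y, lie_sum, map_sum, Finset.sum_apply]
    refine Finset.sum_congr rfl fun j _ => ?_
    rw [lie_smul, map_smul, Pi.smul_apply, smul_eq_mul, mul_comm]
    rfl
  simp only [h, lieDeriv, LinearMap.coe_mk, AddHom.coe_mk, LinearMap.sum_apply, map_sum,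
    LinearMap.comp_apply, LinearMap.mulRight_apply, map_mul, eval_C, eval_X]
  rfl

variable [Module.Finite ℂ g₁]

theorem hasDerivAt_eval_expAct (u : g₀) (f : MvPolynomial ι ℂ) (y : g₁) (s : ℂ) :
    HasDerivAt (fun s : ℂ => eval (b.equivFun (expAct g₁ (s • u) y)) f)
      (eval (b.equivFun (expAct g₁ (s • u) y)) (lieDeriv b u f)) s := by
  rw [eval_lieDeriv]
  refine hasDerivAt_eval f fun i => ?_
  have := hasDerivAt_dual_expEnd (LieModule.toEnd ℂ g₀ g₁ u) (b.coord i) y s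
  simp only [← map_smul] at this
  exact this

/-- A subspace of polynomials that is stable under a vector field and vanishes at a point vanishes
along the flow. -/
theorem eval_expAct_eq_zero {I : Submodule ℂ (MvPolynomial ι ℂ)} {u : g₀}
    (hI : ∀ f ∈ I, lieDeriv b u f ∈ I) {y : g₁} (hy : ∀ f ∈ I, eval (b.equivFun y) f = 0) :
    ∀ f ∈ I, eval (b.equivFun (expAct g₁ u y)) f = 0 := by
  intro f hf
  set h : MvPolynomial ι ℂ → ℂ → ℂ := fun f s => eval (b.equivFun (expAct g₁ (s • u) y)) f
  have hd : ∀ f s, HasDerivAt (h f) (h (lieDeriv b u f) s) s :=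
    fun f s => hasDerivAt_eval_expAct b u f y s
  have hiter : ∀ k : ℕ, iteratedDeriv k (h f) = h (((lieDeriv b u) ^ k) f) := by
    intro k
    induction k with
    | zero => simp
    | succ k ih =>
      rw [iteratedDeriv_succ, ih, pow_succ', Module.End.mul_apply]
      exact funext fun s => (hd _ s).deriv
  have hmem : ∀ k : ℕ, ((lieDeriv b u) ^ k) f ∈ I := by
    intro k
    induction k with
    | zero => simpa
    | succ k ih => rw [pow_succ', Module.End.mul_apply]; exact hI _ ih
  have h0 : ∀ f ∈ I, h f 0 = 0 := by
    intro f hf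
    simp only [h, zero_smul, expAct, map_zero, expEnd_zero]
    exact hy f hf
  -- The function is entire in `s`. All its derivatives at `0` are values at `y` of members of `I`,
  -- so its Taylor series gives `0` at `s = 1`.
  have h1 := Complex.hasSum_taylorSeries_of_entire (f := h f)
    (fun s => (hd f s).differentiableAt) 0 1
  have h2 : h f 1 = 0 := by
    refine h1.unique ?_
    convert hasSum_zero with k
    rw [hiter, h0 _ (hmem k), smul_zero, smul_zero]
  simpa [h] using h2

theorem eval_lieDeriv_eq_zero {u : g₀} {f : MvPolynomial ι ℂ} {y : g₁}
    (h : ∀ s : ℂ, eval (b.equivFun (expAct g₁ (s • u) y)) f = 0) :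
    eval (b.equivFun y) (lieDeriv b u f) = 0 := by
  have h1 := hasDerivAt_eval_expAct b u f y 0
  rw [funext h, zero_smul, expAct, map_zero, expEnd_zero, Module.End.one_apply] at h1
  exact h1.unique (hasDerivAt_const (0 : ℂ) (0 : ℂ))

theorem lieDeriv_mem {S : Set g₁} {u : g₀} (hS : ∀ y ∈ S, ∀ s : ℂ, ∀ f ∈ vanIdeal b S,
      eval (b.equivFun (expAct g₁ (s • u) y)) f = 0) :
    ∀ f ∈ vanIdeal b S, lieDeriv b u f ∈ vanIdeal b S :=
  fun f hf y hy => eval_lieDeriv_eq_zero b fun s => hS y hy s f hf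

variable {t : LieSubalgebra ℂ g₀} {k : ℕ} {x : Fin k → g₁}

theorem OrbitParam.vanIdeal_step_le {n : ℕ} {φ : (Fin n → ℂ) → g₁} (e : g₀) :
    vanIdeal b (Set.range fun z : Fin (n + 1) → ℂ => expAct g₁ (z 0 • e) (φ (Fin.tail z))) ≤
      vanIdeal b (Set.range φ) := by
  rintro f hf _ ⟨z, rfl⟩
  have h := hf _ ⟨Fin.cons 0 z, rfl⟩
  beta_reduce at h
  rwa [Fin.cons_zero, Fin.tail_cons, zero_smul, expAct, map_zero, expEnd_zero,
    Module.End.one_apply] at h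

/-- Appending the flow of `e` can only shrink the ideal, and a strictly smaller prime would have
smaller height. By minimality the ideal is unchanged, so its members vanish along the flow of `e`
and may be differentiated. -/
theorem OrbitParam.lieDeriv_mem_of_isNilWeightVector {n : ℕ} {φ : (Fin n → ℂ) → g₁}
    (hφ : OrbitParam t x n φ) {e : g₀} (he : IsNilWeightVector t g₁ e)
    (hmin : ∀ (n' : ℕ) (φ' : (Fin n' → ℂ) → g₁), OrbitParam t x n' φ' →
      (vanIdeal b (Set.range φ)).height ≤ (vanIdeal b (Set.range φ')).height) :
    ∀ f ∈ vanIdeal b (Set.range φ), lieDeriv b e f ∈ vanIdeal b (Set.range φ) := by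
  have hpar := OrbitParam.step e he hφ
  have hprime := hpar.isPolyMap.isPrime_vanIdeal b
  have hle := OrbitParam.vanIdeal_step_le b (φ := φ) e
  have heq := hle.eq_or_lt.resolve_right fun hlt =>
    absurd (hmin _ _ hpar) (not_le.2 (Ideal.height_strict_mono_of_isPrime hlt))
  refine lieDeriv_mem b ?_
  rintro _ ⟨z, rfl⟩ s f hf
  rw [← heq] at hf
  have h := hf _ ⟨Fin.cons s z, rfl⟩
  beta_reduce at h
  rwa [Fin.cons_zero, Fin.tail_cons] at h

theorem OrbitParam.lieDeriv_mem_of_torus {β : Fin k → Module.Dual ℂ t}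
    (hx : ∀ (i : Fin k) (τ : t), ⁅(τ : g₀), x i⁆ = β i τ • x i)
    {n : ℕ} {φ : (Fin n → ℂ) → g₁} (hφ : OrbitParam t x n φ) (τ : t) :
    ∀ f ∈ vanIdeal b (Set.range φ), lieDeriv b (τ : g₀) f ∈ vanIdeal b (Set.range φ) := by
  refine lieDeriv_mem b ?_
  rintro _ ⟨z, rfl⟩ s f hf
  obtain ⟨z', hz'⟩ := hφ.torus_stable hx (s • τ) z
  have h : expAct g₁ (s • (τ : g₀)) (φ z) = φ z' := hz'
  rw [h]
  exact hf _ ⟨z', rfl⟩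

/-- For minimal height the ideal is stable under nilpotent weight vectors and under the torus. These
span `g₀` and `lieDeriv` is linear, so the ideal is stable under every `u`; its vanishing then
propagates from `∑ x i` to the whole orbit. -/
theorem exists_orbitParam_vanIdeal_le_orbit {β : Fin k → Module.Dual ℂ t}
    (hx : ∀ (i : Fin k) (τ : t), ⁅(τ : g₀), x i⁆ = β i τ • x i)
    (hspan : Submodule.span ℂ ({e | IsNilWeightVector t g₁ e} ∪ (t : Set g₀)) = ⊤) :
    ∃ (n : ℕ) (φ : (Fin n → ℂ) → g₁), OrbitParam t x n φ ∧
      vanIdeal b (Set.range φ) ≤ vanIdeal b (orbit g₀ (∑ i, x i)) := by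
  obtain ⟨n, φ, hφ, hmin⟩ : ∃ (n : ℕ) (φ : (Fin n → ℂ) → g₁), OrbitParam t x n φ ∧
      ∀ (n' : ℕ) (φ' : (Fin n' → ℂ) → g₁), OrbitParam t x n' φ' →
        (vanIdeal b (Set.range φ)).height ≤ (vanIdeal b (Set.range φ')).height := by
    let S : Set ℕ∞ := {h | ∃ (n : ℕ) (φ : (Fin n → ℂ) → g₁), OrbitParam t x n φ ∧
      (vanIdeal b (Set.range φ)).height = h}
    have hne : S.Nonempty := ⟨_, _, _, OrbitParam.base, rfl⟩
    obtain ⟨n, φ, hφ, h⟩ := csInf_mem hne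
    exact ⟨n, φ, hφ, fun n' φ' hφ' => h.trans_le (csInf_le' ⟨n', φ', hφ', rfl⟩)⟩
  have hall : ∀ u : g₀, ∀ f ∈ vanIdeal b (Set.range φ),
      lieDeriv b u f ∈ vanIdeal b (Set.range φ) := by
    intro u f hf
    have hu : u ∈ Submodule.span ℂ ({e | IsNilWeightVector t g₁ e} ∪ (t : Set g₀)) := by
      rw [hspan]; trivial
    induction hu using Submodule.span_induction with
    | mem e he =>
      rcases he with he | he
      · exact hφ.lieDeriv_mem_of_isNilWeightVector b he hmin f hf
      · exact hφ.lieDeriv_mem_of_torus b hx ⟨e, he⟩ f hf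
    | zero => rw [map_zero]; exact zero_mem _
    | add u v _ _ hu hv => rw [map_add, LinearMap.add_apply]; exact add_mem hu hv
    | smul c u _ hu =>
      rw [map_smul, LinearMap.smul_apply, smul_eq_C_mul]; exact Ideal.mul_mem_left _ _ hu
  refine ⟨n, φ, hφ, fun f hf y hy => ?_⟩
  have h : ∀ f ∈ (vanIdeal b (Set.range φ)).restrictScalars ℂ, eval (b.equivFun y) f = 0 := by
    refine orbit_induction g₀
      (p := fun y => ∀ f ∈ (vanIdeal b (Set.range φ)).restrictScalars ℂ,
        eval (b.equivFun y) f = 0) ?_ (fun u y hy => ?_) hy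
    · intro f hf
      obtain ⟨z, hz⟩ := hφ.sum_mem_range
      exact hf _ ⟨z, hz⟩
    · exact eval_expAct_eq_zero b (hall u) hy
  exact h f hf

/-- A polynomial `f` vanishing on the orbit vanishes at generic parameter values. Thus the composite
of `f` with the parametrization, times the nonzero `q`, is zero, and the polynomial ring is a
domain. -/
theorem OrbitParam.vanIdeal_eq [Module.Finite ℂ g₀] {β : Fin k → Module.Dual ℂ t}
    (hβ : LinearIndependent ℂ β)
    (hx : ∀ (i : Fin k) (τ : t), ⁅(τ : g₀), x i⁆ = β i τ • x i)
    {n : ℕ} {φ : (Fin n → ℂ) → g₁} (h : OrbitParam t x n φ)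
    (hle : vanIdeal b (Set.range φ) ≤ vanIdeal b (orbit g₀ (∑ i, x i))) :
    vanIdeal b (orbit g₀ (∑ i, x i)) = vanIdeal b (Set.range φ) := by
  refine le_antisymm (fun f hf => ?_) hle
  obtain ⟨q, hq, hqz⟩ := h.generic hβ hx
  obtain ⟨p, hp⟩ := h.isPolyMap.exists_coordinates b
  rw [vanIdeal_range_eq_ker b hp, RingHom.mem_ker]
  have : aeval p f * q = 0 := by
    refine MvPolynomial.funext fun z => ?_
    rw [map_zero, map_mul]
    by_cases hz : eval z q = 0
    · rw [hz, mul_zero]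
    · rw [eval_aeval_polynomials]
      have := hf _ (hqz z hz).1
      rw [show (fun i => eval z (p i)) = b.equivFun (φ z) from funext fun i => hp i z, this, zero_mul]
  exact (mul_eq_zero.1 this).resolve_right hq

end OrbitDimension

end LieSuper
end

/-! ### Orbit dimension equals the dimension of the tangent space -/

noncomputable section

namespace LieSuper

section OrbitDimension

open MvPolynomial

attribute [local irreducible] expEnd

theorem eq_zero_of_eval_eq_zero_of_mem_nhds {r : ℕ} {P : MvPolynomial (Fin r) ℂ}
    {U : Set (Fin r → ℂ)} {c : Fin r → ℂ} (hU : U ∈ nhds c) (h : ∀ z ∈ U, eval z P = 0) : P = 0 := by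
  obtain ⟨ε, hε, hball⟩ := Metric.mem_nhds_iff.1 hU
  refine MvPolynomial.funext_set (fun i => Metric.ball (c i) ε) (fun i => ?_) fun z hz => ?_
  · exact infinite_of_mem_nhds (c i) (Metric.ball_mem_nhds _ hε)
  · rw [map_zero]
    refine h z (hball ?_)
    rw [Metric.mem_ball, dist_pi_lt_iff hε]
    exact fun i => hz i trivial

variable {g₀ g₁ ι : Type*} [LieRing g₀] [LieAlgebra ℂ g₀] [AddCommGroup g₁]
    [Module ℂ g₁] [LieRingModule g₀ g₁] [LieModule ℂ g₀ g₁] [Fintype ι] (b : Module.Basis ι ℂ g₁)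

/-- Row rank equals column rank, and the columns of the Jacobian are the partial derivatives of `φ`,
which are tangent vectors. -/
theorem IsTangentAt.finrank_span_le {n : ℕ} {φ : (Fin n → ℂ) → g₁} {z : Fin n → ℂ}
    [Module.Finite ℂ g₁]
    (h : IsTangentAt g₀ φ z) {p : ι → MvPolynomial (Fin n) ℂ}
    (hp : ∀ i z, eval z (p i) = b.equivFun (φ z) i) :
    Module.finrank ℂ (Submodule.span ℂ (Set.range fun i j => eval z (pderiv j (p i)))) ≤
      Module.finrank ℂ (tangent g₀ (φ z)) := by
  let M : Matrix ι (Fin n) ℂ := Matrix.of fun i j => eval z (pderiv j (p i))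
  have h1 : Module.finrank ℂ (Submodule.span ℂ (Set.range fun i j => eval z (pderiv j (p i)))) =
      Module.finrank ℂ (Submodule.span ℂ (Set.range M.col)) := by
    rw [← M.rank_eq_finrank_span_cols]
    exact M.rank_eq_finrank_span_row.symm
  have h2 : Submodule.span ℂ (Set.range M.col) ≤
      (tangent g₀ (φ z)).map b.equivFun.toLinearMap := by
    rw [Submodule.span_le]
    rintro _ ⟨j, rfl⟩
    obtain ⟨u, hu⟩ := h j
    refine ⟨⁅u, φ z⁆, ⟨u, rfl⟩, ?_⟩
    ext i
    have hd : ∀ k, HasDerivAt (fun s => Function.update z j s k) ((Pi.single j 1 : Fin n → ℂ) k)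
        (z j) := by
      intro k
      by_cases hk : k = j
      · subst hk
        simpa using hasDerivAt_id' (z k)
      · simpa [hk, Function.update_of_ne] using hasDerivAt_const (z j) (z k)
    have h3 := hasDerivAt_eval (p i) hd
    rw [Function.update_eq_self] at h3
    have h4 := hu (b.coord i)
    have h5 : (fun s => eval (Function.update z j s) (p i)) =
        fun s => b.coord i (φ (Function.update z j s)) := funext fun s => hp i _
    rw [h5] at h3
    have h6 := h4.unique h3
    rw [Finset.sum_eq_single j (fun k _ hk => by rw [Pi.single_eq_of_ne hk, mul_zero])
      (by simp), Pi.single_eq_same, mul_one] at h6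
    exact h6
  rw [h1]
  exact (Submodule.finrank_mono h2).trans (Submodule.finrank_map_le _ _)

variable [Module.Finite ℂ g₁]

/-- Some `r = dim [g₀, x]` linear forms map the orbit of `x` onto a set with interior points. -/
theorem exists_dual_image_mem_nhds (x : g₁) :
    ∃ (l : Fin (Module.finrank ℂ (tangent g₀ x)) → Module.Dual ℂ g₁)
      (c : Fin (Module.finrank ℂ (tangent g₀ x)) → ℂ),
      (fun y i => l i y) '' orbit g₀ x ∈ nhds c := by
  set r := Module.finrank ℂ (tangent g₀ x)
  let v := Module.finBasis ℂ (tangent g₀ x)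
  have hv : LinearIndependent ℂ fun i => (v i : g₁) :=
    v.linearIndependent.map' (tangent g₀ x).subtype (Submodule.ker_subtype _)
  choose u hu using fun i => (v i).2
  obtain ⟨L, hL⟩ := LinearMap.exists_leftInverse_of_injective
    (Fintype.linearCombination ℂ fun i => (v i : g₁)) (LinearMap.ker_eq_bot.2 hv.fintypeLinearCombination_injective)
  let E : (Fin r → ℂ) →ₗ[ℂ] Module.End ℂ g₁ :=
    (LieModule.toEnd ℂ g₀ g₁ : g₀ →ₗ[ℂ] Module.End ℂ g₁) ∘ₗ Fintype.linearCombination ℂ u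
  have hE : ∀ a, L (E a x) = a := by
    intro a
    have h1 : E a x = Fintype.linearCombination ℂ (fun i => (v i : g₁)) a := by
      simp only [E, LinearMap.comp_apply, Fintype.linearCombination_apply, map_sum, map_smul,
        LinearMap.sum_apply, LinearMap.smul_apply]
      exact Finset.sum_congr rfl fun i _ => congrArg _ (hu i)
    rw [h1]
    exact LinearMap.congr_fun hL a
  let F : (Fin r → ℂ) → Fin r → ℂ := fun a => L (expEnd (E a) x)
  -- `L` retracts `g₁` onto coordinates of the tangent space, and `u` lifts its basis to `g₀`; hence
  -- the derivative at `0` is the identity and the map is locally open.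
  have hF : HasStrictFDerivAt F (ContinuousLinearMap.id ℂ (Fin r → ℂ)) 0 := by
    rw [hasStrictFDerivAt_pi']
    intro i
    refine (hasStrictFDerivAt_dual_expEnd E (LinearMap.proj i ∘ₗ L) x).congr_fderiv ?_
    ext1 a
    exact congrFun (hE a) i
  refine ⟨fun i => LinearMap.proj i ∘ₗ L, F 0, ?_⟩
  have h2 := hF.map_nhds_eq_of_surj (by
    exact LinearMap.range_eq_top.2 Function.surjective_id)
  rw [← h2]
  refine Filter.mem_of_superset (Filter.image_mem_map Filter.univ_mem) ?_
  rintro _ ⟨a, -, rfl⟩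
  exact ⟨expAct g₁ (Fintype.linearCombination ℂ u a) x, expAct_mem_orbit g₀ (mem_orbit_self g₀ x) _, rfl⟩

/-- The dimension of the orbit of a sum of weight vectors with linearly independent weights is the
dimension of its tangent space. -/
theorem algDim_orbit_eq_finrank_tangent [Module.Finite ℂ g₀] {t : LieSubalgebra ℂ g₀} {k : ℕ}
    {x : Fin k → g₁} {β : Fin k → Module.Dual ℂ t} (hβ : LinearIndependent ℂ β)
    (hx : ∀ (i : Fin k) (τ : t), ⁅(τ : g₀), x i⁆ = β i τ • x i)
    (hspan : Submodule.span ℂ ({e | IsNilWeightVector t g₁ e} ∪ (t : Set g₀)) = ⊤) :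
    algDim (orbit g₀ (∑ i, x i)) = Module.finrank ℂ (tangent g₀ (∑ i, x i)) := by
  let b := Module.finBasis ℂ g₁
  obtain ⟨n, φ, hφ, hle⟩ := exists_orbitParam_vanIdeal_le_orbit b hx hspan
  have heq := hφ.vanIdeal_eq b hβ hx hle
  obtain ⟨p, hp⟩ := hφ.isPolyMap.exists_coordinates b
  have hker := heq.trans (vanIdeal_range_eq_ker b hp)
  rw [ringKrullDim_polyFunctionRing_eq b _ hker, ← Algebra.adjoin_range_eq_range_aeval]
  obtain ⟨q, hq, hqz⟩ := hφ.generic hβ hx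
  obtain ⟨l, c, hl⟩ := exists_dual_image_mem_nhds (g₀ := g₀) (∑ i, x i)
  have hlb : ∀ i y, l i y = ∑ j, l i (b j) * b.equivFun y j := by
    intro i y
    conv_lhs => rw [← b.sum_equivFun y, map_sum]
    exact Finset.sum_congr rfl fun j _ => by rw [map_smul, smul_eq_mul, mul_comm]
  -- The Jacobian rank is at most the tangent dimension, which is constant on the orbit. For the
  -- other bound, a relation among the chosen linear forms on the orbit would be a polynomial
  -- vanishing on a set with interior.
  refine ringKrullDim_adjoin_eq hq (fun z hz => ?_)
    (f := fun i => ∑ j, C (l i (b j)) * p j) ?_ fun i => ?_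
  · exact ((hqz z hz).2.finrank_span_le b hp).trans
      (finrank_tangent_of_mem_orbit g₀ (hqz z hz).1).le
  · rw [algebraicIndependent_iff]
    intro P hP
    refine eq_zero_of_eval_eq_zero_of_mem_nhds hl ?_
    have hQ : aeval (fun i => ∑ j, C (l i (b j)) * X j) P ∈ vanIdeal b (orbit g₀ (∑ i, x i)) := by
      rw [hker, RingHom.mem_ker, ← hP]
      rw [← AlgHom.comp_apply, comp_aeval]
      congr 2
      ext1 i
      simp only [map_sum, map_mul, aeval_X, algHom_C]
      rfl
    rintro _ ⟨y, hy, rfl⟩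
    have h1 := hQ y hy
    have h2 : ∀ Q : MvPolynomial _ ℂ, eval (b.equivFun y) (aeval (fun i => ∑ j, C (l i (b j)) * X j) Q) =
        eval (fun i => l i y) Q := by
      intro Q
      induction Q using MvPolynomial.induction_on with
      | C a => simp
      | add f g hf hg => rw [map_add, map_add, hf, hg, map_add]
      | mul_X f i hf =>
        rw [map_mul, map_mul, hf, map_mul, aeval_X, eval_X, hlb i y, map_sum]
        congr 1
        exact Finset.sum_congr rfl fun j _ => by rw [map_mul, eval_C, eval_X]
    rw [← h2]; exact h1
  · refine Subalgebra.sum_mem _ fun j _ => ?_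
    rw [← smul_eq_C_mul]
    exact Subalgebra.smul_mem _ (Algebra.subset_adjoin (Set.mem_range_self j)) _

end OrbitDimension

end LieSuper
end

/-! ### Simple spectrum and the discriminant -/

noncomputable section

namespace LieSuper

section SimpleSpectrum

open Polynomial

variable {V : Type*} [AddCommGroup V] [Module ℂ V]

/-- The Gram determinant of the power traces of an endomorphism, i.e. its discriminant. -/
def powerDisc (f : Module.End ℂ V) : ℂ :=
  (Matrix.of fun i j : Fin (Module.finrank ℂ V) => LinearMap.trace ℂ V (f ^ (i + j : ℕ))).det

theorem trace_pow_eq_sum {ι : Type*} [Fintype ι] (b : Module.Basis ι ℂ V) {f : Module.End ℂ V}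
    {c : ι → ℂ} (h : ∀ i, f (b i) = c i • b i) (k : ℕ) :
    LinearMap.trace ℂ V (f ^ k) = ∑ i, c i ^ k := by
  classical
  have hk : ∀ i, (f ^ k) (b i) = c i ^ k • b i := by
    intro i
    induction k with
    | zero => simp
    | succ k ih => rw [pow_succ', Module.End.mul_apply, ih, map_smul, h, smul_smul, pow_succ]
  rw [LinearMap.trace_eq_matrix_trace ℂ b, Matrix.trace]
  refine Finset.sum_congr rfl fun i _ => ?_
  rw [Matrix.diag_apply, LinearMap.toMatrix_apply, hk]
  simp

theorem powerDisc_conj {f g T : Module.End ℂ V} (hT : IsUnit T) (h : g * T = T * f) :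
    powerDisc g = powerDisc f := by
  obtain ⟨T, rfl⟩ := hT
  have hg : ∀ k, g ^ k = T * f ^ k * (T⁻¹ : (Module.End ℂ V)ˣ) := by
    intro k
    have h1 : SemiconjBy (T : Module.End ℂ V) f g := h.symm
    rw [← (h1.pow_right k).eq.symm, Units.mul_inv_cancel_right]
  unfold powerDisc
  congr 1
  ext i j
  rw [Matrix.of_apply, Matrix.of_apply, hg, LinearMap.trace_mul_comm, Units.inv_mul_cancel_left]

variable [Module.Finite ℂ V]

/-- In an eigenbasis the matrix of power traces factors as a transposed Vandermonde matrix times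
that Vandermonde matrix. -/
theorem powerDisc_ne_zero {ι : Type*} [Fintype ι] {f : Module.End ℂ V} {v : ι → V} {c : ι → ℂ}
    (hcard : Fintype.card ι = Module.finrank ℂ V) (hc : Function.Injective c)
    (hv : ∀ i, f (v i) = c i • v i) (hv0 : ∀ i, v i ≠ 0) : powerDisc f ≠ 0 := by
  classical
  have hli : LinearIndependent ℂ v := Module.End.eigenvectors_linearIndependent' f c hc v
    fun i => Module.End.hasEigenvector_iff.2 ⟨Module.End.mem_eigenspace_iff.2 (hv i), hv0 i⟩
  let e : Fin (Module.finrank ℂ V) ≃ ι := (Fintype.equivFinOfCardEq hcard).symm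
  let b := (basisOfLinearIndependentOfCardEqFinrank' _ hli hcard).reindex e.symm
  have hb : ∀ i, f (b i) = c (e i) • b i := by
    intro i
    have : b i = v (e i) := by simp [b]
    rw [this, hv]
  have hM : (Matrix.of fun i j : Fin (Module.finrank ℂ V) =>
      LinearMap.trace ℂ V (f ^ (i + j : ℕ))) =
      (Matrix.vandermonde fun i => c (e i)).transpose * Matrix.vandermonde fun i => c (e i) := by
    ext i j
    rw [Matrix.of_apply, trace_pow_eq_sum b hb, Matrix.mul_apply]
    exact Finset.sum_congr rfl fun k _ => by
      rw [Matrix.transpose_apply, Matrix.vandermonde_apply, Matrix.vandermonde_apply, pow_add]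
  rw [powerDisc, hM, Matrix.det_mul, Matrix.det_transpose]
  have := Matrix.det_vandermonde_ne_zero_iff.2 (hc.comp e.injective)
  exact mul_ne_zero this this

theorem exists_eigenbasis_of_powerDisc_ne_zero {f : Module.End ℂ V} (h : powerDisc f ≠ 0) :
    ∃ (b : Module.Basis (Fin (Module.finrank ℂ V)) ℂ V) (c : Fin (Module.finrank ℂ V) → ℂ),
      Function.Injective c ∧ ∀ i, f (b i) = c i • b i := by
  classical
  set d := Module.finrank ℂ V with hd
  have hfin : Finite {μ // f.HasEigenvalue μ} := inferInstanceAs (Finite f.Eigenvalues)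
  have := Fintype.ofFinite {μ // f.HasEigenvalue μ}
  let p : ℂ[X] := ∏ μ : {μ // f.HasEigenvalue μ}, (X - C (μ : ℂ))
  have hp : p.Monic := monic_prod_of_monic _ _ fun μ _ => monic_X_sub_C _
  have hdeg : p.natDegree = Fintype.card {μ // f.HasEigenvalue μ} := by
    rw [natDegree_prod_of_monic _ _ fun μ _ => monic_X_sub_C _]
    simp
  have hroot : ∀ μ, f.HasEigenvalue μ → p.IsRoot μ := by
    intro μ hμ
    rw [IsRoot, eval_prod]
    exact Finset.prod_eq_zero (Finset.mem_univ ⟨μ, hμ⟩) (by simp)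
  -- Every linear factor of the minimal polynomial divides `p`, so it divides a power of `p`.
  have hnil : IsNilpotent (aeval f p) := by
    have hdvd : ∃ k, minpoly ℂ f ∣ p ^ k := by
      refine ⟨(minpoly ℂ f).natDegree, ?_⟩
      have hs := IsAlgClosed.splits (minpoly ℂ f)
      have hm := minpoly.monic (Algebra.IsIntegral.isIntegral (R := ℂ) f)
      have hcard : Multiset.card (minpoly ℂ f).roots = (minpoly ℂ f).natDegree :=
        (hs.natDegree_eq_card_roots).symm
      have hprod : (minpoly ℂ f) = ((minpoly ℂ f).roots.map fun a => X - C a).prod :=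
        hs.eq_prod_roots_of_monic hm
      rw [← hcard]
      conv_lhs => rw [hprod]
      have : ((minpoly ℂ f).roots.map fun _ => p).prod = p ^ Multiset.card (minpoly ℂ f).roots := by
        rw [Multiset.map_const', Multiset.prod_replicate]
      rw [← this]
      refine Multiset.prod_dvd_prod_of_dvd _ _ fun a ha => ?_
      rw [dvd_iff_isRoot]
      exact hroot a (Module.End.hasEigenvalue_iff_isRoot.2 (isRoot_of_mem_roots ha))
    obtain ⟨k, q, hq⟩ := hdvd
    refine ⟨k, ?_⟩
    rw [← map_pow, hq, map_mul, minpoly.aeval, zero_mul]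
  -- With fewer than `d` eigenvalues, `p` has degree below `d`. As `aeval f p` is nilpotent, its
  -- products with powers of `f` have trace zero, so the coefficients of `p` give a nonzero left
  -- kernel vector of the trace matrix.
  have hle : d ≤ Fintype.card {μ // f.HasEigenvalue μ} := by
    by_contra hlt
    push Not at hlt
    rw [← hdeg] at hlt
    refine h (Matrix.exists_vecMul_eq_zero_iff.1 ⟨fun i => p.coeff i, ?_, ?_⟩)
    · intro h0
      have := congrFun h0 ⟨p.natDegree, hlt⟩
      simp [hp] at this
    · ext j
      have h1 : LinearMap.trace ℂ V (aeval f p * f ^ (j : ℕ)) = 0 := by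
        refine (LinearMap.isNilpotent_trace_of_isNilpotent ?_).eq_zero
        refine Commute.isNilpotent_mul_right ?_ hnil
        simpa using (Commute.all p (X ^ (j : ℕ))).map (aeval f)
      rw [aeval_eq_sum_range' hlt, Finset.sum_mul, map_sum, Finset.sum_range] at h1
      rw [Matrix.vecMul, dotProduct, Pi.zero_apply, ← h1]
      refine Finset.sum_congr rfl fun i _ => ?_
      rw [Matrix.of_apply, smul_mul_assoc, map_smul, smul_eq_mul, pow_add]
  choose v hv using fun μ : {μ // f.HasEigenvalue μ} => μ.2.exists_hasEigenvector
  have hli : LinearIndependent ℂ v := Module.End.eigenvectors_linearIndependent' f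
    (fun μ : {μ // f.HasEigenvalue μ} => (μ : ℂ)) Subtype.val_injective v hv
  have hcard : Fintype.card {μ // f.HasEigenvalue μ} = d :=
    le_antisymm hli.fintype_card_le_finrank hle
  let e : Fin d ≃ {μ // f.HasEigenvalue μ} := (Fintype.equivFinOfCardEq hcard).symm
  refine ⟨(basisOfLinearIndependentOfCardEqFinrank' _ hli hcard).reindex e.symm, fun i => e i,
    Subtype.val_injective.comp e.injective, fun i => ?_⟩
  simpa using Module.End.mem_eigenspace_iff.1 (hv (e i)).1

theorem exists_polynomial_powerDisc (f g : Module.End ℂ V) :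
    ∃ p : ℂ[X], ∀ s : ℂ, p.eval s = powerDisc (f + s • g) := by
  let b := Module.finBasis ℂ V
  let M := LinearMap.toMatrix b b f
  let N := LinearMap.toMatrix b b g
  let Q : Matrix (Fin (Module.finrank ℂ V)) (Fin (Module.finrank ℂ V)) ℂ[X] :=
    C.mapMatrix M + (X : ℂ[X]) • C.mapMatrix N
  refine ⟨(Matrix.of fun i j : Fin (Module.finrank ℂ V) => (Q ^ (i + j : ℕ)).trace).det, fun s => ?_⟩
  have hQ : (evalRingHom s).mapMatrix Q = LinearMap.toMatrix b b (f + s • g) := by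
    ext i j
    simp [Q, M, N]
    ring
  rw [← coe_evalRingHom, RingHom.map_det, powerDisc]
  congr 1
  ext i j
  rw [RingHom.mapMatrix_apply, Matrix.map_apply, Matrix.of_apply, Matrix.of_apply,
    LinearMap.trace_eq_matrix_trace ℂ b, ← LinearMap.toMatrix_pow, ← hQ, ← map_pow,
    RingHom.mapMatrix_apply, ← AddMonoidHom.map_trace]

end SimpleSpectrum

end LieSuper
end

/-! ### From a simple element of `g₀` to one in a given Cartan subalgebra -/

noncomputable section

namespace LieSuper

section Density

attribute [local irreducible] expEnd

open LieModule

variable {g₀ : Type*} [LieRing g₀] [LieAlgebra ℂ g₀] [Module.Finite ℂ g₀]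

theorem exists_regular (t : LieSubalgebra ℂ g₀) [LieRing.IsNilpotent t] :
    ∃ h : t, ∀ α : Weight ℂ t g₀, α.IsNonZero → α h ≠ 0 := by
  obtain ⟨h, -, hh⟩ := Module.Dual.exists_forall_mem_ne_zero_of_forall_exists (⊤ : Submodule ℂ t)
    (fun α : {α : Weight ℂ t g₀ // α.IsNonZero} => (α : Weight ℂ t g₀).toLinear) (fun α => by
      by_contra! hx
      exact α.2 (funext fun x => hx x trivial))
  exact ⟨h, fun α hα => hh ⟨α, hα⟩⟩

/-- On a root space with `α h ≠ 0`, `ad h` is injective: a vector it kills would be an eigenvector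
of the nilpotent `ad h - α h` with eigenvalue `-α h`. Finite dimension makes it surjective there. -/
theorem range_ad_sup_eq_top (t : LieSubalgebra ℂ g₀) [t.IsCartanSubalgebra] {h : t}
    (hh : ∀ α : Weight ℂ t g₀, α.IsNonZero → α h ≠ 0) :
    LinearMap.range (LieAlgebra.ad ℂ g₀ (h : g₀)) ⊔ t.toSubmodule = ⊤ := by
  have h1 := LieAlgebra.cartan_sup_iSup_rootSpace_eq_top (K := ℂ) t
  rw [← LieSubmodule.toSubmodule_inj, LieSubmodule.sup_toSubmodule,
    LieSubmodule.iSup_toSubmodule] at h1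
  rw [eq_top_iff, ← LieSubmodule.top_toSubmodule (R := ℂ) (L := t) (M := g₀), ← h1]
  refine sup_le le_sup_right (iSup_le fun α => ?_)
  rw [LieSubmodule.iSup_toSubmodule]
  refine iSup_le fun hα => le_trans ?_ le_sup_left
  let N := LieAlgebra.rootSpace t α
  let f : N →ₗ[ℂ] N := toEnd ℂ t N h
  have hf : Function.Injective f := by
    rw [injective_iff_map_eq_zero]
    intro v hv
    have hv0 : ⁅(h : g₀), (v : g₀)⁆ = 0 := congrArg Subtype.val hv
    obtain ⟨k, hk⟩ := (mem_genWeightSpace g₀ α (v : g₀)).1 v.2 h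
    have h2 : (toEnd ℂ t g₀ h - α h • (1 : Module.End ℂ g₀)) (v : g₀) = (-α h) • (v : g₀) := by
      have : (toEnd ℂ t g₀ h) (v : g₀) = 0 := hv0
      rw [LinearMap.sub_apply, this, zero_sub, LinearMap.smul_apply, neg_smul]; rfl
    have h3 : ∀ k : ℕ, ((toEnd ℂ t g₀ h - α h • (1 : Module.End ℂ g₀)) ^ k) (v : g₀) =
        (-α h) ^ k • (v : g₀) := by
      intro k
      induction k with
      | zero => simp
      | succ k ih => rw [pow_succ', Module.End.mul_apply, ih, map_smul, h2, smul_smul, pow_succ]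
    rw [h3] at hk
    have := (smul_eq_zero.1 hk).resolve_left (pow_ne_zero _ (neg_ne_zero.2 (hh α hα)))
    exact Subtype.ext this
  have hs := LinearMap.surjective_of_injective hf
  intro v hv
  obtain ⟨w, hw⟩ := hs ⟨v, hv⟩
  exact ⟨w, congrArg Subtype.val hw⟩

/-- Conjugates of a Cartan subalgebra contain a neighbourhood of a regular element; in coordinates. -/
theorem conj_cartan_mem_nhds (t : LieSubalgebra ℂ g₀) [t.IsCartanSubalgebra] {h : t}
    (hh : ∀ α : Weight ℂ t g₀, α.IsNonZero → α h ≠ 0) {ι : Type*} [Fintype ι]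
    (b : Module.Basis ι ℂ g₀) :
    {c : ι → ℂ | ∃ (v : g₀) (s : t), b.equivFun (expAct g₀ v s) = c} ∈ nhds (b.equivFun (h : g₀)) := by
  let m := Module.finrank ℂ t
  let T := Module.finBasis ℂ t
  let E : ((ι → ℂ) × (Fin m → ℂ)) →ₗ[ℂ] Module.End ℂ g₀ :=
    (toEnd ℂ g₀ g₀ : g₀ →ₗ[ℂ] Module.End ℂ g₀) ∘ₗ b.equivFun.symm.toLinearMap ∘ₗ LinearMap.fst ℂ _ _
  let F : ((ι → ℂ) × (Fin m → ℂ)) → ι → ℂ := fun a i =>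
    b.coord i (expEnd (E a) (h : g₀)) + ∑ k, a.2 k * b.coord i (expEnd (E a) (T k : g₀))
  let D : ((ι → ℂ) × (Fin m → ℂ)) →ₗ[ℂ] (ι → ℂ) :=
    b.equivFun.toLinearMap ∘ₗ ((LinearMap.applyₗ (h : g₀) ∘ₗ E) +
      t.toSubmodule.subtype ∘ₗ T.equivFun.symm.toLinearMap ∘ₗ LinearMap.snd ℂ _ _)
  -- In coordinates `F` is the map `(v, s) ↦ exp (ad v) (h + s)`, whose derivative at the origin is
  -- `[v, h] + s`.
  have hF : HasStrictFDerivAt F (LinearMap.toContinuousLinearMap D) 0 := by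
    rw [hasStrictFDerivAt_pi']
    intro i
    have h1 := hasStrictFDerivAt_dual_expEnd E (b.coord i) (h : g₀)
    have h2 : ∀ k, HasStrictFDerivAt (fun a : (ι → ℂ) × (Fin m → ℂ) => a.2 k)
        ((ContinuousLinearMap.proj k).comp (ContinuousLinearMap.snd ℂ (ι → ℂ) (Fin m → ℂ))) 0 :=
      fun k => ((ContinuousLinearMap.proj k).comp
        (ContinuousLinearMap.snd ℂ (ι → ℂ) (Fin m → ℂ))).hasStrictFDerivAt
    have h3 := fun k => (h2 k).mul (hasStrictFDerivAt_dual_expEnd E (b.coord i) (T k : g₀))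
    have h4 := h1.add (HasStrictFDerivAt.fun_sum (u := Finset.univ) fun k _ => h3 k)
    refine h4.congr_fderiv ?_
    refine ContinuousLinearMap.ext fun a => ?_
    have hE0 : E 0 = 0 := map_zero E
    have h5 : T.equivFun.symm a.2 = ∑ k, a.2 k • T k := T.equivFun_symm_apply _
    have h6 : b.equivFun ((T.equivFun.symm a.2 : t) : g₀) i = ∑ k, a.2 k * b.coord i (T k : g₀) := by
      rw [h5]
      have : ((∑ k, a.2 k • T k : t) : g₀) = ∑ k, a.2 k • (T k : g₀) := by
        exact map_sum t.toSubmodule.subtype (fun k => a.2 k • T k) Finset.univ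
      rw [this, map_sum, Finset.sum_apply]
      exact Finset.sum_congr rfl fun k _ => by rw [map_smul]; rfl
    change b.coord i (E a (h : g₀)) + (∑ k, _ : _ →L[ℂ] ℂ) a = b.equivFun (E a (h : g₀) + ((T.equivFun.symm a.2 : t) : g₀)) i
    rw [map_add, Pi.add_apply, h6, sum_apply]
    congr 1
    refine Finset.sum_congr rfl fun k _ => ?_
    simp [hE0, expEnd_zero, mul_comm]
  have hsurj : Function.Surjective D := by
    intro c
    have : b.equivFun.symm c ∈ LinearMap.range (LieAlgebra.ad ℂ g₀ (h : g₀)) ⊔ t.toSubmodule := by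
      rw [range_ad_sup_eq_top t hh]; trivial
    obtain ⟨_, ⟨v, rfl⟩, s, hs, hvs⟩ := Submodule.mem_sup.1 this
    -- The sign turns `[v, h]` into `ad h v`.
    refine ⟨(b.equivFun (-v), T.equivFun ⟨s, hs⟩), ?_⟩
    change b.equivFun (⁅b.equivFun.symm (b.equivFun (-v)), (h : g₀)⁆ +
      ((T.equivFun.symm (T.equivFun ⟨s, hs⟩) : t) : g₀)) = c
    rw [LinearEquiv.symm_apply_apply, LinearEquiv.symm_apply_apply, neg_lie, lie_skew]
    change b.equivFun (LieAlgebra.ad ℂ g₀ (h : g₀) v + s) = c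
    rw [hvs, LinearEquiv.apply_symm_apply]
  have h2 := hF.map_nhds_eq_of_surj (LinearMap.range_eq_top.2 hsurj)
  have hF0 : F 0 = b.equivFun (h : g₀) := by
    ext i
    simp [F, expEnd_zero]
  rw [← hF0, ← h2]
  refine Filter.mem_of_superset (Filter.image_mem_map Filter.univ_mem) ?_
  rintro _ ⟨a, -, rfl⟩
  refine ⟨b.equivFun.symm a.1, h + T.equivFun.symm a.2, ?_⟩
  have h3 : ((h + T.equivFun.symm a.2 : t) : g₀) = (h : g₀) + ∑ k, a.2 k • (T k : g₀) := by
    rw [T.equivFun_symm_apply]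
    exact congrArg ((h : g₀) + ·) (map_sum t.toSubmodule.subtype (fun k => a.2 k • T k) Finset.univ)
  ext i
  rw [h3, map_add, map_sum, map_add, Pi.add_apply, map_sum, Finset.sum_apply]
  simp only [map_smul]
  rfl

variable {g₁ : Type*} [AddCommGroup g₁] [Module ℂ g₁] [LieRingModule g₀ g₁] [LieModule ℂ g₀ g₁]
  [Module.Finite ℂ g₁]

theorem powerDisc_expAct (v u : g₀) :
    powerDisc (toEnd ℂ g₀ g₁ (expAct g₀ v u)) = powerDisc (toEnd ℂ g₀ g₁ u) := by
  refine powerDisc_conj (T := expAct g₁ v)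
    ⟨⟨expAct g₁ v, expAct g₁ (-v), ?_, ?_⟩, rfl⟩ ?_
  · exact LinearMap.ext fun y => expAct_apply_neg g₀ v y
  · exact LinearMap.ext fun y => expAct_neg_apply g₀ v y
  · exact LinearMap.ext fun y => (expAct_lie g₀ v u y).symm

/-- If some element of `g₀` has simple spectrum on `g₁`, then so has some element of a given Cartan
subalgebra. -/
theorem exists_powerDisc_ne_zero_of_cartan (t : LieSubalgebra ℂ g₀) [t.IsCartanSubalgebra] {u : g₀}
    (hu : powerDisc (toEnd ℂ g₀ g₁ u) ≠ 0) : ∃ h : t, powerDisc (toEnd ℂ g₀ g₁ (h : g₀)) ≠ 0 := by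
  obtain ⟨h, hh⟩ := exists_regular t
  let b := Module.finBasis ℂ g₀
  obtain ⟨p, hp⟩ := exists_polynomial_powerDisc (toEnd ℂ g₀ g₁ (h : g₀))
    (toEnd ℂ g₀ g₁ (u - (h : g₀)))
  have hp' : ∀ s : ℂ, p.eval s = powerDisc (toEnd ℂ g₀ g₁ ((h : g₀) + s • (u - (h : g₀)))) := by
    intro s
    rw [hp, map_add, map_smul]
  have hp0 : p ≠ 0 := by
    rintro rfl
    have := hp' 1
    rw [one_smul, add_sub_cancel, Polynomial.eval_zero] at this
    exact hu this.symm
  have hcont : Continuous fun s : ℂ => b.equivFun ((h : g₀) + s • (u - (h : g₀))) := by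
    simp only [map_add, map_smul]
    fun_prop
  have hnhds : {s : ℂ | ∃ (v : g₀) (s' : t), b.equivFun (expAct g₀ v s') =
      b.equivFun ((h : g₀) + s • (u - (h : g₀)))} ∈ nhds (0 : ℂ) := by
    have h1 := conj_cartan_mem_nhds t hh b
    have h2 : b.equivFun (h : g₀) = b.equivFun ((h : g₀) + (0 : ℂ) • (u - (h : g₀))) := by
      rw [zero_smul, add_zero]
    rw [h2] at h1
    exact hcont.continuousAt.preimage_mem_nhds h1
  -- The discriminant on the line from `h` to `u` is a nonzero polynomial, since it is nonzero at `s
  -- = 1`. Infinitely many points near `s = 0` are conjugate into `t`, and one of them is not a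
  -- root.
  obtain ⟨s, ⟨v, s', hs⟩, hroot⟩ := (infinite_of_mem_nhds (0 : ℂ) hnhds).exists_notMem_finite
    (p.rootSet_finite ℂ)
  refine ⟨s', ?_⟩
  rw [← powerDisc_expAct v, b.equivFun.injective hs, ← hp']
  intro h0
  exact hroot ((Polynomial.mem_rootSet).2 ⟨hp0, by simpa using h0⟩)

/-- A nilpotent subalgebra containing an element with simple spectrum acts diagonally. -/
theorem exists_weightBasis {g₀ g₁ : Type*} [LieRing g₀] [LieAlgebra ℂ g₀] [AddCommGroup g₁]
    [Module ℂ g₁] [LieRingModule g₀ g₁] [LieModule ℂ g₀ g₁] [Module.Finite ℂ g₁] (t : LieSubalgebra ℂ g₀) [LieRing.IsNilpotent t] {h : t}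
    (hh : powerDisc (toEnd ℂ g₀ g₁ (h : g₀)) ≠ 0) :
    ∃ (b : Module.Basis (Fin (Module.finrank ℂ g₁)) ℂ g₁)
      (wt : Fin (Module.finrank ℂ g₁) → Module.Dual ℂ t), Function.Injective wt ∧
      ∀ (τ : t) i, ⁅(τ : g₀), b i⁆ = wt i τ • b i := by
  obtain ⟨b, c, hc, hb⟩ := exists_eigenbasis_of_powerDisc_ne_zero hh
  have hb' : ∀ i, ⁅(h : g₀), b i⁆ = c i • b i := hb
  have hcoord : ∀ i y, b.coord i ⁅(h : g₀), y⁆ = c i * b.coord i y := by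
    intro i y
    conv_lhs => rw [← b.sum_repr y, lie_sum, map_sum]
    rw [Finset.sum_eq_single i]
    · simp [hb', mul_comm]
    · intro j _ hj
      simp [hb', hj]
    · simp
  obtain ⟨k, hk⟩ := LieModule.exists_forall_pow_toEnd_eq_zero ℂ t t
  -- Applying `ad h` multiplies the `(i, j)` matrix entry by `c i - c j`. As `ad h` is nilpotent on
  -- `t`, the off-diagonal entries of every `τ` vanish.
  have hpow : ∀ (n : ℕ) (τ : t) i j, b.coord i ⁅((((toEnd ℂ t t h) ^ n) τ : t) : g₀), b j⁆ =
      (c i - c j) ^ n * b.coord i ⁅(τ : g₀), b j⁆ := by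
    intro n
    induction n with
    | zero => simp
    | succ n ih =>
      intro τ i j
      have h1 : ((((toEnd ℂ t t h) ^ (n + 1)) τ : t) : g₀) =
          ⁅(h : g₀), ((((toEnd ℂ t t h) ^ n) τ : t) : g₀)⁆ := by
        rw [pow_succ', Module.End.mul_apply]; rfl
      rw [h1, lie_lie, map_sub, hcoord, hb', lie_smul, map_smul, ih, smul_eq_mul]
      ring
  have hoff : ∀ (τ : t) i j, i ≠ j → b.coord i ⁅(τ : g₀), b j⁆ = 0 := by
    intro τ i j hij
    have h1 := hpow k τ i j
    rw [hk, LinearMap.zero_apply] at h1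
    have h2 : (c i - c j) ^ k ≠ 0 := pow_ne_zero _ (sub_ne_zero.2 (hc.ne hij))
    simpa [h2] using h1.symm
  let wt : Fin (Module.finrank ℂ g₁) → Module.Dual ℂ t := fun i =>
    b.coord i ∘ₗ (toEnd ℂ t g₁ : t →ₗ[ℂ] Module.End ℂ g₁).flip (b i)
  have hwt : ∀ i τ, wt i τ = b.coord i ⁅(τ : g₀), b i⁆ := fun i τ => rfl
  refine ⟨b, wt, fun i j hij => hc ?_, fun τ i => ?_⟩
  · have := LinearMap.congr_fun hij h
    rw [hwt, hwt, hcoord, hcoord] at this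
    simpa using this
  · refine b.ext_elem fun j => ?_
    rw [hwt]
    by_cases hji : j = i
    · subst hji; simp
    · have := hoff τ j i hji
      rw [Module.Basis.coord_apply] at this
      simp [this, Ne.symm hji]

end Density

end LieSuper
end

/-! ### Rank of a differential with a homotopy -/

noncomputable section

namespace LieSuper

section RankFormula

open Module

variable {U V : Type*} [AddCommGroup U] [Module ℂ U] [AddCommGroup V] [Module ℂ V]
  [Module.Finite ℂ V]

theorem finrank_map_add_finrank_inf_ker (f : V →ₗ[ℂ] U) (S : Submodule ℂ V) :
    finrank ℂ (S.map f) + finrank ℂ (S ⊓ LinearMap.ker f : Submodule ℂ V) = finrank ℂ S := by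
  have h := LinearMap.finrank_range_add_finrank_ker (f.domRestrict S)
  rw [LinearMap.range_domRestrict] at h
  have h2 : finrank ℂ (LinearMap.ker (f.domRestrict S)) =
      finrank ℂ (S ⊓ LinearMap.ker f : Submodule ℂ V) := by
    rw [LinearMap.ker_domRestrict]
    have := LinearEquiv.finrank_eq (Submodule.equivMapOfInjective S.subtype S.injective_subtype
      ((LinearMap.ker f).submoduleOf S))
    rw [Submodule.submoduleOf, Submodule.map_comap_subtype] at this
    exact this
  rw [← h2]; exact h

/-- `D` is injective on its range, so it maps the stable subspace `R` onto itself; a preimage of `D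
z` in `R` must equal `z`. -/
theorem mem_of_apply_mem {D : Module.End ℂ V} (hD : Disjoint (LinearMap.range D) (LinearMap.ker D))
    {R : Submodule ℂ V} (hR : R ≤ LinearMap.range D) (hDR : R.map D ≤ R) {z : V}
    (hz : z ∈ LinearMap.range D) (hDz : D z ∈ R) : z ∈ R := by
  have h1 : R ⊓ LinearMap.ker D = ⊥ := (hD.mono_left hR).eq_bot
  have h2 := finrank_map_add_finrank_inf_ker D R
  rw [h1, finrank_bot, add_zero] at h2
  have h3 : R.map D = R := Submodule.eq_of_le_of_finrank_eq hDR h2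
  rw [← h3] at hDz
  obtain ⟨w, hw, hwz⟩ := hDz
  have h4 : z - w ∈ (⊥ : Submodule ℂ V) := by
    rw [← hD.eq_bot]
    exact ⟨sub_mem hz (hR hw), LinearMap.mem_ker.2 (by rw [map_sub, hwz, sub_self])⟩
  rw [Submodule.mem_bot, sub_eq_zero] at h4
  rwa [h4]

/-- Nondegeneracy identifies `f` with the transpose of `g`, which has the same rank as `g`. -/
theorem finrank_range_eq_of_adjoint {U V : Type*} [AddCommGroup U] [Module ℂ U]
    [AddCommGroup V] [Module ℂ V] [Module.Finite ℂ U] {B₀ : LinearMap.BilinForm ℂ U}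
    {B₁ : LinearMap.BilinForm ℂ V}
    (h₀ : B₀.Nondegenerate) (h₁ : B₁.Nondegenerate) {f : U →ₗ[ℂ] V} {g : V →ₗ[ℂ] U}
    (h : ∀ u z, B₁ (f u) z = B₀ u (g z)) :
    finrank ℂ (LinearMap.range f) = finrank ℂ (LinearMap.range g) := by
  have hcomp : B₁ ∘ₗ f = g.dualMap ∘ₗ B₀ := by
    ext u z
    exact h u z
  have hinj₁ : Function.Injective B₁ := LinearMap.ker_eq_bot.1 (LinearMap.separatingLeft_iff_ker_eq_bot.1 h₁.1)
  have hinj₀ : Function.Injective B₀ := LinearMap.ker_eq_bot.1 (LinearMap.separatingLeft_iff_ker_eq_bot.1 h₀.1)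
  have hsurj₀ : LinearMap.range B₀ = ⊤ := LinearMap.range_eq_top.2
    ((LinearMap.injective_iff_surjective_of_finrank_eq_finrank Subspace.dual_finrank_eq.symm).1 hinj₀)
  have h1 : finrank ℂ (LinearMap.range (B₁ ∘ₗ f)) = finrank ℂ (LinearMap.range f) := by
    rw [LinearMap.range_comp]
    exact (LinearEquiv.finrank_eq (Submodule.equivMapOfInjective _ hinj₁ _)).symm
  rw [← h1, hcomp, LinearMap.range_comp_of_range_eq_top _ hsurj₀,
    LinearMap.finrank_range_dualMap_eq_finrank_range]

variable [Module.Finite ℂ U]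

/-- The homotopy makes the sequence `d₀`, `d₁` exact on the range of `D`, so the rank of `D` is the
sum of the ranks of `D d₀` and `d₁ D`. These are equal by adjointness, up to a sign. What is left of
`d₀` is its range inside the kernel of `D`. -/
theorem two_mul_finrank_range_of_homotopy {B₀ : LinearMap.BilinForm ℂ U}
    {B₁ : LinearMap.BilinForm ℂ V} (h₀ : B₀.Nondegenerate) (h₁ : B₁.Nondegenerate)
    {d₀ s₀ : U →ₗ[ℂ] V} {d₁ s₁ : V →ₗ[ℂ] U} {D₀ : Module.End ℂ U} {D : Module.End ℂ V}
    (hdd : ∀ u, d₁ (d₀ u) = 0) (hDd : ∀ u, D (d₀ u) = d₀ (D₀ u)) (hDd' : ∀ z, D₀ (d₁ z) = d₁ (D z))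
    (hhom : ∀ z, D z = -d₀ (s₁ z) - s₀ (d₁ z)) (hadj : ∀ u z, B₁ (d₀ u) z = B₀ u (d₁ z))
    (hskew : ∀ z w, B₁ (D z) w = -B₁ z (D w))
    (hD : Disjoint (LinearMap.range D) (LinearMap.ker D)) :
    2 * finrank ℂ (LinearMap.range d₀) = finrank ℂ (LinearMap.range D) +
      2 * finrank ℂ (LinearMap.range d₀ ⊓ LinearMap.ker D : Submodule ℂ V) := by
  have e1 := finrank_map_add_finrank_inf_ker D (LinearMap.range d₀)
  have e2 := finrank_map_add_finrank_inf_ker d₁ (LinearMap.range D)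
  rw [← LinearMap.range_comp] at e1 e2
  have e3 : finrank ℂ (LinearMap.range (D ∘ₗ d₀)) = finrank ℂ (LinearMap.range (d₁ ∘ₗ D)) := by
    rw [finrank_range_eq_of_adjoint h₀ h₁ (f := D ∘ₗ d₀) (g := -(d₁ ∘ₗ D)), LinearMap.range_neg]
    intro u z
    rw [LinearMap.comp_apply, hskew, hadj, LinearMap.neg_apply, map_neg]
    rfl
  have e4 : LinearMap.range D ⊓ LinearMap.ker d₁ = LinearMap.range (D ∘ₗ d₀) := by
    have hle : LinearMap.range (D ∘ₗ d₀) ≤ LinearMap.range D := LinearMap.range_comp_le_range _ _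
    have hDR : (LinearMap.range (D ∘ₗ d₀)).map D ≤ LinearMap.range (D ∘ₗ d₀) := by
      rintro _ ⟨_, ⟨u, rfl⟩, rfl⟩
      exact ⟨D₀ u, by rw [LinearMap.comp_apply, LinearMap.comp_apply, hDd u]⟩
    refine le_antisymm ?_ (le_inf hle ?_)
    · rintro z ⟨hz, hz1⟩
      -- If `d₁ z = 0`, then `D z = -d₀ (s₁ z)`, so `D (D z)` lies in the range of `D d₀`; two
      -- applications of the lemma cancel `D` twice.
      refine mem_of_apply_mem hD hle hDR hz (mem_of_apply_mem hD hle hDR ⟨z, rfl⟩ ?_)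
      refine ⟨-s₁ z, ?_⟩
      rw [LinearMap.comp_apply, hhom z, LinearMap.mem_ker.1 hz1, map_zero, sub_zero, map_neg]
    · rintro _ ⟨u, rfl⟩
      rw [LinearMap.mem_ker, LinearMap.comp_apply, ← hDd', hdd, map_zero]
  rw [e4] at e2
  omega

end RankFormula

/-! ### Action of the generalized root spaces on a diagonalized module -/

section WeightBasis

open LieModule

variable {g₀ g₁ : Type*} [LieRing g₀] [LieAlgebra ℂ g₀] [AddCommGroup g₁]
    [Module ℂ g₁] [LieRingModule g₀ g₁] [LieModule ℂ g₀ g₁]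

/-- A basis of `g₁` on which `t` acts diagonally, with the given weights. -/
def IsWeightBasis {t : LieSubalgebra ℂ g₀} {ι : Type*} (b : Module.Basis ι ℂ g₁)
    (wt : ι → Module.Dual ℂ t) : Prop :=
  ∀ (τ : t) i, ⁅(τ : g₀), b i⁆ = wt i τ • b i

theorem IsWeightBasis.basis_mem_genWeightSpace {t : LieSubalgebra ℂ g₀} {ι : Type*}
    {b : Module.Basis ι ℂ g₁} {wt : ι → Module.Dual ℂ t} (hb : IsWeightBasis b wt) [LieRing.IsNilpotent t] (i : ι) :
    b i ∈ genWeightSpace g₁ (wt i : t → ℂ) :=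
  weightSpace_le_genWeightSpace g₁ _ ((mem_weightSpace (L := t) _ _).2 fun τ => hb τ i)

variable {t : LieSubalgebra ℂ g₀} {ι : Type*} [Fintype ι] {b : Module.Basis ι ℂ g₁}
  {wt : ι → Module.Dual ℂ t}

theorem IsWeightBasis.coord_lie (hb : IsWeightBasis b wt) (τ : t) (i : ι) (y : g₁) :
    b.coord i ⁅(τ : g₀), y⁆ = wt i τ * b.coord i y := by
  classical
  conv_lhs => rw [← b.sum_repr y, lie_sum, map_sum]
  rw [Finset.sum_eq_single i]
  · simp [hb τ _, mul_comm]
  · intro j _ hj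
    simp [hb τ _, hj]
  · simp

theorem IsWeightBasis.lie_eq_of_mem_genWeightSpace [LieRing.IsNilpotent t]
    (hb : IsWeightBasis b wt) {χ : t → ℂ} {y : g₁} (hy : y ∈ genWeightSpace g₁ χ) (τ : t) :
    ⁅(τ : g₀), y⁆ = χ τ • y := by
  obtain ⟨k, hk⟩ := (mem_genWeightSpace g₁ χ y).1 hy τ
  refine b.ext_elem fun i => ?_
  change b.coord i ⁅(τ : g₀), y⁆ = b.coord i (χ τ • y)
  have h : ∀ n : ℕ, b.coord i (((toEnd ℂ t g₁ τ - χ τ • (1 : Module.End ℂ g₁)) ^ n) y) =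
      (wt i τ - χ τ) ^ n * b.coord i y := by
    intro n
    induction n with
    | zero => simp
    | succ n ih =>
      rw [pow_succ', Module.End.mul_apply, LinearMap.sub_apply, map_sub, LinearMap.smul_apply,
        map_smul, Module.End.one_apply]
      have := hb.coord_lie τ i (((toEnd ℂ t g₁ τ - χ τ • (1 : Module.End ℂ g₁)) ^ n) y)
      change b.coord i ⁅(τ : g₀), _⁆ - _ = _
      rw [this, ih, smul_eq_mul]
      ring
  have h1 := h k
  rw [hk, map_zero] at h1
  rw [hb.coord_lie, map_smul, smul_eq_mul]
  rcases mul_eq_zero.1 h1.symm with h2 | h2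
  · rw [sub_eq_zero.1 (eq_zero_of_pow_eq_zero h2)]
  · rw [h2, mul_zero, mul_zero]

/-- A generalized root vector acts on `g₁` as a genuine weight vector: it maps each `b i` into a
generalized weight space, on which `t` is already diagonal. -/
theorem IsWeightBasis.lie_lie_of_mem_rootSpace [LieRing.IsNilpotent t]
    (hb : IsWeightBasis b wt) {α : t → ℂ} {e : g₀} (he : e ∈ LieAlgebra.rootSpace t α) (τ : t)
    (v : g₁) : ⁅(τ : g₀), ⁅e, v⁆⁆ = ⁅e, ⁅(τ : g₀), v⁆⁆ + α τ • ⁅e, v⁆ := by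
  let E : Module.End ℂ g₁ := toEnd ℂ g₀ g₁ e
  let H : Module.End ℂ g₁ := toEnd ℂ g₀ g₁ τ
  have : H * E = E * H + α τ • E := by
    refine b.ext fun i => ?_
    have h1 := hb.lie_eq_of_mem_genWeightSpace
      (LieAlgebra.lie_mem_genWeightSpace_of_mem_genWeightSpace he (hb.basis_mem_genWeightSpace i)) τ
    change ⁅(τ : g₀), ⁅e, b i⁆⁆ = ⁅e, ⁅(τ : g₀), b i⁆⁆ + α τ • ⁅e, b i⁆
    rw [h1, hb τ i, lie_smul, Pi.add_apply, add_smul, add_comm]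
  exact LinearMap.congr_fun this v

/-- There are finitely many weights, so for large `k` no translate `k • α + wt i` is a weight. -/
theorem IsWeightBasis.isNilpotent_toEnd [LieRing.IsNilpotent t] [Module.Finite ℂ g₁]
    (hb : IsWeightBasis b wt) {α : t → ℂ} (hα : α ≠ 0) {e : g₀}
    (he : e ∈ LieAlgebra.rootSpace t α) : IsNilpotent (toEnd ℂ g₀ g₁ e) := by
  have h := Filter.eventually_all.2 fun i : ι =>
    eventually_genWeightSpace_smul_add_eq_bot (L := t) g₁ α (wt i : t → ℂ) hα
  obtain ⟨k, hk⟩ := h.exists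
  refine ⟨k, b.ext fun i => ?_⟩
  have := LieAlgebra.toEnd_pow_apply_mem he (hb.basis_mem_genWeightSpace i) k
  rw [hk i] at this
  exact (LieSubmodule.mem_bot _).1 this

theorem IsWeightBasis.isNilWeightVector [LieRing.IsNilpotent t] [Module.Finite ℂ g₁]
    (hb : IsWeightBasis b wt) {α : t → ℂ} (hα : α ≠ 0) {e : g₀}
    (he : e ∈ LieAlgebra.rootSpace t α) : IsNilWeightVector t g₁ e :=
  ⟨hb.isNilpotent_toEnd hα he, α, fun τ v => hb.lie_lie_of_mem_rootSpace he τ v⟩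

theorem IsWeightBasis.span_isNilWeightVector_union [t.IsCartanSubalgebra] [Module.Finite ℂ g₀]
    [Module.Finite ℂ g₁] (hb : IsWeightBasis b wt) :
    Submodule.span ℂ ({e | IsNilWeightVector t g₁ e} ∪ (t : Set g₀)) = ⊤ := by
  have h1 := LieAlgebra.cartan_sup_iSup_rootSpace_eq_top (K := ℂ) t
  rw [← LieSubmodule.toSubmodule_inj, LieSubmodule.sup_toSubmodule,
    LieSubmodule.iSup_toSubmodule] at h1
  rw [eq_top_iff, ← LieSubmodule.top_toSubmodule (R := ℂ) (L := t) (M := g₀), ← h1]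
  refine sup_le (fun u hu => Submodule.subset_span (Or.inr hu)) (iSup_le fun α => ?_)
  rw [LieSubmodule.iSup_toSubmodule]
  exact iSup_le fun hα e he => Submodule.subset_span (Or.inl (hb.isNilWeightVector hα he))

end WeightBasis

end LieSuper
end

/-! ### Root vectors and isotropic odd roots -/

noncomputable section

namespace LieSuper

section RootVectors

open LieModule LieSuperalgebra

/-- A diagonalizable commutator `E F - F E` that commutes with `F` is zero. -/
theorem eq_zero_of_eq_commutator {V ι : Type*} [AddCommGroup V] [Module ℂ V] [Fintype ι]
    (b : Module.Basis ι ℂ V) {H E F : Module.End ℂ V} {c : ι → ℂ} (hH : ∀ i, H (b i) = c i • b i)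
    (hEF : H = E * F - F * E) (hF : Commute H F) : H = 0 := by
  classical
  refine b.ext fun i => ?_
  suffices h : c i = 0 by rw [hH, h, zero_smul, LinearMap.zero_apply]
  by_contra hi
  -- The polynomial `q` vanishes at every eigenvalue except `c i`, so `q(H)` is a multiple of the
  -- projection to that eigenspace. It commutes with `F`, forcing `tr (H q(H)) = 0`, while a direct
  -- count gives a nonzero multiple of `c i`.
  let q : Polynomial ℂ := ∏ μ ∈ (Finset.univ.image c).erase (c i), (Polynomial.X - Polynomial.C μ)
  have hq : ∀ j, c j ≠ c i → q.eval (c j) = 0 := by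
    intro j hj
    rw [Polynomial.eval_prod]
    exact Finset.prod_eq_zero (i := c j) (by simp [hj]) (by simp)
  have hqi : q.eval (c i) ≠ 0 := by
    rw [Polynomial.eval_prod, Finset.prod_ne_zero_iff]
    intro μ hμ
    have := (Finset.mem_erase.1 hμ).1
    simpa [sub_eq_zero] using this.symm
  let T : Module.End ℂ V := Polynomial.aeval H q
  have hT : ∀ j, T (b j) = q.eval (c j) • b j := fun j =>
    Module.End.aeval_apply_of_hasEigenvector
      (Module.End.hasEigenvector_iff.2 ⟨Module.End.mem_eigenspace_iff.2 (hH j), b.ne_zero j⟩)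
  have hTF : Commute T F := by
    have := Polynomial.aeval_eq_sum_range (p := q) H
    change T = _ at this
    rw [this]
    exact Commute.sum_left _ _ _ fun k _ => (hF.pow_left k).smul_left _
  have h0 : LinearMap.trace ℂ V (H * T) = 0 := by
    rw [hEF, sub_mul, map_sub, mul_assoc, ← hTF.eq, LinearMap.trace_mul_comm ℂ E, mul_assoc,
      LinearMap.trace_mul_comm ℂ (F * E), sub_self]
  have h1 : LinearMap.trace ℂ V (H * T) = ∑ j, c j * q.eval (c j) := by
    have hHT : ∀ j, (H * T) (b j) = (c j * q.eval (c j)) • b j := by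
      intro j
      rw [Module.End.mul_apply, hT, map_smul, hH, smul_smul, mul_comm]
    simpa using trace_pow_eq_sum b hHT 1
  have h2 : ∑ j, c j * q.eval (c j) = ∑ j, if c j = c i then c i * q.eval (c i) else 0 := by
    refine Finset.sum_congr rfl fun j _ => ?_
    split_ifs with h
    · rw [h]
    · rw [hq j h, mul_zero]
  rw [h1, h2, ← Finset.sum_filter, Finset.sum_const, nsmul_eq_mul] at h0
  have h3 : ((Finset.univ.filter fun j => c j = c i).card : ℂ) ≠ 0 := by
    rw [Nat.cast_ne_zero]
    exact Finset.card_ne_zero.2 ⟨i, by simp⟩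
  exact mul_ne_zero h3 (mul_ne_zero hi hqi) h0

variable {g₀ g₁ : Type*} [LieRing g₀] [LieAlgebra ℂ g₀] [AddCommGroup g₁]
    [Module ℂ g₁] [LieRingModule g₀ g₁] [LieModule ℂ g₀ g₁] [LieSuperalgebra g₀ g₁]

theorem IsInvariantForm.lie_skew {B₀ : LinearMap.BilinForm ℂ g₀} {B₁ : LinearMap.BilinForm ℂ g₁}
    (hB : IsInvariantForm B₀ B₁) (u : g₀) (x y : g₁) : B₁ ⁅u, x⁆ y = -B₁ x ⁅u, y⁆ := by
  rw [hB.skew x, neg_neg, hB.lie_odd, hB.lie_odd, oddBracket_symm]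

theorem lie_oddBracket_of_weight {u : g₀} {x y : g₁} {a c : ℂ} (hx : ⁅u, x⁆ = a • x)
    (hy : ⁅u, y⁆ = c • y) : ⁅u, (oddBracket x y : g₀)⁆ = (a + c) • (oddBracket x y : g₀) := by
  rw [lie_oddBracket, hx, hy, map_smul, map_smul, LinearMap.smul_apply, add_smul]

theorem oddBracket_lie_self {x : g₁} (hx : (oddBracket x x : g₀) = 0) (w : g₁) :
    ⁅(oddBracket x w : g₀), x⁆ = 0 := by
  have h := oddBracket_jacobi (g₀ := g₀) x w x
  rw [hx, zero_lie, add_zero, oddBracket_symm w x, ← two_smul ℂ] at h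
  exact (smul_eq_zero.1 h).resolve_left two_ne_zero

variable {t : LieSubalgebra ℂ g₀}

theorem mem_cartan_of_lie_eq_zero [t.IsCartanSubalgebra] [Module.Finite ℂ g₀] {u : g₀}
    (hu : ∀ τ : t, ⁅(τ : g₀), u⁆ = 0) : u ∈ t := by
  have h : u ∈ LieAlgebra.rootSpace t (0 : t → ℂ) :=
    weightSpace_le_genWeightSpace g₀ _ ((mem_weightSpace (L := t) _ _).2 fun τ => by
      rw [Pi.zero_apply, zero_smul]; exact hu τ)
  rw [LieAlgebra.rootSpace_zero_eq] at h
  exact h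

variable {ι : Type*} [Fintype ι] {b : Module.Basis ι ℂ g₁} {wt : ι → Module.Dual ℂ t}
  {B₀ : LinearMap.BilinForm ℂ g₀} {B₁ : LinearMap.BilinForm ℂ g₁}

/-- Some basis vector pairs nontrivially with `z`, and invariance forces its weight to be the
negative of `χ`. -/
theorem IsWeightBasis.exists_dual_weight (hb : IsWeightBasis b wt) (hB : IsInvariantForm B₀ B₁)
    {z : g₁} (hz : z ≠ 0) {χ : Module.Dual ℂ t} (hχ : ∀ τ : t, ⁅(τ : g₀), z⁆ = χ τ • z) :
    ∃ w : g₁, (∀ τ : t, ⁅(τ : g₀), w⁆ = (-χ τ) • w) ∧ B₁ z w = 1 := by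
  obtain ⟨j, hj⟩ : ∃ j, B₁ z (b j) ≠ 0 := by
    by_contra! h
    have : B₁ z = 0 := b.ext h
    exact hz (hB.nondegenerate_odd.1 z fun y => by rw [this, LinearMap.zero_apply])
  have hwt : ∀ τ, wt j τ = -χ τ := by
    intro τ
    have h := hB.lie_skew τ z (b j)
    rw [hχ, hb τ j, map_smul, map_smul, LinearMap.smul_apply, smul_eq_mul, smul_eq_mul,
      ← neg_mul] at h
    rw [mul_right_cancel₀ hj h, neg_neg]
  refine ⟨(B₁ z (b j))⁻¹ • b j, fun τ => ?_, ?_⟩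
  · rw [lie_smul, hb τ j, hwt, smul_comm]
  · rw [map_smul, smul_eq_mul, inv_mul_cancel₀ hj]

theorem IsInvariantForm.oddBracket_apply (hB : IsInvariantForm B₀ B₁) {x y : g₁}
    {χ : Module.Dual ℂ t} (hx : ∀ τ : t, ⁅(τ : g₀), x⁆ = χ τ • x) (hxy : B₁ x y = 1) (τ : t) :
    B₀ (oddBracket x y) τ = χ τ := by
  rw [hB.symm, ← hB.lie_odd, hx, map_smul, LinearMap.smul_apply, hxy, smul_eq_mul, mul_one]

/-- If a root `α` vanishes on the coroot of the isotropic odd root `β`, then root vectors for `α`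
annihilate the odd root vectors for `β`. -/
theorem IsWeightBasis.lie_eq_zero_of_isotropic [t.IsCartanSubalgebra] [Module.Finite ℂ g₀]
    [Module.Finite ℂ g₁] (hb : IsWeightBasis b wt) (hB : IsInvariantForm B₀ B₁)
    (hker : (∀ y : g₁, y = 0) ∨ ∀ u v : g₀, (∀ y : g₁, ⁅⁅u, v⁆, y⁆ = 0) → ⁅u, v⁆ = 0)
    {α β : Module.Dual ℂ t} (hα : α ≠ 0) {e : g₀} (he : e ∈ LieAlgebra.rootSpace t (α : t → ℂ))
    {x : g₁} (hx : ∀ τ : t, ⁅(τ : g₀), x⁆ = β τ • x) (hxx : (oddBracket x x : g₀) = 0) {h : t}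
    (hh : ∀ τ : t, B₀ h τ = β τ) (hαh : α h = 0) : ⁅e, x⁆ = 0 := by
  by_contra hz
  have hez : ∀ τ : t, ⁅(τ : g₀), ⁅e, x⁆⁆ = (α + β) τ • ⁅e, x⁆ := by
    intro τ
    rw [hb.lie_lie_of_mem_rootSpace he, hx, lie_smul, LinearMap.add_apply, add_smul, add_comm]
  -- From a nonzero `[e, x]`, its dual vector gives `f = [x, w]` of weight `-α` and `k = [e, f]`,
  -- which represents `α` on `t`. Moreover `f` kills `x`, and `β k = α h = 0` by symmetry of the
  -- form.
  obtain ⟨w, hw, hzw⟩ := hb.exists_dual_weight hB hz hez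
  obtain ⟨f, hf⟩ : ∃ f : g₀, f = oddBracket x w := ⟨_, rfl⟩
  have hfτ : ∀ τ : t, ⁅(τ : g₀), f⁆ = (-α τ) • f := by
    intro τ
    rw [hf, lie_oddBracket_of_weight (hx τ) (hw τ)]
    congr 1
    rw [LinearMap.add_apply]; ring
  have hkt : ⁅e, f⁆ ∈ t := by
    have h1 : f ∈ genWeightSpace g₀ (-α : t → ℂ) :=
      weightSpace_le_genWeightSpace g₀ _ ((mem_weightSpace (L := t) _ _).2 hfτ)
    have h2 := LieAlgebra.lie_mem_genWeightSpace_of_mem_genWeightSpace he h1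
    rw [add_neg_cancel] at h2
    have h3 : ⁅e, f⁆ ∈ LieAlgebra.rootSpace t (0 : t → ℂ) := h2
    rw [LieAlgebra.rootSpace_zero_eq] at h3
    exact h3
  obtain ⟨k, hk⟩ : ∃ k : t, (k : g₀) = ⁅e, f⁆ := ⟨⟨_, hkt⟩, rfl⟩
  have hkτ : ∀ τ : t, B₀ k τ = α τ := by
    intro τ
    rw [hk, hB.lie_even, ← lie_skew, hfτ, neg_smul, neg_neg, map_smul, hf, ← hB.lie_odd, hzw,
      smul_eq_mul, mul_one]
  have hβk : β k = 0 := by rw [← hh, hB.symm, hkτ, hαh]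
  have hfx : ⁅f, x⁆ = 0 := by rw [hf]; exact oddBracket_lie_self hxx w
  have hfe : ∀ v : g₁, ⁅f, ⁅e, v⁆⁆ = ⁅e, ⁅f, v⁆⁆ - ⁅(k : g₀), v⁆ := by
    intro v
    rw [hk, leibniz_lie e f v]
    abel
  let E : Module.End ℂ g₁ := toEnd ℂ g₀ g₁ e
  -- If `α k = 0`, then `e`, `f`, `k` satisfy Heisenberg relations on `g₁`, so the diagonalizable
  -- `k` acts as zero there; `hker` then gives `k = 0`, hence `α = 0`. If not, they generate an
  -- `sl(2)` in which `x` has weight zero and is killed by `f`.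
  by_cases ha : α k = 0
  · have hk0 : ∀ y : g₁, ⁅⁅e, f⁆, y⁆ = 0 := by
      have h0 : toEnd ℂ g₀ g₁ (k : g₀) = 0 := by
        refine eq_zero_of_eq_commutator b (E := E) (F := toEnd ℂ g₀ g₁ f) (c := fun i => wt i k)
          (fun i => hb k i) ?_ ?_
        · refine LinearMap.ext fun v => ?_
          have := hfe v
          change ⁅(k : g₀), v⁆ = ⁅e, ⁅f, v⁆⁆ - ⁅f, ⁅e, v⁆⁆
          rw [this]; abel
        · refine LinearMap.ext fun v => ?_
          change ⁅(k : g₀), ⁅f, v⁆⁆ = ⁅f, ⁅(k : g₀), v⁆⁆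
          rw [leibniz_lie, hfτ, ha, neg_zero, zero_smul, zero_lie, zero_add]
      intro y
      rw [← hk]
      exact LinearMap.congr_fun h0 y
    rcases hker with hker | hker
    · exact hz (hker _)
    · refine hα (LinearMap.ext fun τ => ?_)
      rw [← hkτ, hk, hker e f hk0, map_zero, LinearMap.zero_apply, LinearMap.zero_apply]
  · have hkE : ∀ n : ℕ, ⁅(k : g₀), (E ^ n) x⁆ = ((n : ℂ) * α k) • (E ^ n) x := by
      intro n
      induction n with
      | zero => simp [hx, hβk]
      | succ n ih =>
        rw [pow_succ', Module.End.mul_apply]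
        change ⁅(k : g₀), ⁅e, (E ^ n) x⁆⁆ = _ • ⁅e, (E ^ n) x⁆
        rw [hb.lie_lie_of_mem_rootSpace he, ih, lie_smul, ← add_smul]
        congr 1
        push_cast
        ring
    -- The factor `n (n + 1) / 2` is the sum of the eigenvalues `0, ..., n` of `k` on the vectors `E
    -- ^ i x`, divided by `α k`. It is nonzero from `n = 1` on, so `e x ≠ 0` would keep all powers
    -- of `E` nonzero on `x`.
    have hfE : ∀ n : ℕ, ⁅f, (E ^ (n + 1)) x⁆ = (-(α k * ((n : ℂ) * (n + 1) / 2))) • (E ^ n) x := by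
      intro n
      induction n with
      | zero =>
        have := hkE 0
        simp only [pow_zero, Module.End.one_apply] at this
        change ⁅f, ⁅e, x⁆⁆ = _
        rw [hfe, hfx, this]
        simp
      | succ n ih =>
        rw [pow_succ', Module.End.mul_apply]
        change ⁅f, ⁅e, (E ^ (n + 1)) x⁆⁆ = _
        rw [hfe, ih, hkE, lie_smul]
        change _ • E ((E ^ n) x) - _ = _
        rw [← Module.End.mul_apply, ← pow_succ', ← sub_smul]
        congr 1
        push_cast
        ring
    have hne : ∀ n : ℕ, (E ^ (n + 1)) x ≠ 0 := by
      intro n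
      induction n with
      | zero => exact hz
      | succ n ih =>
        intro h0
        have h1 := hfE (n + 1)
        rw [h0, lie_zero] at h1
        refine (smul_ne_zero ?_ ih) h1.symm
        have h2 : ((n : ℂ) + 1) ≠ 0 := Nat.cast_add_one_ne_zero n
        have h3 : ((n : ℂ) + 1 + 1) ≠ 0 := by exact_mod_cast Nat.succ_ne_zero (n + 1)
        push_cast
        exact neg_ne_zero.2 (mul_ne_zero ha (div_ne_zero (mul_ne_zero h2 h3) two_ne_zero))
    obtain ⟨N, hN⟩ := hb.isNilpotent_toEnd (fun h => hα (LinearMap.ext fun τ => congrFun h τ)) he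
    have : (E ^ (N + 1)) x = 0 := by
      rw [pow_succ', show E ^ N = 0 from hN, mul_zero, LinearMap.zero_apply]
    exact hne N this

end RootVectors

end LieSuper
end

/-! ### The dimension of the tangent space -/

noncomputable section

namespace LieSuper

section TangentRank

open LieModule LieSuperalgebra Module

section Diagonal

variable {V ι : Type*} [AddCommGroup V] [Module ℂ V] [Fintype ι] {b : Module.Basis ι ℂ V}
  {D : Module.End ℂ V} {c : ι → ℂ}

theorem coord_apply_of_diagonal (hD : ∀ i, D (b i) = c i • b i) (i : ι) (v : V) :
    b.coord i (D v) = c i * b.coord i v := by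
  classical
  conv_lhs => rw [← b.sum_repr v, map_sum, map_sum]
  rw [Finset.sum_eq_single i]
  · simp [hD, mul_comm]
  · intro j _ hj
    simp [hD, hj]
  · simp

theorem disjoint_range_ker_of_diagonal (hD : ∀ i, D (b i) = c i • b i) :
    Disjoint (LinearMap.range D) (LinearMap.ker D) := by
  rw [Submodule.disjoint_def]
  rintro _ ⟨w, rfl⟩ hw
  refine b.ext_elem fun i => ?_
  have h : b.coord i (D (D w)) = 0 := by rw [LinearMap.mem_ker.1 hw, map_zero]
  rw [coord_apply_of_diagonal hD, coord_apply_of_diagonal hD, ← mul_assoc, mul_eq_zero,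
    mul_self_eq_zero, ← mul_eq_zero, ← coord_apply_of_diagonal hD] at h
  rw [map_zero]; exact h

theorem finrank_range_of_diagonal (hD : ∀ i, D (b i) = c i • b i) :
    finrank ℂ (LinearMap.range D) = Nat.card {i // c i ≠ 0} := by
  classical
  have h : LinearMap.range D = Submodule.span ℂ (Set.range fun i : {i // c i ≠ 0} => b i) := by
    refine le_antisymm ?_ (Submodule.span_le.2 ?_)
    · rintro _ ⟨v, rfl⟩
      rw [← b.sum_repr v, map_sum]
      refine Submodule.sum_mem _ fun i _ => ?_
      rw [map_smul, hD]
      by_cases hi : c i = 0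
      · rw [hi, zero_smul, smul_zero]; exact zero_mem _
      · exact Submodule.smul_mem _ _ (Submodule.smul_mem _ _ (Submodule.subset_span ⟨⟨i, hi⟩, rfl⟩))
    · rintro _ ⟨i, rfl⟩
      exact ⟨(c i)⁻¹ • b i, by rw [map_smul, hD, smul_smul, inv_mul_cancel₀ i.2, one_smul]⟩
  have h2 := b.linearIndependent.comp (fun i : {i // c i ≠ 0} => (i : ι)) Subtype.val_injective
  rw [h, Nat.card_eq_fintype_card]
  exact finrank_span_eq_card h2

end Diagonal

theorem linearIndependent_of_weights {g₀ g₁ : Type*} [LieRing g₀] [LieAlgebra ℂ g₀]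
    [AddCommGroup g₁] [Module ℂ g₁] [LieRingModule g₀ g₁] [LieModule ℂ g₀ g₁]
    {t : LieSubalgebra ℂ g₀} {κ : Type*} [Fintype κ] {x : κ → g₁} {β : κ → Module.Dual ℂ t} (hβ : LinearIndependent ℂ β)
    (hx : ∀ i (τ : t), ⁅(τ : g₀), x i⁆ = β i τ • x i) (hx0 : ∀ i, x i ≠ 0) :
    LinearIndependent ℂ x := by
  classical
  rw [Fintype.linearIndependent_iff]
  intro a ha i
  obtain ⟨τ, hτ⟩ := exists_forall_apply_eq hβ (Pi.single i 1)
  have h : ⁅(τ : g₀), ∑ j, a j • x j⁆ = a i • x i := by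
    rw [lie_sum, Finset.sum_eq_single i]
    · rw [lie_smul, hx, hτ, Pi.single_eq_same, one_smul]
    · intro j _ hj
      rw [lie_smul, hx, hτ, Pi.single_eq_of_ne hj, zero_smul, smul_zero]
    · simp
  rw [ha, lie_zero] at h
  exact (smul_eq_zero.1 h.symm).resolve_right (hx0 i)

variable {g₀ g₁ : Type*} [LieRing g₀] [LieAlgebra ℂ g₀] [AddCommGroup g₁]
    [Module ℂ g₁] [LieRingModule g₀ g₁] [LieModule ℂ g₀ g₁] [LieSuperalgebra g₀ g₁]
    [Module.Finite ℂ g₀]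
    {t : LieSubalgebra ℂ g₀} [t.IsCartanSubalgebra]
    {ι : Type*} [Fintype ι] {b : Module.Basis ι ℂ g₁} {wt : ι → Module.Dual ℂ t}
    {B₀ : LinearMap.BilinForm ℂ g₀} {B₁ : LinearMap.BilinForm ℂ g₁}
    {κ : Type*} {x : κ → g₁} {β : κ → Module.Dual ℂ t}

/-- The coroots of an iso-set: their brackets with the roots of the iso-set vanish. -/
theorem IsWeightBasis.exists_coroots (hb : IsWeightBasis b wt) (hB : IsInvariantForm B₀ B₁)
    (hx : ∀ i (τ : t), ⁅(τ : g₀), x i⁆ = β i τ • x i) (hx0 : ∀ i, x i ≠ 0)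
    (hxx : ∀ i j, (oddBracket (x i) (x j) : g₀) = 0)
    (hxy : ∀ i j, i ≠ j → ∀ w : g₁, (∀ τ : t, ⁅(τ : g₀), w⁆ = (-β j τ) • w) →
      (oddBracket (x i) w : g₀) = 0) :
    ∃ (h : κ → t) (y : κ → g₁), (∀ i (τ : t), B₀ (h i) τ = β i τ) ∧ (∀ i j, β j (h i) = 0) ∧
      (∀ i, (h i : g₀) = oddBracket (x i) (y i)) ∧
      ∀ i j, i ≠ j → (oddBracket (x i) (y j) : g₀) = 0 := by
  choose y hy hxy1 using fun i => hb.exists_dual_weight hB (hx0 i) (hx i)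
  have hmem : ∀ i, (oddBracket (x i) (y i) : g₀) ∈ t := fun i =>
    mem_cartan_of_lie_eq_zero fun τ => by
      rw [lie_oddBracket_of_weight (hx i τ) (hy i τ), add_neg_cancel, zero_smul]
  refine ⟨fun i => ⟨_, hmem i⟩, y, fun i τ => hB.oddBracket_apply (hx i) (hxy1 i) τ, fun i j => ?_,
    fun i => rfl, fun i j hij => hxy i j hij _ (hy j)⟩
  -- For `i = j` this follows from `[x i, x i] = 0`. Otherwise, in the Jacobi identity for `x i`, `y
  -- i`, `x j`, the other two brackets vanish.
  have h1 : ⁅(oddBracket (x i) (y i) : g₀), x j⁆ = 0 := by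
    by_cases hij : i = j
    · subst hij
      exact oddBracket_lie_self (hxx i i) _
    · have := oddBracket_jacobi (g₀ := g₀) (x i) (y i) (x j)
      rwa [oddBracket_symm (y i) (x j), hxy j i (Ne.symm hij) _ (hy i), hxx, zero_lie, zero_lie,
        add_zero, add_zero] at this
  have h2 := hx j ⟨_, hmem i⟩
  rw [h1] at h2
  exact (smul_eq_zero.1 h2.symm).resolve_right (hx0 j)

variable [Fintype κ] [Module.Finite ℂ g₁]

/-- An element of the span of `h` on which as few as possible of the given forms vanish. -/
theorem exists_generic_combination {M η : Type*} [AddCommGroup M] [Module ℂ M] [Finite η]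
    (h : κ → M) (f : η → Module.Dual ℂ M) :
    ∃ c : κ → ℂ, ∀ i, f i (∑ j, c j • h j) = 0 → ∀ j, f i (h j) = 0 := by
  obtain ⟨m, hm, hf⟩ := Module.Dual.exists_forall_mem_ne_zero_of_forall_exists
    (Submodule.span ℂ (Set.range h))
    (fun i : {i // ¬ ∀ j, f i (h j) = 0} => f i) (fun i => by
      obtain ⟨j, hj⟩ := not_forall.1 i.2
      exact ⟨h j, Submodule.subset_span ⟨j, rfl⟩, hj⟩)
  obtain ⟨c, rfl⟩ := (Submodule.mem_span_range_iff_exists_fun ℂ).1 hm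
  exact ⟨c, fun i hi => by_contra fun hne => hf ⟨i, hne⟩ hi⟩

/-- Decompose `g₀` under `t`. The Cartan part only rescales the `x i`. As `H` kills the sum, a root
vector with `α H ≠ 0` produces an eigenvector of `H` with nonzero eigenvalue; one with `α H = 0`
kills every `x i` by isotropy. -/
theorem IsWeightBasis.tangent_le (hb : IsWeightBasis b wt) (hB : IsInvariantForm B₀ B₁)
    (hker : (∀ y : g₁, y = 0) ∨ ∀ u v : g₀, (∀ y : g₁, ⁅⁅u, v⁆, y⁆ = 0) → ⁅u, v⁆ = 0)
    (hx : ∀ i (τ : t), ⁅(τ : g₀), x i⁆ = β i τ • x i)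
    (hxx : ∀ i j, (oddBracket (x i) (x j) : g₀) = 0)
    {h : κ → t} (hh : ∀ i (τ : t), B₀ (h i) τ = β i τ) {H : t} (hβH : ∀ i, β i H = 0)
    (hH : ∀ α : Weight ℂ t g₀, α H = 0 → ∀ i, α (h i) = 0) :
    tangent g₀ (∑ i, x i) ≤
      Submodule.span ℂ (Set.range x) ⊔ LinearMap.range (toEnd ℂ g₀ g₁ (H : g₀)) := by
  rintro _ ⟨u, rfl⟩
  rw [← Submodule.mem_comap]
  revert u
  rw [← Submodule.eq_top_iff']
  have h1 := LieAlgebra.cartan_sup_iSup_rootSpace_eq_top (K := ℂ) t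
  rw [← LieSubmodule.toSubmodule_inj, LieSubmodule.sup_toSubmodule,
    LieSubmodule.iSup_toSubmodule] at h1
  rw [eq_top_iff, ← LieSubmodule.top_toSubmodule (R := ℂ) (L := t) (M := g₀), ← h1]
  refine sup_le (fun u hu => ?_) (iSup_le fun α => ?_)
  · refine Submodule.mem_sup_left ?_
    change ⁅u, ∑ i, x i⁆ ∈ Submodule.span ℂ (Set.range x)
    rw [lie_sum]
    refine Submodule.sum_mem _ fun i _ => ?_
    have := hx i ⟨u, hu⟩
    rw [show ⁅u, x i⁆ = _ from this]
    exact Submodule.smul_mem _ _ (Submodule.subset_span ⟨i, rfl⟩)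
  · rw [LieSubmodule.iSup_toSubmodule]
    refine iSup_le fun hα e he => ?_
    change ⁅e, ∑ i, x i⁆ ∈ Submodule.span ℂ (Set.range x) ⊔
      LinearMap.range (toEnd ℂ g₀ g₁ (H : g₀))
    by_cases hαH : α H = 0
    · have h2 : ⁅e, ∑ i, x i⁆ = 0 := by
        rw [lie_sum]
        refine Finset.sum_eq_zero fun i _ => ?_
        refine hb.lie_eq_zero_of_isotropic hB hker (α := α.toLinear) ?_ he (hx i) (hxx i i) (hh i)
          (hH α hαH i)
        intro h0
        exact hα (funext fun τ => LinearMap.congr_fun h0 τ)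
      rw [h2]; exact zero_mem _
    · refine Submodule.mem_sup_right ⟨(α H)⁻¹ • ⁅e, ∑ i, x i⁆, ?_⟩
      have h2 := hb.lie_lie_of_mem_rootSpace he H (∑ i, x i)
      have h3 : ⁅(H : g₀), ∑ i, x i⁆ = 0 := by
        rw [lie_sum]
        exact Finset.sum_eq_zero fun i _ => by rw [hx, hβH, zero_smul]
      rw [h3, lie_zero, zero_add] at h2
      rw [map_smul]
      change (α H)⁻¹ • ⁅(H : g₀), _⁆ = _
      rw [h2, smul_smul, inv_mul_cancel₀ hαH, one_smul]

/-- Here the homotopy formula is applied with `d` the bracket with `X`, `s` the bracket with `Y` and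
`D` the action of `H = [X, Y]`; the hypotheses on the differential and the homotopy are Jacobi
identities. -/
theorem IsWeightBasis.two_mul_finrank_tangent (hb : IsWeightBasis b wt)
    (hB : IsInvariantForm B₀ B₁)
    (hker : (∀ y : g₁, y = 0) ∨ ∀ u v : g₀, (∀ y : g₁, ⁅⁅u, v⁆, y⁆ = 0) → ⁅u, v⁆ = 0)
    (hβ : LinearIndependent ℂ β)
    (hx : ∀ i (τ : t), ⁅(τ : g₀), x i⁆ = β i τ • x i) (hx0 : ∀ i, x i ≠ 0)
    (hxx : ∀ i j, (oddBracket (x i) (x j) : g₀) = 0)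
    (hxy : ∀ i j, i ≠ j → ∀ w : g₁, (∀ τ : t, ⁅(τ : g₀), w⁆ = (-β j τ) • w) →
      (oddBracket (x i) w : g₀) = 0) :
    ∃ h : κ → t, (∀ i (τ : t), B₀ (h i) τ = β i τ) ∧
      2 * finrank ℂ (tangent g₀ (∑ i, x i)) =
        Nat.card {i // ∃ j, wt i (h j) ≠ 0} + 2 * Fintype.card κ := by
  classical
  obtain ⟨h, y, hh, hβh, hhxy, hxy0⟩ := hb.exists_coroots hB hx hx0 hxx hxy
  refine ⟨h, hh, ?_⟩
  -- `H` must be generic both for the odd weights, which are counted, and for the even roots, which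
  -- control the tangent space on the kernel.
  obtain ⟨c, hc⟩ := exists_generic_combination h
    (Sum.elim wt fun α : Weight ℂ t g₀ => α.toLinear)
  obtain ⟨H, hHdef⟩ : ∃ H : t, H = ∑ j, c j • h j := ⟨_, rfl⟩
  rw [← hHdef] at hc
  have hβH : ∀ i, β i H = 0 := by
    intro i
    rw [hHdef, map_sum]
    exact Finset.sum_eq_zero fun j _ => by rw [map_smul, hβh, smul_zero]
  obtain ⟨X, hX⟩ : ∃ X : g₁, X = ∑ i, x i := ⟨_, rfl⟩
  obtain ⟨Y, hY⟩ : ∃ Y : g₁, Y = ∑ i, c i • y i := ⟨_, rfl⟩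
  have hXX : (oddBracket X X : g₀) = 0 := by
    rw [hX, LinearMap.map_sum₂]
    refine Finset.sum_eq_zero fun i _ => ?_
    rw [map_sum]
    exact Finset.sum_eq_zero fun j _ => hxx i j
  have hXY : (oddBracket X Y : g₀) = H := by
    have h1 : (H : g₀) = ∑ j, c j • (h j : g₀) := by
      rw [hHdef]
      exact map_sum t.toSubmodule.subtype (fun k => c k • h k) Finset.univ
    rw [hX, hY, h1, LinearMap.map_sum₂]
    refine Finset.sum_congr rfl fun i _ => ?_
    rw [map_sum, Finset.sum_eq_single i]
    · rw [map_smul, hhxy]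
    · intro j _ hj
      rw [map_smul, hxy0 i j (Ne.symm hj), smul_zero]
    · simp
  have hHX : ⁅(H : g₀), X⁆ = 0 := by
    rw [hX, lie_sum]
    exact Finset.sum_eq_zero fun i _ => by rw [hx, hβH, zero_smul]
  have hdiag : ∀ i, toEnd ℂ g₀ g₁ (H : g₀) (b i) = wt i H • b i := fun i => hb H i
  have hdisj := disjoint_range_ker_of_diagonal hdiag
  have hmain := two_mul_finrank_range_of_homotopy hB.nondegenerate_even hB.nondegenerate_odd
    (d₀ := (toEnd ℂ g₀ g₁ : g₀ →ₗ[ℂ] Module.End ℂ g₁).flip X)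
    (s₀ := (toEnd ℂ g₀ g₁ : g₀ →ₗ[ℂ] Module.End ℂ g₁).flip Y)
    (d₁ := oddBracket X) (s₁ := oddBracket Y) (D₀ := toEnd ℂ g₀ g₀ (H : g₀))
    (D := toEnd ℂ g₀ g₁ (H : g₀))
    (fun u => by
      have h1 := lie_oddBracket u X X
      rw [hXX, lie_zero, oddBracket_symm ⁅u, X⁆ X, ← two_smul ℂ] at h1
      exact (smul_eq_zero.1 h1.symm).resolve_left two_ne_zero)
    (fun u => by
      change ⁅(H : g₀), ⁅u, X⁆⁆ = ⁅⁅(H : g₀), u⁆, X⁆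
      rw [leibniz_lie, hHX, lie_zero, add_zero])
    (fun z => by
      change ⁅(H : g₀), (oddBracket X z : g₀)⁆ = oddBracket X ⁅(H : g₀), z⁆
      rw [lie_oddBracket, hHX, map_zero, LinearMap.zero_apply, zero_add])
    (fun z => by
      have h1 := oddBracket_jacobi (g₀ := g₀) X Y z
      rw [hXY, oddBracket_symm z X, add_assoc] at h1
      change ⁅(H : g₀), z⁆ = -⁅(oddBracket Y z : g₀), X⁆ - ⁅(oddBracket X z : g₀), Y⁆
      rw [eq_neg_of_add_eq_zero_left h1]
      abel)
    (fun u z => hB.lie_odd u X z) (fun z w => hB.lie_skew H z w) hdisj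
  have htan : LinearMap.range ((toEnd ℂ g₀ g₁ : g₀ →ₗ[ℂ] Module.End ℂ g₁).flip X) =
      tangent g₀ (∑ i, x i) := by rw [hX]; rfl
  have hle := hb.tangent_le hB hker hx hxx hh hβH fun α hα i => hc (Sum.inr α) hα i
  have hspan : Submodule.span ℂ (Set.range x) ≤ LinearMap.ker (toEnd ℂ g₀ g₁ (H : g₀)) := by
    rw [Submodule.span_le]
    rintro _ ⟨i, rfl⟩
    rw [SetLike.mem_coe, LinearMap.mem_ker]
    exact (hx i H).trans (by rw [hβH, zero_smul])
  -- The kernel and the range of the diagonal `H` are independent, so only the span of the `x i`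
  -- survives; it is reached by the torus, as the weights are independent.
  have hinf : (tangent g₀ (∑ i, x i) ⊓ LinearMap.ker (toEnd ℂ g₀ g₁ (H : g₀)) : Submodule ℂ g₁) =
      Submodule.span ℂ (Set.range x) := by
    refine le_antisymm ?_ (le_inf (Submodule.span_le.2 ?_) hspan)
    · rintro z ⟨hz, hzk⟩
      obtain ⟨s, hs, r, hr, rfl⟩ := Submodule.mem_sup.1 (hle hz)
      have h1 : r ∈ LinearMap.ker (toEnd ℂ g₀ g₁ (H : g₀)) := by
        have := sub_mem hzk (hspan hs)
        rwa [add_sub_cancel_left] at this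
      rw [Submodule.disjoint_def.1 hdisj r hr h1, add_zero]
      exact hs
    · rintro _ ⟨i, rfl⟩
      obtain ⟨τ, hτ⟩ := exists_forall_apply_eq hβ (Pi.single i 1)
      refine mem_tangent.2 ⟨τ, ?_⟩
      rw [lie_sum, Finset.sum_eq_single i]
      · rw [hx, hτ, Pi.single_eq_same, one_smul]
      · intro j _ hj
        rw [hx, hτ, Pi.single_eq_of_ne hj, zero_smul]
      · simp
  rw [htan, hinf, finrank_span_eq_card (linearIndependent_of_weights hβ hx hx0),
    finrank_range_of_diagonal hdiag] at hmain
  rw [hmain]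
  congr 1
  refine Nat.card_congr (Equiv.subtypeEquivRight fun i => ?_)
  constructor
  · intro hi
    by_contra! h0
    refine hi ?_
    rw [hHdef, map_sum]
    exact Finset.sum_eq_zero fun j _ => by rw [map_smul, h0, smul_zero]
  · rintro ⟨j, hj⟩ h0
    exact hj (hc (Sum.inl i) h0 j)

end TangentRank

end LieSuper
end

/-! ### From iso-sets to the dimension formula -/

noncomputable section

namespace LieSuper

section Reduction

open LieModule LieSuperalgebra Module

variable {g₀ g₁ : Type*} [LieRing g₀] [LieAlgebra ℂ g₀] [AddCommGroup g₁]
    [Module ℂ g₁] [LieRingModule g₀ g₁] [LieModule ℂ g₀ g₁]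
    {t : LieSubalgebra ℂ g₀} [t.IsCartanSubalgebra]
    {A : Finset (Module.Dual ℂ t)} {x : Module.Dual ℂ t → g₁}

/-- Independence gives a point of `t` at which all members of `A` take the value `1`; their sums
take the value `2`. The case `β = γ` is included. -/
theorem IsIsoSet.add_ne_zero (hA : IsIsoSet t g₁ A) {β γ : Module.Dual ℂ t} (hβ : β ∈ A)
    (hγ : γ ∈ A) : β + γ ≠ 0 := by
  intro h
  obtain ⟨τ, hτ⟩ := exists_forall_apply_eq hA.linearIndep fun _ => 1
  have h1 := hτ ⟨β, hβ⟩
  have h2 := hτ ⟨γ, hγ⟩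
  have h3 := LinearMap.congr_fun h τ
  rw [LinearMap.add_apply, h1, h2, LinearMap.zero_apply] at h3
  norm_num at h3

variable [LieSuperalgebra g₀ g₁]

theorem IsIsoSet.oddBracket_eq_zero (hA : IsIsoSet t g₁ A) {β γ : Module.Dual ℂ t}
    (hβ : β ∈ A ∨ -β ∈ A) (hγ : γ ∈ A ∨ -γ ∈ A) (hβγ : β + γ ≠ 0) (hβ0 : β ≠ 0) (hγ0 : γ ≠ 0)
    {v w : g₁} (hv : ∀ τ : t, ⁅(τ : g₀), v⁆ = β τ • v) (hw : ∀ τ : t, ⁅(τ : g₀), w⁆ = γ τ • w) :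
    (oddBracket v w : g₀) = 0 := by
  have hroot : ∀ {χ : Module.Dual ℂ t} {v : g₁}, χ ≠ 0 → (∀ τ : t, ⁅(τ : g₀), v⁆ = χ τ • v) →
      v ≠ 0 → χ ∈ rootSet t g₁ := by
    intro χ v hχ hv hv0
    refine ⟨hχ, fun h => hv0 ?_⟩
    have := (mem_weightSpace (L := t) (χ : t → ℂ) v).2 hv
    rwa [h, LieSubmodule.mem_bot] at this
  by_cases hv0 : v = 0
  · rw [hv0, map_zero, LinearMap.zero_apply]
  by_cases hw0 : w = 0
  · rw [hw0, map_zero]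
  by_contra hne
  refine hA.add_notMem β (hroot hβ0 hv hv0) γ (hroot hγ0 hw hw0) hβ hγ ⟨hβγ, fun h => hne ?_⟩
  have := (mem_weightSpace (L := t) ((β + γ : Module.Dual ℂ t) : t → ℂ)
    (oddBracket v w : g₀)).2 fun τ => lie_oddBracket_of_weight (hv τ) (hw τ)
  rwa [h, LieSubmodule.mem_bot] at this

theorem IsIsoSet.oddBracket_sum_self (hA : IsIsoSet t g₁ A)
    (hx : ∀ β ∈ A, ∀ τ : t, ⁅(τ : g₀), x β⁆ = β τ • x β) :
    (oddBracket (∑ β ∈ A, x β) (∑ β ∈ A, x β) : g₀) = 0 := by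
  rw [LinearMap.map_sum₂]
  refine Finset.sum_eq_zero fun β hβ => ?_
  rw [map_sum]
  exact Finset.sum_eq_zero fun γ hγ => hA.oddBracket_eq_zero (Or.inl hβ) (Or.inl hγ)
    (hA.add_ne_zero hβ hγ) (hA.subset β hβ).1 (hA.subset γ hγ).1 (hx β hβ) (hx γ hγ)

variable [Module.Finite ℂ g₀] {ι : Type*} [Fintype ι] {b : Module.Basis ι ℂ g₁}
  {wt : ι → Module.Dual ℂ t} {B₀ : LinearMap.BilinForm ℂ g₀} {B₁ : LinearMap.BilinForm ℂ g₁}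

/-- Each odd weight is represented by an element of `t`, a bracket of two odd weight vectors. Thus
the choice of a representative of `β` in the definition of `perp` is irrelevant on odd roots. -/
theorem IsWeightBasis.apply_eq_zero_of_orthogonal (hb : IsWeightBasis b wt)
    (hB : IsInvariantForm B₀ B₁) {τ : t} (hτ : ∀ u : t, B₀ τ u = 0) (i : ι) : wt i τ = 0 := by
  have hi : ∀ τ : t, ⁅(τ : g₀), b i⁆ = wt i τ • b i := fun τ => hb τ i
  obtain ⟨w, hw, hbw⟩ := hb.exists_dual_weight hB (b.ne_zero i) hi
  have hk : (oddBracket (b i) w : g₀) ∈ t := mem_cartan_of_lie_eq_zero fun τ => by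
    rw [lie_oddBracket_of_weight (hi τ) (hw τ), add_neg_cancel, zero_smul]
  rw [← hB.oddBracket_apply hi hbw, hB.symm]
  exact hτ ⟨_, hk⟩

/-- Injectivity of `wt` makes every weight simple, so counting roots is counting basis vectors. -/
theorem IsWeightBasis.ncard_rootSet_diff_perp (hb : IsWeightBasis b wt)
    (hwt : Function.Injective wt) (hB : IsInvariantForm B₀ B₁) {κ : Type*} {β : κ → Module.Dual ℂ t}
    (hβ : ∀ γ, γ ∈ A ↔ ∃ j, β j = γ) {h : κ → t} (hh : ∀ i (τ : t), B₀ (h i) τ = β i τ) :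
    (rootSet t g₁ \ perp t B₀ A).ncard = Nat.card {i // ∃ j, wt i (h j) ≠ 0} := by
  have hset : rootSet t g₁ \ perp t B₀ A = wt '' {i | ∃ j, wt i (h j) ≠ 0} := by
    ext χ
    constructor
    · rintro ⟨⟨-, hχ⟩, hperp⟩
      obtain ⟨y, hy, hy0⟩ : ∃ y ∈ weightSpace g₁ (χ : t → ℂ), y ≠ 0 := by
        by_contra! h0
        exact hχ ((LieSubmodule.eq_bot_iff _).2 h0)
      rw [mem_weightSpace] at hy
      obtain ⟨i, hi⟩ : ∃ i, b.coord i y ≠ 0 := by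
        by_contra! h0
        exact hy0 (b.ext_elem fun i => by rw [map_zero]; exact h0 i)
      have hχi : wt i = χ := by
        refine LinearMap.ext fun τ => ?_
        have h1 := hb.coord_lie τ i y
        rw [show ⁅(τ : g₀), y⁆ = χ τ • y from hy τ, map_smul, smul_eq_mul] at h1
        exact (mul_right_cancel₀ hi h1).symm
      refine ⟨i, ?_, hχi⟩
      by_contra hno
      refine hperp fun γ hγ c hc => ?_
      obtain ⟨j, rfl⟩ := (hβ γ).1 hγ
      have h2 := hb.apply_eq_zero_of_orthogonal hB (τ := c - h j) (fun u => by
        change B₀ ((c : g₀) - (h j : g₀)) u = 0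
        rw [map_sub, LinearMap.sub_apply, hc, hh, sub_self]) i
      rw [map_sub, sub_eq_zero] at h2
      rw [← hχi, h2]
      by_contra h3
      exact hno ⟨j, h3⟩
    · rintro ⟨i, ⟨j, hj⟩, rfl⟩
      refine ⟨⟨?_, ?_⟩, fun hp => hj (hp (β j) ((hβ _).2 ⟨j, rfl⟩) (h j) (hh j))⟩
      · intro h0
        rw [h0, LinearMap.zero_apply] at hj
        exact hj rfl
      · intro h0
        have := (mem_weightSpace (L := t) (wt i : t → ℂ) (b i)).2 fun τ => hb τ i
        rw [h0, LieSubmodule.mem_bot] at this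
        exact b.ne_zero i this
  rw [hset, Set.ncard_image_of_injective _ hwt]
  rfl

theorem exists_algDim_orbit_eq [Module.Finite ℂ g₁]
    (hspec : ∃ u : g₀, powerDisc (toEnd ℂ g₀ g₁ u) ≠ 0)
    (hker : (∀ y : g₁, y = 0) ∨ ∀ u v : g₀, (∀ y : g₁, ⁅⁅u, v⁆, y⁆ = 0) → ⁅u, v⁆ = 0)
    (hB : IsInvariantForm B₀ B₁) (hA : IsIsoSet t g₁ A)
    (hx : ∀ β ∈ A, ∀ τ : t, ⁅(τ : g₀), x β⁆ = β τ • x β) (hx0 : ∀ β ∈ A, x β ≠ 0) :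
    ∃ d : ℕ, algDim (orbit g₀ (∑ β ∈ A, x β)) = (d : WithBot ℕ∞) ∧
      (d : ℚ) = ((rootSet t g₁ \ perp t B₀ A).ncard : ℚ) / 2 + (A.card : ℚ) := by
  obtain ⟨u, hu⟩ := hspec
  obtain ⟨u', hu'⟩ := exists_powerDisc_ne_zero_of_cartan t hu
  obtain ⟨b, wt, hwt, hb⟩ := exists_weightBasis t hu'
  have hb : IsWeightBasis b wt := hb
  let e : Fin A.card ≃ A := A.equivFin.symm
  have hsum : ∑ β ∈ A, x β = ∑ i, x (e i) := by
    rw [← Finset.sum_coe_sort, ← Equiv.sum_comp e]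
  have hli : LinearIndependent ℂ fun i => ((e i : A) : Module.Dual ℂ t) :=
    hA.linearIndep.comp e e.injective
  have hne : ∀ i, ((e i : A) : Module.Dual ℂ t) ≠ 0 := fun i => hli.ne_zero i
  have hxe : ∀ i (τ : t), ⁅(τ : g₀), x (e i)⁆ = ((e i : A) : Module.Dual ℂ t) τ • x (e i) :=
    fun i => hx _ (e i).2
  obtain ⟨h, hh, hrank⟩ := hb.two_mul_finrank_tangent hB hker hli hxe (fun i => hx0 _ (e i).2)
    (fun i j => hA.oddBracket_eq_zero (Or.inl (e i).2) (Or.inl (e j).2)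
      (hA.add_ne_zero (e i).2 (e j).2) (hne i) (hne j) (hxe i) (hxe j))
    (fun i j hij w hw => hA.oddBracket_eq_zero (γ := -((e j : A) : Module.Dual ℂ t))
      (Or.inl (e i).2) (Or.inr (by rw [neg_neg]; exact (e j).2))
      (fun h0 => hij (hli.injective (add_neg_eq_zero.1 h0))) (hne i) (neg_ne_zero.2 (hne j))
      (hxe i) hw)
  refine ⟨finrank ℂ (tangent g₀ (∑ β ∈ A, x β)), ?_, ?_⟩
  · rw [hsum]
    exact algDim_orbit_eq_finrank_tangent hli hxe hb.span_isNilWeightVector_union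
  · rw [hb.ncard_rootSet_diff_perp hwt hB (β := fun i => ((e i : A) : Module.Dual ℂ t))
      (fun γ => ⟨fun hγ => ⟨e.symm ⟨γ, hγ⟩, by rw [Equiv.apply_symm_apply]⟩, fun ⟨j, hj⟩ =>
        hj ▸ (e j).2⟩) hh, hsum]
    rw [Fintype.card_fin] at hrank
    have := congrArg (Nat.cast : ℕ → ℚ) hrank
    push_cast at this
    linarith

end Reduction

end LieSuper
end

/-! ### Matrix superalgebras: supertrace form and faithfulness -/

noncomputable section

namespace LieSuper

section MatrixSuperalgebras

open Matrix Module

variable {g₀ g₁ : Type*} [LieRing g₀] [LieAlgebra ℂ g₀] [AddCommGroup g₁]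
    [Module ℂ g₁] [LieRingModule g₀ g₁] [LieModule ℂ g₀ g₁]

/-- Simple spectrum, witnessed by eigenvectors in a space into which `g₁` is embedded. -/
theorem powerDisc_toEnd_ne_zero [Module.Finite ℂ g₁] {W κ : Type*} [AddCommGroup W] [Module ℂ W]
    [Fintype κ] {ρ : g₁ →ₗ[ℂ] W} (hρ : Function.Injective ρ) {u : g₀} {w : κ → W} {c : κ → ℂ}
    (hw : ∀ k, w k ∈ Set.range ρ) (hw0 : ∀ k, w k ≠ 0)
    (huw : ∀ k x, ρ x = w k → ρ ⁅u, x⁆ = c k • w k) (hc : Function.Injective c)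
    (hcard : Fintype.card κ = finrank ℂ g₁) : powerDisc (LieModule.toEnd ℂ g₀ g₁ u) ≠ 0 := by
  choose x hx using hw
  refine powerDisc_ne_zero (v := x) hcard hc (fun k => hρ ?_) fun k h0 => hw0 k ?_
  · rw [map_smul, hx]
    exact huw k _ (hx k)
  · rw [← hx, h0, map_zero]

theorem finrank_eq_of_range_eq {V W M : Type*} [AddCommGroup V] [Module ℂ V] [AddCommGroup W]
    [Module ℂ W] [AddCommGroup M] [Module ℂ M] {f : V →ₗ[ℂ] M} {g : W →ₗ[ℂ] M}
    (hf : Function.Injective f) (hg : Function.Injective g) (h : Set.range f = Set.range g) :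
    finrank ℂ V = finrank ℂ W := by
  have : LinearMap.range f = LinearMap.range g := SetLike.coe_injective h
  rw [← LinearMap.finrank_range_of_inj hf, this, LinearMap.finrank_range_of_inj hg]

theorem IsMatrixSuperalgebra.exists_powerDisc_ne_zero {ι₀ ι₁ : Type}
    [Fintype ι₀] [Fintype ι₁] [LieSuperalgebra g₀ g₁]
    {E O : Set (Matrix (ι₀ ⊕ ι₁) (ι₀ ⊕ ι₁) ℂ)} [Module.Finite ℂ g₁]
    (hg : IsMatrixSuperalgebra g₀ g₁ E O) {W κ : Type*} [AddCommGroup W] [Module ℂ W] [Fintype κ]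
    {ψ : W →ₗ[ℂ] Matrix (ι₀ ⊕ ι₁) (ι₀ ⊕ ι₁) ℂ} (hψ : Function.Injective ψ)
    (hψO : Set.range ψ = O) {U : Matrix (ι₀ ⊕ ι₁) (ι₀ ⊕ ι₁) ℂ} (hU : U ∈ E) {w : κ → W}
    {c : κ → ℂ} (hw0 : ∀ k, w k ≠ 0) (hUw : ∀ k, U * ψ (w k) - ψ (w k) * U = c k • ψ (w k))
    (hc : Function.Injective c) (hcard : Fintype.card κ = finrank ℂ W) :
    ∃ u : g₀, powerDisc (LieModule.toEnd ℂ g₀ g₁ u) ≠ 0 := by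
  obtain ⟨ρ₀, ρ₁, hρ₀, hρ₁, hrE, hrO, h00, h01, h11⟩ := hg
  rw [← hrE] at hU
  obtain ⟨u, rfl⟩ := hU
  refine ⟨u, powerDisc_toEnd_ne_zero hρ₁ (w := fun k => ψ (w k)) (fun k => ?_) (fun k h0 => ?_)
    (fun k x hx => ?_) hc ?_⟩
  · rw [hrO, ← hψO]; exact ⟨_, rfl⟩
  · exact hw0 k (hψ (by rw [h0, map_zero]))
  · rw [h01, hx, hUw]
  · rw [hcard, finrank_eq_of_range_eq hρ₁ hψ (hrO.trans hψO.symm)]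

theorem fromBlocks_sub_fromBlocks {ι₀ ι₁ : Type*} (A A' : Matrix ι₀ ι₀ ℂ) (B B' : Matrix ι₀ ι₁ ℂ)
    (C C' : Matrix ι₁ ι₀ ℂ) (D D' : Matrix ι₁ ι₁ ℂ) : fromBlocks A B C D - fromBlocks A' B' C' D' =
      fromBlocks (A - A') (B - B') (C - C') (D - D') := by
  simp only [sub_eq_add_neg, fromBlocks_neg, fromBlocks_add]

variable {ι₀ ι₁ : Type} [Fintype ι₀] [Fintype ι₁] [DecidableEq ι₀] [DecidableEq ι₁]

variable (ι₀ ι₁) in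
/-- The parity operator of a superspace. -/
def parity : Matrix (ι₀ ⊕ ι₁) (ι₀ ⊕ ι₁) ℂ := fromBlocks 1 0 0 (-1)

theorem parity_mul_parity : parity ι₀ ι₁ * parity ι₀ ι₁ = 1 := by
  simp [parity, fromBlocks_multiply]

theorem parity_mul_even (P : Matrix ι₀ ι₀ ℂ) (S : Matrix ι₁ ι₁ ℂ) :
    parity ι₀ ι₁ * fromBlocks P 0 0 S = fromBlocks P 0 0 S * parity ι₀ ι₁ := by
  simp [parity, fromBlocks_multiply]

theorem parity_mul_odd (Q : Matrix ι₀ ι₁ ℂ) (R : Matrix ι₁ ι₀ ℂ) :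
    parity ι₀ ι₁ * fromBlocks 0 Q R 0 = -(fromBlocks 0 Q R 0 * parity ι₀ ι₁) := by
  simp [parity, fromBlocks_multiply, fromBlocks_neg]

variable (ι₀ ι₁) in
/-- The supertrace form. -/
def strForm : LinearMap.BilinForm ℂ (Matrix (ι₀ ⊕ ι₁) (ι₀ ⊕ ι₁) ℂ) :=
  LinearMap.mk₂ ℂ (fun X Y => (parity ι₀ ι₁ * X * Y).trace)
    (fun X X' Y => by rw [mul_add, add_mul, trace_add])
    (fun c X Y => by rw [mul_smul_comm, smul_mul_assoc, trace_smul])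
    (fun X Y Y' => by rw [mul_add, trace_add])
    (fun c X Y => by rw [mul_smul_comm, trace_smul])

theorem strForm_apply (X Y : Matrix (ι₀ ⊕ ι₁) (ι₀ ⊕ ι₁) ℂ) :
    strForm ι₀ ι₁ X Y = (parity ι₀ ι₁ * X * Y).trace := rfl

-- The pairing with `Xᴴ * parity` is the positive definite `tr (X Xᴴ)`. Nondegeneracy therefore
-- follows for any space of matrices closed under `X ↦ Xᴴ * parity`.
open scoped ComplexOrder in
theorem eq_zero_of_strForm_eq_zero {X : Matrix (ι₀ ⊕ ι₁) (ι₀ ⊕ ι₁) ℂ}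
    (h : strForm ι₀ ι₁ X (Xᴴ * parity ι₀ ι₁) = 0) : X = 0 := by
  rw [strForm_apply, ← mul_assoc, trace_mul_comm, ← mul_assoc, ← mul_assoc, parity_mul_parity,
    one_mul] at h
  exact trace_mul_conjTranspose_self_eq_zero_iff.1 h

variable [LieSuperalgebra g₀ g₁] {E O : Set (Matrix (ι₀ ⊕ ι₁) (ι₀ ⊕ ι₁) ℂ)}

/-- The parity matrix commutes with even and anticommutes with odd matrices; with cyclicity of the
trace this yields symmetry, skewness and invariance of the supertrace form. -/
theorem IsMatrixSuperalgebra.exists_isInvariantForm (hg : IsMatrixSuperalgebra g₀ g₁ E O)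
    (hE : ∀ X ∈ E, ∃ (P : Matrix ι₀ ι₀ ℂ) (S : Matrix ι₁ ι₁ ℂ), X = fromBlocks P 0 0 S)
    (hO : ∀ X ∈ O, ∃ (Q : Matrix ι₀ ι₁ ℂ) (R : Matrix ι₁ ι₀ ℂ), X = fromBlocks 0 Q R 0)
    (hE' : ∀ X ∈ E, (∀ Y ∈ E, strForm ι₀ ι₁ X Y = 0) → X = 0)
    (hO' : ∀ X ∈ O, (∀ Y ∈ O, strForm ι₀ ι₁ X Y = 0) → X = 0) :
    ∃ (B₀ : LinearMap.BilinForm ℂ g₀) (B₁ : LinearMap.BilinForm ℂ g₁), IsInvariantForm B₀ B₁ := by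
  obtain ⟨ρ₀, ρ₁, hρ₀, hρ₁, hrE, hrO, h00, h01, h11⟩ := hg
  have hΓ₀ : ∀ u, parity ι₀ ι₁ * ρ₀ u = ρ₀ u * parity ι₀ ι₁ := by
    intro u
    obtain ⟨P, S, h⟩ := hE (ρ₀ u) (hrE ▸ ⟨u, rfl⟩)
    rw [h, parity_mul_even]
  have hΓ₁ : ∀ x, parity ι₀ ι₁ * ρ₁ x = -(ρ₁ x * parity ι₀ ι₁) := by
    intro x
    obtain ⟨P, S, h⟩ := hO (ρ₁ x) (hrO ▸ ⟨x, rfl⟩)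
    rw [h, parity_mul_odd]
  have hcyc₀ : ∀ u Z, (parity ι₀ ι₁ * ρ₀ u * Z).trace = (parity ι₀ ι₁ * Z * ρ₀ u).trace := by
    intro u Z
    rw [hΓ₀, mul_assoc, trace_mul_comm]
  have hcyc₁ : ∀ x Z, (parity ι₀ ι₁ * ρ₁ x * Z).trace = -(parity ι₀ ι₁ * Z * ρ₁ x).trace := by
    intro u Z
    rw [hΓ₁, neg_mul, trace_neg, mul_assoc, trace_mul_comm]
  let B₀ : LinearMap.BilinForm ℂ g₀ := (strForm ι₀ ι₁).compl₁₂ ρ₀ ρ₀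
  let B₁ : LinearMap.BilinForm ℂ g₁ := (strForm ι₀ ι₁).compl₁₂ ρ₁ ρ₁
  have hB₀ : ∀ u v, B₀ u v = (parity ι₀ ι₁ * ρ₀ u * ρ₀ v).trace := fun u v => rfl
  have hB₁ : ∀ u v, B₁ u v = (parity ι₀ ι₁ * ρ₁ u * ρ₁ v).trace := fun u v => rfl
  have hsymm : ∀ u v, B₀ u v = B₀ v u := fun u v => by rw [hB₀, hB₀, hcyc₀]
  have hskew : ∀ u v, B₁ u v = -B₁ v u := fun u v => by rw [hB₁, hB₁, hcyc₁]
  have hsep₀ : B₀.SeparatingLeft := by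
    intro u hu
    refine hρ₀ ?_
    rw [map_zero]
    refine hE' _ (hrE ▸ ⟨u, rfl⟩) fun Y hY => ?_
    rw [← hrE] at hY
    obtain ⟨v, rfl⟩ := hY
    exact hu v
  have hsep₁ : B₁.SeparatingLeft := by
    intro u hu
    refine hρ₁ ?_
    rw [map_zero]
    refine hO' _ (hrO ▸ ⟨u, rfl⟩) fun Y hY => ?_
    rw [← hrO] at hY
    obtain ⟨v, rfl⟩ := hY
    exact hu v
  refine ⟨B₀, B₁, hsymm, hskew, fun u v w => ?_, fun u x y => ?_,
    ⟨hsep₀, fun u hu => hsep₀ u fun v => (hsymm u v).trans (hu v)⟩,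
    ⟨hsep₁, fun u hu => hsep₁ u fun v => (hskew u v).trans (by rw [hu v, neg_zero])⟩⟩
  · have h1 := hcyc₀ v (ρ₀ u * ρ₀ w)
    simp only [hB₀, h00, mul_sub, sub_mul, trace_sub, ← mul_assoc] at h1 ⊢
    rw [h1]
  · have h1 := hcyc₁ x (ρ₀ u * ρ₁ y)
    simp only [hB₀, hB₁, h01, h11, mul_sub, sub_mul, mul_add, trace_add, trace_sub,
      ← mul_assoc] at h1 ⊢
    rw [h1, sub_neg_eq_add]

/-- If the blocks satisfy `P Q = Q S` for all `Q`, both are the same scalar. For a commutator `P`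
has trace zero, so the scalar is zero; central scalars of `gl` are the reason for restricting to
commutators. If a block is empty, `g₁ = 0`. -/
theorem IsMatrixSuperalgebra.lie_eq_zero_of_acts_trivially (hg : IsMatrixSuperalgebra g₀ g₁ E O)
    (hE : ∀ X ∈ E, ∃ (P : Matrix ι₀ ι₀ ℂ) (S : Matrix ι₁ ι₁ ℂ), X = fromBlocks P 0 0 S)
    (hO : ∀ X ∈ O, ∃ (Q : Matrix ι₀ ι₁ ℂ) (R : Matrix ι₁ ι₀ ℂ), X = fromBlocks 0 Q R 0)
    (hO2 : ∀ Q : Matrix ι₀ ι₁ ℂ, ∃ R : Matrix ι₁ ι₀ ℂ, fromBlocks 0 Q R 0 ∈ O) :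
    (∀ y : g₁, y = 0) ∨ ∀ u v : g₀, (∀ y : g₁, ⁅⁅u, v⁆, y⁆ = 0) → ⁅u, v⁆ = 0 := by
  obtain ⟨ρ₀, ρ₁, hρ₀, hρ₁, hrE, hrO, h00, h01, h11⟩ := hg
  by_cases hne : Nonempty ι₀ ∧ Nonempty ι₁
  · right
    obtain ⟨⟨a⟩, ⟨c⟩⟩ := hne
    intro u v huv
    refine hρ₀ ?_
    rw [map_zero, h00]
    obtain ⟨P₁, S₁, h1⟩ := hE (ρ₀ u) (hrE ▸ ⟨u, rfl⟩)
    obtain ⟨P₂, S₂, h2⟩ := hE (ρ₀ v) (hrE ▸ ⟨v, rfl⟩)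
    obtain ⟨P, hP⟩ : ∃ P, P = P₁ * P₂ - P₂ * P₁ := ⟨_, rfl⟩
    obtain ⟨S, hS⟩ : ∃ S, S = S₁ * S₂ - S₂ * S₁ := ⟨_, rfl⟩
    have h3 : ρ₀ u * ρ₀ v - ρ₀ v * ρ₀ u = fromBlocks P 0 0 S := by
      rw [h1, h2, hP, hS]
      simp [fromBlocks_multiply, fromBlocks_sub_fromBlocks]
    have hPS : ∀ Q : Matrix ι₀ ι₁ ℂ, P * Q = Q * S := by
      intro Q
      obtain ⟨R, hR⟩ := hO2 Q
      rw [← hrO] at hR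
      obtain ⟨y, hy⟩ := hR
      have h4 := congrArg ρ₁ (huv y)
      rw [h01, h00, h3, hy, map_zero, fromBlocks_multiply, fromBlocks_multiply, fromBlocks_sub_fromBlocks,
        ← fromBlocks_zero, fromBlocks_inj] at h4
      simpa [sub_eq_zero] using h4.2.1
    have hPij : ∀ i j, P i j = if i = j then S c c else 0 := by
      intro i j
      have := congrFun (congrFun (hPS (Matrix.single j c 1)) i) c
      rw [Matrix.mul_single_apply_same] at this
      split_ifs with hij
      · subst hij
        rw [Matrix.single_mul_apply_same] at this
        simpa using this
      · rw [Matrix.single_mul_apply_of_ne _ _ _ _ _ hij] at this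
        simpa using this
    have htr : P.trace = 0 := by rw [hP, trace_sub, trace_mul_comm, sub_self]
    have hSc : S c c = 0 := by
      rw [Matrix.trace, Finset.sum_congr rfl (fun i _ => by rw [diag_apply, hPij, if_pos rfl]),
        Finset.sum_const, nsmul_eq_mul] at htr
      refine (mul_eq_zero.1 htr).resolve_left ?_
      exact Nat.cast_ne_zero.2 <| Finset.card_ne_zero.2 ⟨a, Finset.mem_univ a⟩
    have hP0 : P = 0 := by
      ext i j
      rw [hPij, hSc, ite_self, Matrix.zero_apply]
    have hS0 : S = 0 := by
      ext i j
      have := congrFun (congrFun (hPS (Matrix.single a i 1)) a) j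
      rw [Matrix.single_mul_apply_same, hP0, Matrix.zero_mul] at this
      simpa using this.symm
    rw [h3, hP0, hS0, fromBlocks_zero]
  · left
    intro y
    refine hρ₁ ?_
    obtain ⟨Q, R, h⟩ := hO (ρ₁ y) (hrO ▸ ⟨y, rfl⟩)
    have hQ : Q = 0 := by
      ext i j
      exact absurd ⟨⟨i⟩, ⟨j⟩⟩ hne
    have hR : R = 0 := by
      ext i j
      exact absurd ⟨⟨j⟩, ⟨i⟩⟩ hne
    rw [h, hQ, hR, fromBlocks_zero, map_zero]

end MatrixSuperalgebras

end LieSuper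
end

/-! ### The series `gl(m|n)` and `sl(m|n)` -/

noncomputable section

namespace LieSuper

/-- The properties of a Lie superalgebra on which the dimension formula for orbits depends: an
invariant form, an even element with simple odd spectrum, and faithfulness on commutators of the
action of `g₀` on `g₁`, unless `g₁ = 0`. -/
structure IsQuadraticWithSimpleSpectrum (g₀ g₁ : Type*) [LieRing g₀] [LieAlgebra ℂ g₀]
    [AddCommGroup g₁] [Module ℂ g₁] [LieRingModule g₀ g₁] [LieModule ℂ g₀ g₁]
    [LieSuperalgebra g₀ g₁] : Prop where
  exists_form : ∃ (B₀ : LinearMap.BilinForm ℂ g₀) (B₁ : LinearMap.BilinForm ℂ g₁),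
    IsInvariantForm B₀ B₁
  exists_simple : ∃ u : g₀, powerDisc (LieModule.toEnd ℂ g₀ g₁ u) ≠ 0
  lie_eq_zero : (∀ y : g₁, y = 0) ∨ ∀ u v : g₀, (∀ y : g₁, ⁅⁅u, v⁆, y⁆ = 0) → ⁅u, v⁆ = 0

section MatrixFamilies

open Matrix Module

variable {g₀ g₁ : Type*} [LieRing g₀] [LieAlgebra ℂ g₀] [AddCommGroup g₁]
    [Module ℂ g₁] [LieRingModule g₀ g₁] [LieModule ℂ g₀ g₁] [LieSuperalgebra g₀ g₁]

theorem conjTranspose_even_mul_parity {ι₀ ι₁ : Type} [Fintype ι₀] [Fintype ι₁] [DecidableEq ι₀]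
    [DecidableEq ι₁] (P : Matrix ι₀ ι₀ ℂ) (S : Matrix ι₁ ι₁ ℂ) :
    (fromBlocks P 0 0 S)ᴴ * parity ι₀ ι₁ = fromBlocks Pᴴ 0 0 (-Sᴴ) := by
  simp [parity, fromBlocks_conjTranspose, fromBlocks_multiply]

theorem conjTranspose_odd_mul_parity {ι₀ ι₁ : Type} [Fintype ι₀] [Fintype ι₁] [DecidableEq ι₀]
    [DecidableEq ι₁] (Q : Matrix ι₀ ι₁ ℂ) (R : Matrix ι₁ ι₀ ℂ) :
    (fromBlocks 0 Q R 0)ᴴ * parity ι₀ ι₁ = fromBlocks 0 (-Rᴴ) Qᴴ 0 := by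
  simp [parity, fromBlocks_conjTranspose, fromBlocks_multiply]

theorem strForm_one {ι₀ ι₁ : Type} [Fintype ι₀] [Fintype ι₁] [DecidableEq ι₀]
    [DecidableEq ι₁] (P : Matrix ι₀ ι₀ ℂ) (S : Matrix ι₁ ι₁ ℂ) :
    strForm ι₀ ι₁ (fromBlocks P 0 0 S) 1 = P.trace - S.trace := by
  simp [strForm_apply, parity, fromBlocks_multiply, Matrix.trace, Fintype.sum_sum_type, sub_eq_add_neg]

theorem eq_zero_of_strForm_glOdd {m n : ℕ} : ∀ X ∈ glOdd m n,
    (∀ Y ∈ glOdd m n, strForm (Fin m) (Fin n) X Y = 0) → X = 0 := by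
  rintro _ ⟨Q, R, rfl⟩ h
  refine eq_zero_of_strForm_eq_zero (h _ ?_)
  rw [conjTranspose_odd_mul_parity]
  exact ⟨_, _, rfl⟩

theorem eq_and_eq_of_sub_mul_eq {m i i' j j' : ℕ} (hi : i < m) (hi' : i' < m)
    (h : (i : ℤ) - m * (j + 1) = i' - m * (j' + 1)) : i = i' ∧ j = j' := by
  have h1 : i + m * j' = i' + m * j := by
    zify; linarith
  have h2 : i = i' := by
    have := congrArg (· % m) h1
    simpa [Nat.add_mul_mod_self_left, Nat.mod_eq_of_lt hi, Nat.mod_eq_of_lt hi'] using this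
  subst h2
  exact ⟨rfl, (Nat.eq_of_mul_eq_mul_left (by omega) (Nat.add_left_cancel h1)).symm⟩

/-- The parametrization of the odd part of `gl(m|n)`. -/
def glOddMap (m n : ℕ) : (Matrix (Fin m) (Fin n) ℂ × Matrix (Fin n) (Fin m) ℂ) →ₗ[ℂ]
    Matrix (Fin m ⊕ Fin n) (Fin m ⊕ Fin n) ℂ where
  toFun X := fromBlocks 0 X.1 X.2 0
  map_add' X Y := by simp [fromBlocks_add]
  map_smul' c X := by simp [fromBlocks_smul]

/-- The eigenvalues on the upper block are `i - m (j + 1)`: they are negative, and distinct by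
uniqueness of division by `m`. Those on the lower block are their negatives. The shift `a` does not
act, and is free for adjusting the supertrace. -/
theorem exists_powerDisc_ne_zero_of_glOdd [Module.Finite ℂ g₁] {m n : ℕ}
    {E : Set (Matrix (Fin m ⊕ Fin n) (Fin m ⊕ Fin n) ℂ)}
    (hg : IsMatrixSuperalgebra g₀ g₁ E (glOdd m n)) {a : ℂ}
    (hE : fromBlocks (diagonal fun i : Fin m => (i : ℂ) + a) 0 0
      (diagonal fun j : Fin n => (m : ℂ) * (j + 1) + a) ∈ E) :
    ∃ u : g₀, powerDisc (LieModule.toEnd ℂ g₀ g₁ u) ≠ 0 := by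
  let w : (Fin m × Fin n) ⊕ (Fin m × Fin n) →
      Matrix (Fin m) (Fin n) ℂ × Matrix (Fin n) (Fin m) ℂ :=
    Sum.elim (fun k => (single k.1 k.2 1, 0)) fun k => (0, single k.2 k.1 1)
  let c : (Fin m × Fin n) ⊕ (Fin m × Fin n) → ℤ :=
    Sum.elim (fun k => (k.1 : ℕ) - m * ((k.2 : ℕ) + 1)) fun k => -((k.1 : ℕ) - m * ((k.2 : ℕ) + 1))
  have hneg : ∀ k : Fin m × Fin n, ((k.1 : ℕ) : ℤ) - m * ((k.2 : ℕ) + 1) < 0 := by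
    intro k
    have h1 : ((k.1 : ℕ) : ℤ) < m := by exact_mod_cast k.1.2
    have h2 : (0 : ℤ) ≤ m * (k.2 : ℕ) := by positivity
    linarith
  have hinj : ∀ k l : Fin m × Fin n, ((k.1 : ℕ) : ℤ) - m * ((k.2 : ℕ) + 1) =
      (l.1 : ℕ) - m * ((l.2 : ℕ) + 1) → k = l := by
    intro k l h
    obtain ⟨h1, h2⟩ := eq_and_eq_of_sub_mul_eq k.1.2 l.1.2 h
    exact Prod.ext (Fin.ext h1) (Fin.ext h2)
  refine hg.exists_powerDisc_ne_zero (ψ := glOddMap m n) (w := w) (c := fun k => (c k : ℂ)) ?_ ?_ hE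
    ?_ ?_ ?_ ?_
  · intro X Y h
    have h' : fromBlocks 0 X.1 X.2 0 = fromBlocks 0 Y.1 Y.2 0 := h
    rw [fromBlocks_inj] at h'
    exact Prod.ext h'.2.1 h'.2.2.1
  · ext X
    constructor
    · rintro ⟨Y, rfl⟩
      exact ⟨Y.1, Y.2, rfl⟩
    · rintro ⟨Q, R, rfl⟩
      exact ⟨(Q, R), rfl⟩
  · rintro (k | k) h
    · have := congrFun (congrFun (congrArg Prod.fst h) k.1) k.2
      simp [w] at this
    · have := congrFun (congrFun (congrArg Prod.snd h) k.2) k.1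
      simp [w] at this
  · rintro (⟨i, j⟩ | ⟨i, j⟩)
    · simp only [w, c, Sum.elim_inl, glOddMap, LinearMap.coe_mk, AddHom.coe_mk, fromBlocks_multiply,
        fromBlocks_sub_fromBlocks, fromBlocks_smul]
      congr 1
      · simp
      · ext a' b'
        by_cases h : i = a' ∧ j = b'
        · obtain ⟨rfl, rfl⟩ := h
          simp
        · simp [single_apply_of_ne _ _ _ _ _ h]
      · simp
      · simp
    · simp only [w, c, Sum.elim_inr, glOddMap, LinearMap.coe_mk, AddHom.coe_mk, fromBlocks_multiply,
        fromBlocks_sub_fromBlocks, fromBlocks_smul]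
      congr 1
      · simp
      · simp
      · ext a' b'
        by_cases h : j = a' ∧ i = b'
        · obtain ⟨rfl, rfl⟩ := h
          simp
        · simp [single_apply_of_ne _ _ _ _ _ h]
      · simp
  · refine Int.cast_injective.comp ?_
    rintro (k | k) (l | l) h
    · exact congrArg _ (hinj k l h)
    · have h' : ((k.1 : ℕ) : ℤ) - m * ((k.2 : ℕ) + 1) = -((l.1 : ℕ) - m * ((l.2 : ℕ) + 1)) := h
      have := hneg k
      have := hneg l
      omega
    · have h' : -(((k.1 : ℕ) : ℤ) - m * ((k.2 : ℕ) + 1)) = (l.1 : ℕ) - m * ((l.2 : ℕ) + 1) := h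
      have := hneg k
      have := hneg l
      omega
    · exact congrArg _ (hinj k l (neg_injective h))
  · simp [Module.finrank_prod, Module.finrank_matrix, mul_comm]

theorem isQuadraticWithSimpleSpectrum_gl [Module.Finite ℂ g₁] {m n : ℕ}
    (hg : IsMatrixSuperalgebra g₀ g₁ (glEven m n) (glOdd m n)) :
    IsQuadraticWithSimpleSpectrum g₀ g₁ where
  exists_form := by
    refine hg.exists_isInvariantForm (fun X h => h) (fun X h => h) ?_ eq_zero_of_strForm_glOdd
    rintro _ ⟨P, S, rfl⟩ h
    refine eq_zero_of_strForm_eq_zero (h _ ?_)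
    rw [conjTranspose_even_mul_parity]
    exact ⟨_, _, rfl⟩
  exists_simple := exists_powerDisc_ne_zero_of_glOdd hg (a := 0) ⟨_, _, rfl⟩
  lie_eq_zero := hg.lie_eq_zero_of_acts_trivially (fun X h => h) (fun X h => h)
    fun Q => ⟨0, Q, 0, rfl⟩

theorem isQuadraticWithSimpleSpectrum_sl [Module.Finite ℂ g₁] {m n : ℕ} (hmn : m ≠ n)
    (hg : IsMatrixSuperalgebra g₀ g₁ (slEven m n) (glOdd m n)) :
    IsQuadraticWithSimpleSpectrum g₀ g₁ where
  exists_form := by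
    refine hg.exists_isInvariantForm (fun X ⟨P, S, h, _⟩ => ⟨P, S, h⟩) (fun X h => h) ?_
      eq_zero_of_strForm_glOdd
    rintro _ ⟨P, S, rfl, htr⟩ h
    have hmn' : (m : ℂ) - n ≠ 0 := sub_ne_zero.2 (Nat.cast_injective.ne hmn)
    -- The matrix `Xᴴ * parity` need not have supertrace zero. Adding `a` times the identity
    -- corrects this when `m ≠ n`, without changing the pairing with `X`, because `X` has supertrace
    -- zero.
    obtain ⟨a, ha⟩ : ∃ a : ℂ, (Pᴴ).trace + (Sᴴ).trace + a * (m - n) = 0 :=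
      ⟨-((Pᴴ).trace + (Sᴴ).trace) / (m - n), by rw [div_mul_cancel₀ _ hmn']; ring⟩
    have h1 := h (fromBlocks (Pᴴ + a • 1) 0 0 (-Sᴴ + a • 1)) ⟨_, _, rfl, by
      rw [trace_add, trace_add, trace_neg, trace_smul, trace_smul, trace_one, trace_one,
        Fintype.card_fin, Fintype.card_fin, smul_eq_mul, smul_eq_mul, ← ha]
      ring⟩
    refine eq_zero_of_strForm_eq_zero ?_
    have h2 : fromBlocks (Pᴴ + a • 1) 0 0 (-Sᴴ + a • 1) =
        (fromBlocks P 0 0 S)ᴴ * parity (Fin m) (Fin n) + a • 1 := by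
      rw [conjTranspose_even_mul_parity, ← fromBlocks_one, fromBlocks_smul, fromBlocks_add]
      simp
    rw [h2, map_add, map_smul, strForm_one, htr, smul_zero, add_zero] at h1
    exact h1
  exists_simple := by
    have hmn' : (m : ℂ) - n ≠ 0 := sub_ne_zero.2 (Nat.cast_injective.ne hmn)
    obtain ⟨a, ha⟩ : ∃ a : ℂ, (∑ i : Fin m, (i : ℂ)) - (∑ j : Fin n, (m : ℂ) * (j + 1)) +
        a * (m - n) = 0 :=
      ⟨-((∑ i : Fin m, (i : ℂ)) - (∑ j : Fin n, (m : ℂ) * (j + 1))) / (m - n), by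
        rw [div_mul_cancel₀ _ hmn']; ring⟩
    refine exists_powerDisc_ne_zero_of_glOdd hg (a := a) ⟨_, _, rfl, ?_⟩
    rw [trace_diagonal, trace_diagonal, Finset.sum_add_distrib, Finset.sum_add_distrib, ← ha]
    simp only [Finset.sum_const, Finset.card_univ, Fintype.card_fin, nsmul_eq_mul]
    ring
  lie_eq_zero := hg.lie_eq_zero_of_acts_trivially (fun X ⟨P, S, h, _⟩ => ⟨P, S, h⟩) (fun X h => h)
    fun Q => ⟨0, Q, 0, rfl⟩

end MatrixFamilies

end LieSuper
end

/-! ### The series `osp(m|2n)` -/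

noncomputable section

namespace LieSuper

section Orthosymplectic

open Matrix Module

variable {g₀ g₁ : Type*} [LieRing g₀] [LieAlgebra ℂ g₀] [AddCommGroup g₁]
    [Module ℂ g₁] [LieRingModule g₀ g₁] [LieModule ℂ g₀ g₁] [LieSuperalgebra g₀ g₁]

theorem J_mul_J (n : ℕ) : J (Fin n) ℂ * J (Fin n) ℂ = -1 := J_squared (Fin n) ℂ

theorem J_mul_J_mul {n : ℕ} {κ : Type*} (M : Matrix (Fin n ⊕ Fin n) κ ℂ) :
    J (Fin n) ℂ * (J (Fin n) ℂ * M) = -M := by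
  rw [← Matrix.mul_assoc, J_mul_J, Matrix.neg_mul, Matrix.one_mul]

theorem conjTranspose_J (n : ℕ) : (J (Fin n) ℂ)ᴴ = -J (Fin n) ℂ := by
  simp [J, fromBlocks_conjTranspose, fromBlocks_neg]

/-- The parametrization of the odd part of `osp(m|2n)`. -/
def ospOddMap (m n : ℕ) : Matrix (Fin m) (Fin n ⊕ Fin n) ℂ →ₗ[ℂ]
    Matrix (Fin m ⊕ (Fin n ⊕ Fin n)) (Fin m ⊕ (Fin n ⊕ Fin n)) ℂ where
  toFun Q := fromBlocks 0 Q (-(J (Fin n) ℂ * Qᵀ)) 0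
  map_add' Q Q' := by simp [fromBlocks_add, Matrix.mul_add, add_comm]
  map_smul' c Q := by simp [fromBlocks_smul]

theorem ospOddMap_apply {m n : ℕ} (Q : Matrix (Fin m) (Fin n ⊕ Fin n) ℂ) :
    ospOddMap m n Q = fromBlocks 0 Q (-(J (Fin n) ℂ * Qᵀ)) 0 := rfl

theorem range_ospOddMap (m n : ℕ) : Set.range (ospOddMap m n) = ospOdd m n := by
  ext X
  constructor
  · rintro ⟨Q, rfl⟩
    exact ⟨Q, _, rfl, by rw [Matrix.mul_neg, J_mul_J_mul, neg_neg]⟩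
  · rintro ⟨Q, R, rfl, h⟩
    refine ⟨Q, ?_⟩
    rw [ospOddMap_apply, h, J_mul_J_mul, neg_neg]

/-- The odd part is freely parametrized by its upper block `Q`, so the action can be computed as `P
Q - Q S` on rectangular matrices. -/
theorem commutator_ospOddMap {m n : ℕ} {P : Matrix (Fin m) (Fin m) ℂ}
    {S : Matrix (Fin n ⊕ Fin n) (Fin n ⊕ Fin n) ℂ} (hP : Pᵀ + P = 0)
    (hS : Sᵀ * J (Fin n) ℂ + J (Fin n) ℂ * S = 0) (Q : Matrix (Fin m) (Fin n ⊕ Fin n) ℂ) :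
    fromBlocks P 0 0 S * ospOddMap m n Q - ospOddMap m n Q * fromBlocks P 0 0 S =
      ospOddMap m n (P * Q - Q * S) := by
  have hP' : Pᵀ = -P := eq_neg_of_add_eq_zero_left hP
  have hS' : S * J (Fin n) ℂ = -(J (Fin n) ℂ * Sᵀ) := by
    have h1 := congrArg (fun M => J (Fin n) ℂ * (M * J (Fin n) ℂ)) hS
    simp only [Matrix.add_mul, Matrix.mul_add, Matrix.zero_mul, Matrix.mul_zero, Matrix.mul_assoc,
      J_mul_J, J_mul_J_mul, Matrix.mul_neg, Matrix.mul_one] at h1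
    rw [← sub_eq_zero, sub_neg_eq_add, ← neg_eq_zero, ← h1]
    abel
  simp only [ospOddMap_apply, fromBlocks_multiply, fromBlocks_sub_fromBlocks]
  congr 1
  · simp
  · simp
  · rw [transpose_sub, transpose_mul, transpose_mul, hP', Matrix.mul_neg, ← Matrix.mul_assoc, hS']
    simp [Matrix.mul_sub, Matrix.mul_assoc]
  · simp

/-- A skew-symmetric matrix with simple spectrum, supported on the antidiagonal. -/
def skewAntidiagonal (m : ℕ) : Matrix (Fin m) (Fin m) ℂ :=
  of fun i j => if j = i.rev then -Complex.I * (2 * i + 1 - m) else 0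

/-- The eigenvectors of `skewAntidiagonal m`. -/
def skewEigenvector {m : ℕ} (i : Fin m) : Fin m → ℂ := Pi.single i 1 + Complex.I • Pi.single i.rev 1

theorem cast_rev {m : ℕ} (i : Fin m) : ((i.rev : ℕ) : ℂ) = m - 1 - i := by
  have h : (i.rev : ℕ) + i + 1 = m := by rw [Fin.val_rev]; omega
  have : ((i.rev : ℕ) : ℂ) + i + 1 = m := by exact_mod_cast h
  linear_combination this

theorem transpose_skewAntidiagonal (m : ℕ) :
    (skewAntidiagonal m)ᵀ + skewAntidiagonal m = 0 := by
  ext i j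
  simp only [Matrix.add_apply, transpose_apply, skewAntidiagonal, of_apply, Matrix.zero_apply]
  by_cases h : j = i.rev
  · subst h
    rw [if_pos (Fin.rev_rev i).symm, if_pos rfl, cast_rev]
    ring
  · rw [if_neg h, if_neg (fun h' => h (by rw [h', Fin.rev_rev])), add_zero]

theorem skewAntidiagonal_mulVec {m : ℕ} (i : Fin m) :
    skewAntidiagonal m *ᵥ skewEigenvector i = (2 * i + 1 - m : ℂ) • skewEigenvector i := by
  ext a
  have h1 : (skewAntidiagonal m *ᵥ skewEigenvector i) a =
      -Complex.I * (2 * a + 1 - m) * skewEigenvector i a.rev := by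
    simp [mulVec, dotProduct, skewAntidiagonal]
  rw [h1]
  simp only [skewEigenvector, Pi.add_apply, Pi.smul_apply, smul_eq_mul, Pi.single_apply,
    Fin.rev_inj]
  have hI := Complex.I_mul_I
  by_cases ha : a = i
  · subst ha
    rw [if_pos rfl]
    by_cases hr : a.rev = a
    · rw [if_pos hr, if_pos hr.symm]
      have h2 := cast_rev a
      rw [hr] at h2
      -- This is the middle index of an odd `m`: the eigenvector collapses to a multiple of one
      -- basis vector and the eigenvalue is zero.
      linear_combination (-Complex.I * (1 + Complex.I) - (1 + Complex.I)) * h2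
    · rw [if_neg hr, if_neg (Ne.symm hr)]
      linear_combination (-(2 * a + 1 - m : ℂ)) * hI
  · rw [if_neg ha]
    by_cases hr : a.rev = i
    · subst hr
      rw [if_pos rfl, if_pos (Fin.rev_rev a).symm, cast_rev]
      ring
    · rw [if_neg hr, if_neg (fun h => hr (by rw [h, Fin.rev_rev]))]
      ring

theorem skewEigenvector_apply_self_ne_zero {m : ℕ} (i : Fin m) : skewEigenvector i i ≠ 0 := by
  intro h
  simp only [skewEigenvector, Pi.add_apply, Pi.smul_apply, smul_eq_mul, Pi.single_apply] at h
  have := congrArg Complex.re h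
  split_ifs at this <;> simp at this

/-- A diagonal symplectic matrix. -/
theorem diagonal_mul_J {n : ℕ} (s : Fin n → ℂ) :
    (diagonal (Sum.elim s (-s)))ᵀ * J (Fin n) ℂ + J (Fin n) ℂ * diagonal (Sum.elim s (-s)) = 0 := by
  rw [diagonal_transpose]
  ext i j
  rcases i with i | i <;> rcases j with j | j <;>
    simp [J, diagonal_mul, mul_diagonal, one_apply]
  all_goals
    split_ifs with h <;> simp_all

theorem exists_powerDisc_ne_zero_osp [Module.Finite ℂ g₁] {m n : ℕ}
    (hg : IsMatrixSuperalgebra g₀ g₁ (ospEven m n) (ospOdd m n)) :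
    ∃ u : g₀, powerDisc (LieModule.toEnd ℂ g₀ g₁ u) ≠ 0 := by
  -- The skew block has eigenvalues `2 i + 1 - m`, all of absolute value less than `m`. Spacing the
  -- symplectic eigenvalues by multiples of `2 m`, with zero omitted, keeps all differences
  -- distinct.
  let s : Fin n → ℂ := fun j => 2 * m * (j + 1)
  let σ : Fin n ⊕ Fin n → ℤ := Sum.elim (fun j => 2 * m * ((j : ℕ) + 1)) fun j => -(2 * m * ((j : ℕ) + 1))
  let c : Fin m × (Fin n ⊕ Fin n) → ℤ := fun k => 2 * (k.1 : ℕ) + 1 - m - σ k.2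
  have hσ : ∀ k, (Sum.elim s (-s)) k = (σ k : ℂ) := by
    rintro (k | k) <;> simp [s, σ]
  refine hg.exists_powerDisc_ne_zero (ψ := ospOddMap m n)
    (w := fun k : Fin m × (Fin n ⊕ Fin n) => vecMulVec (skewEigenvector k.1) (Pi.single k.2 1))
    (c := fun k => (c k : ℂ)) ?_ (range_ospOddMap m n)
    (U := fromBlocks (skewAntidiagonal m) 0 0 (diagonal (Sum.elim s (-s))))
    ⟨_, _, rfl, transpose_skewAntidiagonal m, diagonal_mul_J s⟩ ?_ ?_ ?_ ?_
  · intro Q Q' h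
    rw [ospOddMap_apply, ospOddMap_apply, fromBlocks_inj] at h
    exact h.2.1
  · intro k h
    have h1 := congrFun (congrFun h k.1) k.2
    rw [vecMulVec_apply, Pi.single_eq_same, mul_one] at h1
    exact skewEigenvector_apply_self_ne_zero _ h1
  · intro k
    rw [commutator_ospOddMap (transpose_skewAntidiagonal m) (diagonal_mul_J s), ← map_smul]
    congr 1
    rw [mul_vecMulVec, skewAntidiagonal_mulVec]
    ext a l
    rw [Matrix.sub_apply, mul_diagonal, Matrix.smul_apply, vecMulVec_apply, vecMulVec_apply, hσ, Pi.smul_apply,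
      smul_eq_mul, smul_eq_mul]
    by_cases hl : l = k.2
    · subst hl
      simp only [c]
      push_cast
      ring
    · rw [Pi.single_eq_of_ne hl]
      ring
  · refine Int.cast_injective.comp ?_
    rintro ⟨i, k⟩ ⟨i', k'⟩ h
    have hi : ((i : ℕ) : ℤ) < m := by exact_mod_cast i.2
    have hi' : ((i' : ℕ) : ℤ) < m := by exact_mod_cast i'.2
    have hpos : ∀ j : Fin n, (0 : ℤ) ≤ m * (j : ℕ) := fun j => by positivity
    rcases k with j | j <;> rcases k' with j' | j' <;> simp only [c, σ, Sum.elim_inl, Sum.elim_inr] at h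
    · obtain ⟨h1, h2⟩ := eq_and_eq_of_sub_mul_eq i.2 i'.2 (j := j) (j' := j') (by linarith)
      rw [Fin.ext h1, Fin.ext h2]
    · have := hpos j
      have := hpos j'
      nlinarith
    · have := hpos j
      have := hpos j'
      nlinarith
    · obtain ⟨h1, h2⟩ := eq_and_eq_of_sub_mul_eq i'.2 i.2 (j := j) (j' := j') (by linarith)
      rw [Fin.ext h1, Fin.ext h2]
  · simp [Module.finrank_matrix]

theorem isQuadraticWithSimpleSpectrum_osp [Module.Finite ℂ g₁] {m n : ℕ}
    (hg : IsMatrixSuperalgebra g₀ g₁ (ospEven m n) (ospOdd m n)) :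
    IsQuadraticWithSimpleSpectrum g₀ g₁ where
  exists_form := by
    refine hg.exists_isInvariantForm (fun X ⟨P, S, h, _⟩ => ⟨P, S, h⟩)
      (fun X ⟨Q, R, h, _⟩ => ⟨Q, R, h⟩) ?_ ?_
    · rintro _ ⟨P, S, rfl, hP, hS⟩ h
      refine eq_zero_of_strForm_eq_zero (h _ ?_)
      rw [conjTranspose_even_mul_parity]
      refine ⟨_, _, rfl, ?_, ?_⟩
      · have := congrArg conjTranspose hP
        rw [conjTranspose_add, conjTranspose_zero] at this
        exact this
      · have h1 := congrArg (fun M => J (Fin n) ℂ * (Mᴴ * J (Fin n) ℂ)) hS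
        have h2 : Sᵀᴴ = Sᴴᵀ := rfl
        simp only [conjTranspose_add, conjTranspose_mul, conjTranspose_J, h2, Matrix.add_mul,
          Matrix.mul_add, Matrix.neg_mul, Matrix.mul_neg, Matrix.mul_assoc, J_mul_J, J_mul_J_mul,
          conjTranspose_zero, Matrix.zero_mul, Matrix.mul_zero, neg_neg, Matrix.mul_one] at h1
        rw [← neg_eq_zero, ← h1, transpose_neg, Matrix.neg_mul, Matrix.mul_neg]
        abel
    · rintro _ ⟨Q, R, rfl, hQR⟩ h
      refine eq_zero_of_strForm_eq_zero (h _ ?_)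
      rw [conjTranspose_odd_mul_parity]
      refine ⟨_, _, rfl, ?_⟩
      have h1 : Qᴴ = (Qᵀᴴ)ᵀ := rfl
      rw [h1, hQR, conjTranspose_mul, conjTranspose_J, Matrix.mul_neg, transpose_neg, transpose_neg,
        transpose_mul, J_transpose, Matrix.neg_mul, neg_neg, J_mul_J_mul]
  exists_simple := exists_powerDisc_ne_zero_osp hg
  lie_eq_zero := hg.lie_eq_zero_of_acts_trivially (fun X ⟨P, S, h, _⟩ => ⟨P, S, h⟩)
    (fun X ⟨Q, R, h, _⟩ => ⟨Q, R, h⟩) fun Q => ⟨_, by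
      rw [← range_ospOddMap]; exact ⟨Q, rfl⟩⟩

end Orthosymplectic

end LieSuper
end

/-! ### The family `D(2|1;a)` -/

noncomputable section

namespace LieSuper

section InvariantForms

variable {g₀ g₁ : Type*} [LieRing g₀] [LieAlgebra ℂ g₀] [AddCommGroup g₁]
    [Module ℂ g₁] [LieRingModule g₀ g₁] [LieModule ℂ g₀ g₁] [LieSuperalgebra g₀ g₁]

/-- If `g₀` acts faithfully on `g₁`, nondegeneracy of an invariant form on `g₁` implies its
nondegeneracy on `g₀`. -/
theorem IsInvariantForm.of_faithful {B₀ : LinearMap.BilinForm ℂ g₀}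
    {B₁ : LinearMap.BilinForm ℂ g₁} (hsymm : ∀ u v : g₀, B₀ u v = B₀ v u)
    (hskew : ∀ x y : g₁, B₁ x y = -B₁ y x) (heven : ∀ u v w : g₀, B₀ ⁅u, v⁆ w = B₀ u ⁅v, w⁆)
    (hodd : ∀ (u : g₀) (x y : g₁), B₁ ⁅u, x⁆ y = B₀ u (LieSuperalgebra.oddBracket x y))
    (hsep : B₁.SeparatingLeft) (hfaith : ∀ u : g₀, (∀ y : g₁, ⁅u, y⁆ = 0) → u = 0) :
    IsInvariantForm B₀ B₁ := by
  have hsep₀ : B₀.SeparatingLeft := fun u hu =>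
    hfaith u fun y => hsep _ fun z => (hodd u y z).trans (hu _)
  exact ⟨hsymm, hskew, heven, hodd,
    ⟨hsep₀, fun u hu => hsep₀ u fun v => (hsymm u v).trans (hu v)⟩,
    ⟨hsep, fun u hu => hsep u fun v => (hskew u v).trans (by rw [hu v, neg_zero])⟩⟩

end InvariantForms

section SymplecticPlane

open Matrix

/-- The symplectic form on `ℂ²` as a bilinear form. -/
def sympForm : LinearMap.BilinForm ℂ (Fin 2 → ℂ) :=
  LinearMap.mk₂ ℂ symp (fun v v' w => by simp [symp]; ring) (fun c v w => by simp [symp]; ring)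
    (fun v w w' => by simp [symp]; ring) (fun c v w => by simp [symp]; ring)

theorem sympForm_apply (v w : Fin 2 → ℂ) : sympForm v w = symp v w := rfl

theorem symp_swap (v w : Fin 2 → ℂ) : symp v w = -symp w v := by
  simp only [symp]; ring

/-- The basis of `ℂ²` dual to the standard one with respect to the symplectic form. -/
def sympDual : Fin 2 → Fin 2 → ℂ := ![![0, 1], ![-1, 0]]

theorem sympForm_sympDual (v : Fin 2 → ℂ) (i : Fin 2) :
    sympForm v (sympDual i) = (Pi.basisFun ℂ (Fin 2)).repr v i := by
  fin_cases i <;> simp [sympForm_apply, symp, sympDual]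

theorem trace_sl2 (s : sl2) : (s : Matrix (Fin 2) (Fin 2) ℂ).trace = 0 := s.2

theorem trace_mul_sympSq (s : sl2) (v w : Fin 2 → ℂ) :
    ((s : Matrix (Fin 2) (Fin 2) ℂ) * sympSq v w).trace =
      -2 * symp ((s : Matrix (Fin 2) (Fin 2) ℂ) *ᵥ v) w := by
  have h := trace_sl2 s
  rw [trace_fin_two] at h
  simp only [sympSq, Matrix.mul_add, trace_add, symp, trace_fin_two, Matrix.mul_apply,
    vecMulVec_apply, mulVec, dotProduct, Fin.sum_univ_two, cons_val_zero, cons_val_one]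
  linear_combination (v 0 * w 1 - v 1 * w 0) * h

/-- As a representation, `sl(2)` is the space of quadratic forms on the plane; three values
determine such a form. -/
theorem sl2_eq_zero_of_symp {s : sl2}
    (h : ∀ v, symp ((s : Matrix (Fin 2) (Fin 2) ℂ) *ᵥ v) v = 0) : s = 0 := by
  have ht := trace_sl2 s
  rw [trace_fin_two] at ht
  have h0 := h ![1, 0]
  have h1 := h ![0, 1]
  have h2 := h ![1, 1]
  simp [symp, mulVec, dotProduct, Fin.sum_univ_two] at h0 h1 h2
  ext i j
  fin_cases i <;> fin_cases j <;> simp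
  · linear_combination (ht + h2 + h0 - h1) / 2
  · exact h1
  · exact h0
  · linear_combination (ht - h2 - h0 + h1) / 2

/-- The diagonal element `diag(s, -s)` of `sl(2)`. -/
def sl2Diagonal (s : ℂ) : sl2 := ⟨diagonal ![s, -s], by
  change (diagonal ![s, -s]).trace = 0
  simp⟩

theorem sl2Diagonal_mulVec_single (s : ℂ) (i : Fin 2) :
    (sl2Diagonal s : Matrix (Fin 2) (Fin 2) ℂ) *ᵥ Pi.single i 1 =
      (![s, -s] i) • Pi.single i 1 := by
  ext j
  fin_cases i <;> fin_cases j <;> simp [sl2Diagonal, mulVec_diagonal]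

end SymplecticPlane

section DTwoOne

open Matrix Module

theorem tmul_apply_eq_repr {M N ι κ : Type*} [AddCommGroup M] [Module ℂ M] [AddCommGroup N]
    [Module ℂ N] {B : LinearMap.BilinForm ℂ M} {C : LinearMap.BilinForm ℂ N} {b : Basis ι ℂ M}
    {c : Basis κ ℂ N} {b' : ι → M} {c' : κ → N} (hb : ∀ x i, B x (b' i) = b.repr x i)
    (hc : ∀ x i, C x (c' i) = c.repr x i) (x : M ⊗[ℂ] N) (k : ι × κ) :
    B.tmul C x (b' k.1 ⊗ₜ c' k.2) = (b.tensorProduct c).repr x k := by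
  obtain ⟨i, j⟩ := k
  induction x with
  | zero => simp
  | tmul m n =>
    rw [LinearMap.BilinForm.tensorDistrib_tmul, hb, hc, Basis.tensorProduct_repr_tmul_apply]
  | add x y hx hy => rw [map_add, LinearMap.add_apply, hx, hy, map_add, Finsupp.add_apply]

theorem separatingLeft_of_apply_eq_repr {M ι : Type*} [AddCommGroup M] [Module ℂ M]
    {B : LinearMap.BilinForm ℂ M} {b : Basis ι ℂ M} {b' : ι → M}
    (hb : ∀ x i, B x (b' i) = b.repr x i) : B.SeparatingLeft := fun x hx =>
  b.repr.injective (Finsupp.ext fun i => by rw [← hb, hx, map_zero, Finsupp.zero_apply])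

/-- The product of three symplectic forms. -/
def tripleForm : LinearMap.BilinForm ℂ ((Fin 2 → ℂ) ⊗[ℂ] ((Fin 2 → ℂ) ⊗[ℂ] (Fin 2 → ℂ))) :=
  sympForm.tmul (sympForm.tmul sympForm)

theorem tripleForm_tmul (v₁ v₂ v₃ w₁ w₂ w₃ : Fin 2 → ℂ) :
    tripleForm (v₁ ⊗ₜ (v₂ ⊗ₜ v₃)) (w₁ ⊗ₜ (w₂ ⊗ₜ w₃)) = symp v₁ w₁ * symp v₂ w₂ * symp v₃ w₃ := by
  simp only [tripleForm, LinearMap.BilinForm.tensorDistrib_tmul, sympForm_apply, smul_eq_mul]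
  ring

theorem tripleForm_separatingLeft : tripleForm.SeparatingLeft :=
  separatingLeft_of_apply_eq_repr
    (tmul_apply_eq_repr sympForm_sympDual (tmul_apply_eq_repr sympForm_sympDual sympForm_sympDual))

/-- Induction for a threefold tensor product. -/
theorem tripleTensor_induction {p : (Fin 2 → ℂ) ⊗[ℂ] ((Fin 2 → ℂ) ⊗[ℂ] (Fin 2 → ℂ)) → Prop}
    (h : ∀ v₁ v₂ v₃, p (v₁ ⊗ₜ (v₂ ⊗ₜ v₃))) (hadd : ∀ x y, p x → p y → p (x + y)) (x) : p x := by
  have h0 : p 0 := by simpa using h 0 0 0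
  induction x with
  | zero => exact h0
  | tmul v y =>
    induction y with
    | zero => simpa using h0
    | tmul v₂ v₃ => exact h v v₂ v₃
    | add y z hy hz => rw [TensorProduct.tmul_add]; exact hadd _ _ hy hz
  | add x y hx hy => exact hadd _ _ hx hy

theorem tripleForm_skew (x y) : tripleForm x y = -tripleForm y x := by
  refine tripleTensor_induction (p := fun x => tripleForm x y = -tripleForm y x)
    (fun v₁ v₂ v₃ => ?_) (fun a b ha hb => ?_) x
  · refine tripleTensor_induction (p := fun y => tripleForm _ y = -tripleForm y _)
      (fun w₁ w₂ w₃ => ?_) (fun a b ha hb => ?_) y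
    · rw [tripleForm_tmul, tripleForm_tmul, symp_swap v₁, symp_swap v₂, symp_swap v₃]
      ring
    · rw [map_add, ha, hb, map_add, LinearMap.add_apply]
      ring
  · rw [map_add, LinearMap.add_apply, ha, hb, map_add]
    ring

variable {g₀ g₁ : Type*} [LieRing g₀] [LieAlgebra ℂ g₀] [AddCommGroup g₁]
    [Module ℂ g₁] [LieRingModule g₀ g₁] [LieModule ℂ g₀ g₁] [LieSuperalgebra g₀ g₁]

/-- The trace form of `sl(2)`. -/
def sl2TraceForm : LinearMap.BilinForm ℂ sl2 :=
  LinearMap.mk₂ ℂ (fun s s' => ((s : Matrix (Fin 2) (Fin 2) ℂ) * (s' : Matrix _ _ ℂ)).trace)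
    (fun s s' s'' => by simp [Matrix.add_mul]) (fun c s s' => by simp)
    (fun s s' s'' => by simp [Matrix.mul_add]) (fun c s s' => by simp)

theorem sl2TraceForm_apply (s s' : sl2) :
    sl2TraceForm s s' = ((s : Matrix (Fin 2) (Fin 2) ℂ) * (s' : Matrix _ _ ℂ)).trace := rfl

theorem sl2TraceForm_symm (s s' : sl2) : sl2TraceForm s s' = sl2TraceForm s' s := by
  rw [sl2TraceForm_apply, sl2TraceForm_apply, trace_mul_comm]

theorem sl2TraceForm_lie (s s' s'' : sl2) : sl2TraceForm ⁅s, s'⁆ s'' = sl2TraceForm s ⁅s', s''⁆ := by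
  have h : (s' * (s * s'') : Matrix (Fin 2) (Fin 2) ℂ).trace =
      (s * (s'' * s') : Matrix (Fin 2) (Fin 2) ℂ).trace := by
    rw [trace_mul_comm, mul_assoc]
  simp only [sl2TraceForm_apply, LieSubalgebra.coe_bracket, Ring.lie_def, sub_mul, mul_sub,
    trace_sub, mul_assoc, h]

/-- Pair the action with a test tensor that repeats `v` in one slot: `symp v v = 0` kills the other
two terms and isolates one `sl(2)` component. -/
theorem IsD21.eq_zero_of_acts_trivially {a : ℂ} (hg : IsD21 a g₀ g₁) {u : g₀}
    (hu : ∀ y : g₁, ⁅u, y⁆ = 0) : u = 0 := by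
  obtain ⟨e₀, e₁, h01, -⟩ := hg
  have key : ∀ v₁ v₂ v₃ w₁ w₂ w₃,
      symp (((e₀ u).1 : Matrix (Fin 2) (Fin 2) ℂ) *ᵥ v₁) w₁ * symp v₂ w₂ * symp v₃ w₃ +
      symp v₁ w₁ * symp (((e₀ u).2.1 : Matrix (Fin 2) (Fin 2) ℂ) *ᵥ v₂) w₂ * symp v₃ w₃ +
      symp v₁ w₁ * symp v₂ w₂ * symp (((e₀ u).2.2 : Matrix (Fin 2) (Fin 2) ℂ) *ᵥ v₃) w₃ = 0 := by
    intro v₁ v₂ v₃ w₁ w₂ w₃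
    have h := congrArg (fun x => tripleForm x (w₁ ⊗ₜ (w₂ ⊗ₜ w₃))) (h01 u v₁ v₂ v₃)
    simp only [hu, map_zero, map_add, LinearMap.zero_apply, LinearMap.add_apply,
      tripleForm_tmul] at h
    exact h.symm
  have hself : ∀ v, symp v v = 0 := fun v => by simp only [symp]; ring
  have hone : symp ![1, 0] ![0, 1] = 1 := by simp [symp]
  have h1 : (e₀ u).1 = 0 := sl2_eq_zero_of_symp fun v => by
    simpa [hself, hone] using key v ![1, 0] ![1, 0] v ![0, 1] ![0, 1]
  have h2 : (e₀ u).2.1 = 0 := sl2_eq_zero_of_symp fun v => by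
    simpa [hself, hone] using key ![1, 0] v ![1, 0] ![0, 1] v ![0, 1]
  have h3 : (e₀ u).2.2 = 0 := sl2_eq_zero_of_symp fun v => by
    simpa [hself, hone] using key ![1, 0] ![1, 0] v ![0, 1] ![0, 1] v
  refine e₀.injective ?_
  rw [map_zero]
  exact Prod.ext h1 (Prod.ext h2 h3)

theorem IsD21.exists_powerDisc_ne_zero [Module.Finite ℂ g₁] {a : ℂ} (hg : IsD21 a g₀ g₁) :
    ∃ u : g₀, powerDisc (LieModule.toEnd ℂ g₀ g₁ u) ≠ 0 := by
  obtain ⟨e₀, e₁, h01, -⟩ := hg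
  let b := (Pi.basisFun ℂ (Fin 2)).tensorProduct
    ((Pi.basisFun ℂ (Fin 2)).tensorProduct (Pi.basisFun ℂ (Fin 2)))
  -- The eight sums `±1 ± 2 ± 4` are distinct.
  let c : Fin 2 × Fin 2 × Fin 2 → ℤ := fun k => ![1, -1] k.1 + ![2, -2] k.2.1 + ![4, -4] k.2.2
  have hb : ∀ k, b k = Pi.single k.1 1 ⊗ₜ (Pi.single k.2.1 1 ⊗ₜ Pi.single k.2.2 1) := by
    intro k
    simp [b, Basis.tensorProduct_apply']
  refine ⟨e₀.symm (sl2Diagonal 1, sl2Diagonal 2, sl2Diagonal 4),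
    powerDisc_toEnd_ne_zero (ρ := e₁.toLinearMap) e₁.injective (w := b) (c := fun k => (c k : ℂ))
    (fun k => ⟨e₁.symm (b k), e₁.apply_symm_apply _⟩) (fun k => b.ne_zero k) (fun k x hx => ?_)
    (Int.cast_injective.comp (by decide)) ?_⟩
  · have hx' : x = e₁.symm (b k) := by rw [← hx]; exact (e₁.symm_apply_apply x).symm
    rw [hx', hb]
    refine (h01 _ _ _ _).trans ?_
    rw [LieEquiv.apply_symm_apply]
    simp only [sl2Diagonal_mulVec_single, TensorProduct.tmul_smul, ← TensorProduct.smul_tmul',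
      ← add_smul]
    congr 1
    simp only [c]
    obtain ⟨i, j, l⟩ := k
    fin_cases i <;> fin_cases j <;> fin_cases l <;> norm_num
  · rw [e₁.finrank_eq, finrank_eq_card_basis b]

theorem IsD21.exists_isInvariantForm {a : ℂ} (ha : a ≠ 0) (ha' : a ≠ -1) (hg : IsD21 a g₀ g₁) :
    ∃ (B₀ : LinearMap.BilinForm ℂ g₀) (B₁ : LinearMap.BilinForm ℂ g₁), IsInvariantForm B₀ B₁ := by
  have hfaith : ∀ u : g₀, (∀ y : g₁, ⁅u, y⁆ = 0) → u = 0 := fun u => hg.eq_zero_of_acts_trivially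
  obtain ⟨e₀, e₁, h01, h11⟩ := hg
  have ha1 : 1 + a ≠ 0 := fun h => ha' (by linear_combination h)
  let p₁ : g₀ →ₗ[ℂ] sl2 := LinearMap.fst ℂ _ _ ∘ₗ (e₀ : g₀ →ₗ[ℂ] sl2 × sl2 × sl2)
  let p₂ : g₀ →ₗ[ℂ] sl2 :=
    LinearMap.fst ℂ _ _ ∘ₗ LinearMap.snd ℂ _ _ ∘ₗ (e₀ : g₀ →ₗ[ℂ] sl2 × sl2 × sl2)
  let p₃ : g₀ →ₗ[ℂ] sl2 :=
    LinearMap.snd ℂ _ _ ∘ₗ LinearMap.snd ℂ _ _ ∘ₗ (e₀ : g₀ →ₗ[ℂ] sl2 × sl2 × sl2)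
  -- By `trace_mul_sympSq`, invariance forces the coefficient `-1 / (2 σᵢ)` on the `i`-th factor,
  -- with `σ = (-(1 + a), 1, a)`; this is where `a ≠ 0, -1` enters.
  let B₀ : LinearMap.BilinForm ℂ g₀ := (1 / (2 * (1 + a))) • sl2TraceForm.compl₁₂ p₁ p₁ +
    (-1 / 2 : ℂ) • sl2TraceForm.compl₁₂ p₂ p₂ + (-1 / (2 * a)) • sl2TraceForm.compl₁₂ p₃ p₃
  have hB₀ : ∀ u v, B₀ u v = 1 / (2 * (1 + a)) * sl2TraceForm (e₀ u).1 (e₀ v).1 +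
    (-1 / 2) * sl2TraceForm (e₀ u).2.1 (e₀ v).2.1 +
    (-1 / (2 * a)) * sl2TraceForm (e₀ u).2.2 (e₀ v).2.2 := fun u v => rfl
  let B₁ : LinearMap.BilinForm ℂ g₁ := tripleForm.compl₁₂ e₁.toLinearMap e₁.toLinearMap
  have hB₁ : ∀ x y, B₁ x y = tripleForm (e₁ x) (e₁ y) := fun x y => rfl
  refine ⟨B₀, B₁, IsInvariantForm.of_faithful (fun u v => ?_) (fun x y => ?_) (fun u v w => ?_)
    (fun u x y => ?_) (fun x hx => ?_) hfaith⟩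
  · simp only [hB₀, sl2TraceForm_symm (e₀ u).1, sl2TraceForm_symm (e₀ u).2.1,
      sl2TraceForm_symm (e₀ u).2.2]
  · rw [hB₁, hB₁, tripleForm_skew]
  · simp only [hB₀, LieEquiv.map_lie]
    exact congrArg₂ _ (congrArg₂ _ (congrArg _ (sl2TraceForm_lie _ _ _))
      (congrArg _ (sl2TraceForm_lie _ _ _))) (congrArg _ (sl2TraceForm_lie _ _ _))
  · rw [← e₁.symm_apply_apply x, ← e₁.symm_apply_apply y]
    generalize e₁ x = x
    generalize e₁ y = y
    refine tripleTensor_induction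
      (p := fun x => B₁ ⁅u, e₁.symm x⁆ (e₁.symm y) = B₀ u (LieSuperalgebra.oddBracket _ _))
      (fun v₁ v₂ v₃ => ?_) (fun x x' hx hx' => ?_) x
    · refine tripleTensor_induction
        (p := fun y => B₁ _ (e₁.symm y) = B₀ u (LieSuperalgebra.oddBracket _ (e₁.symm y)))
        (fun w₁ w₂ w₃ => ?_) (fun y y' hy hy' => ?_) y
      · obtain ⟨h1, h2, h3⟩ := h11 v₁ v₂ v₃ w₁ w₂ w₃ _ rfl
        rw [hB₁, h01, hB₀, e₁.apply_symm_apply]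
        simp only [sl2TraceForm_apply, h1, h2, h3, Matrix.mul_smul, trace_smul, trace_mul_sympSq,
          map_add, LinearMap.add_apply, tripleForm_tmul, smul_eq_mul]
        field_simp
      · simp only [map_add, hy, hy']
    · simp only [map_add, lie_add, LinearMap.add_apply, hx, hx']
  · refine e₁.injective ?_
    rw [map_zero]
    refine tripleForm_separatingLeft _ fun y => ?_
    rw [← e₁.apply_symm_apply y]
    exact hx _

theorem isQuadraticWithSimpleSpectrum_d21 [Module.Finite ℂ g₁] {a : ℂ} (ha : a ≠ 0) (ha' : a ≠ -1)
    (hg : IsD21 a g₀ g₁) : IsQuadraticWithSimpleSpectrum g₀ g₁ where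
  exists_form := hg.exists_isInvariantForm ha ha'
  exists_simple := hg.exists_powerDisc_ne_zero
  lie_eq_zero := Or.inr fun _ _ h => hg.eq_zero_of_acts_trivially h

end DTwoOne

end LieSuper
end

/-! ### Superalgebras with odd part in octonions tensor the plane -/

noncomputable section

namespace LieSuper

attribute [local instance] LieRing.ofAssociativeRing

namespace Oct

theorem form_comm (x y : Oct) : form x y = form y x := by
  simp only [form, dotProduct_comm]
  ring

/-- The octonion form as a bilinear form. -/
def formBilin : LinearMap.BilinForm ℂ Oct :=
  LinearMap.mk₂ ℂ form
    (fun x y z => by simp only [form, Prod.fst_add, Prod.snd_add, add_dotProduct]; ring)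
    (fun c x y => by
      simp only [form, Prod.smul_fst, Prod.smul_snd, smul_dotProduct, smul_eq_mul]; ring)
    (fun x y z => by simp only [form, Prod.fst_add, Prod.snd_add, dotProduct_add]; ring)
    (fun c x y => by
      simp only [form, Prod.smul_fst, Prod.smul_snd, dotProduct_smul, smul_eq_mul]; ring)

theorem form_add_left (x y z : Oct) : form (x + y) z = form x z + form y z :=
  LinearMap.map_add₂ formBilin x y z

theorem form_add_right (x y z : Oct) : form x (y + z) = form x y + form x z :=
  (formBilin x).map_add y z

theorem form_smul_left (c : ℂ) (x y : Oct) : form (c • x) y = c * form x y :=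
  LinearMap.map_smul₂ formBilin c x y

theorem form_smul_right (c : ℂ) (x y : Oct) : form x (c • y) = c * form x y :=
  (formBilin x).map_smul c y

theorem form_sub_left (x y z : Oct) : form (x - y) z = form x z - form y z :=
  LinearMap.map_sub₂ formBilin x y z

theorem form_sub_right (x y z : Oct) : form x (y - z) = form x y - form x z :=
  (formBilin x).map_sub y z

theorem form_zero_left (x : Oct) : form 0 x = 0 := LinearMap.map_zero₂ formBilin x

theorem form_zero_right (x : Oct) : form x 0 = 0 := (formBilin x).map_zero

/-- The trace of an endomorphism of the octonions in terms of the standard basis. -/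
theorem trace_eq (f : Module.End ℂ Oct) : LinearMap.trace ℂ Oct f =
    (f (1, 0, 0, 0)).1 + ∑ i, (f (0, Pi.single i 1, 0, 0)).2.1 i +
      ∑ i, (f (0, 0, Pi.single i 1, 0)).2.2.1 i + (f (0, 0, 0, 1)).2.2.2 := by
  rw [LinearMap.trace_eq_matrix_trace ℂ ((Module.Basis.singleton Unit ℂ).prod
    ((Pi.basisFun ℂ (Fin 3)).prod ((Pi.basisFun ℂ (Fin 3)).prod (Module.Basis.singleton Unit ℂ))))]
  simp [Matrix.trace, LinearMap.toMatrix_apply, Fintype.sum_sum_type, Module.Basis.prod_apply,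
    add_assoc]
  rfl

end Oct

section Octonionic

open Matrix Module Oct

variable {g₀ g₁ : Type*} [LieRing g₀] [LieAlgebra ℂ g₀] [AddCommGroup g₁]
    [Module ℂ g₁] [LieRingModule g₀ g₁] [LieModule ℂ g₀ g₁] [LieSuperalgebra g₀ g₁]
    {K : LieSubalgebra ℂ (Module.End ℂ Oct)} {V : Submodule ℂ Oct} {D : Oct → Oct → Oct → Oct}
    {c : ℂ}

theorem symp_single (i j : Fin 2) :
    symp (Pi.single i 1) (Pi.single j 1) = (![![0, 1], ![-1, 0]] : Matrix (Fin 2) (Fin 2) ℂ) i j := by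
  fin_cases i <;> fin_cases j <;> simp [symp]

/-- Bracketing `x ⊗ e₀` with `y ⊗ e₁` isolates `D x y`. The given superalgebra itself thus certifies
that `D` takes values in `K`, with no octonion identity needed. -/
theorem IsOctonionic.exists_mem (hg : IsOctonionic K V D c g₀ g₁) (hD : ∀ z, D 0 0 z = 0)
    {x y : Oct} (hx : x ∈ V) (hy : y ∈ V) : ∃ d ∈ K, ∀ z, d z = D x y z := by
  obtain ⟨e₀, ρ₁, -, hr, -, h11, -⟩ := hg
  obtain ⟨X, hX⟩ : ![x, 0] ∈ Set.range ρ₁ := by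
    rw [hr]; intro i; fin_cases i; exacts [hx, V.zero_mem]
  obtain ⟨Y, hY⟩ : ![0, y] ∈ Set.range ρ₁ := by
    rw [hr]; intro i; fin_cases i; exacts [V.zero_mem, hy]
  refine ⟨_, (e₀ (LieSuperalgebra.oddBracket X Y)).1.2, fun z => ?_⟩
  rw [h11, hX, hY]
  simp [symp_single, hD]

/-- The map `D` is equivariant. -/
theorem IsOctonionic.lie_apply (hg : IsOctonionic K V D c g₀ g₁) (hD : ∀ z, D 0 0 z = 0)
    {d d' : Module.End ℂ Oct} (hd : d ∈ K) {x y : Oct} (hx : x ∈ V) (hy : y ∈ V)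
    (hd' : ∀ z, d' z = D x y z) (z : Oct) :
    d (d' z) - d' (d z) = D (d x) y z + D x (d y) z := by
  obtain ⟨e₀, ρ₁, -, hr, h01, h11, -⟩ := hg
  obtain ⟨X, hX⟩ : ![x, 0] ∈ Set.range ρ₁ := by
    rw [hr]; intro i; fin_cases i; exacts [hx, V.zero_mem]
  obtain ⟨Y, hY⟩ : ![0, y] ∈ Set.range ρ₁ := by
    rw [hr]; intro i; fin_cases i; exacts [V.zero_mem, hy]
  obtain ⟨u, hu⟩ : ∃ u, e₀ u = (⟨d, hd⟩, 0) := ⟨_, e₀.apply_symm_apply _⟩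
  have h := congrArg (fun b => ((e₀ b).1 : Module.End ℂ Oct) z)
    (LieSuperalgebra.lie_oddBracket u X Y)
  have hXY : ∀ z, ((e₀ (LieSuperalgebra.oddBracket X Y)).1 : Module.End ℂ Oct) z = d' z := by
    intro z
    rw [h11, hX, hY, hd']
    simp [symp_single, hD]
  have h1 : ∀ i, ρ₁ ⁅u, X⁆ i = ![d x, 0] i := by
    intro i
    rw [h01, hu, hX]
    fin_cases i <;> simp
  have h2 : ∀ i, ρ₁ ⁅u, Y⁆ i = ![0, d y] i := by
    intro i
    rw [h01, hu, hY]
    fin_cases i <;> simp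
  have h3 : ((e₀ ⁅u, LieSuperalgebra.oddBracket X Y⁆).1 : Module.End ℂ Oct) z =
      d (d' z) - d' (d z) := by
    rw [LieEquiv.map_lie, hu, ← hXY, ← hXY]
    rfl
  have h4 : ((e₀ (LieSuperalgebra.oddBracket ⁅u, X⁆ Y)).1 : Module.End ℂ Oct) z = D (d x) y z := by
    rw [h11, hY]
    simp [symp_single, h1, hD]
  have h5 : ((e₀ (LieSuperalgebra.oddBracket X ⁅u, Y⁆)).1 : Module.End ℂ Oct) z = D x (d y) z := by
    rw [h11, hX]
    simp [symp_single, h2, hD]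
  rw [← h3, ← h4, ← h5]
  refine h.trans ?_
  rw [map_add]
  rfl

/-- Acting on `x ⊗ e₀` and `x ⊗ e₁` with `x ≠ 0` shows that the `sl(2)` part is scalar, hence zero
by its trace; then the part in `K` kills `V`. -/
theorem IsOctonionic.eq_zero_of_acts_trivially (hg : IsOctonionic K V D c g₀ g₁)
    (hV : ∃ x ∈ V, x ≠ 0) (hK : ∀ d ∈ K, (∀ x ∈ V, d x = 0) → d = 0) {u : g₀}
    (hu : ∀ y : g₁, ⁅u, y⁆ = 0) : u = 0 := by
  obtain ⟨e₀, ρ₁, -, hr, h01, -⟩ := hg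
  have key : ∀ x ∈ V, ∀ y ∈ V, ∀ i, ((e₀ u).1 : Module.End ℂ Oct) (![x, y] i) +
      (((e₀ u).2 : Matrix (Fin 2) (Fin 2) ℂ) i 0 • x +
        ((e₀ u).2 : Matrix (Fin 2) (Fin 2) ℂ) i 1 • y) = 0 := by
    intro x hx y hy i
    obtain ⟨X, hX⟩ : ![x, y] ∈ Set.range ρ₁ := by
      rw [hr]; intro i; fin_cases i; exacts [hx, hy]
    have h := h01 u X i
    rw [hu, map_zero, hX, Fin.sum_univ_two] at h
    exact h.symm
  obtain ⟨x, hx, hx0⟩ := hV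
  have ht := trace_sl2 (e₀ u).2
  rw [trace_fin_two] at ht
  have h10 := key x hx 0 V.zero_mem 1
  have h01 := key 0 V.zero_mem x hx 0
  have h00 := key x hx 0 V.zero_mem 0
  have h11 := key 0 V.zero_mem x hx 1
  simp [hx0] at h10 h01 h00 h11
  have hd : ((e₀ u).2 : Matrix (Fin 2) (Fin 2) ℂ) 0 0 =
      ((e₀ u).2 : Matrix (Fin 2) (Fin 2) ℂ) 1 1 := by
    have h2 := h00.trans h11.symm
    exact smul_left_injective ℂ hx0 (add_left_cancel h2)
  have hs : (e₀ u).2 = 0 := by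
    ext i j
    fin_cases i <;> fin_cases j <;> simp
    · linear_combination (ht + hd) / 2
    · exact h01
    · exact h10
    · linear_combination (ht - hd) / 2
  have hd : (e₀ u).1 = 0 := by
    refine Subtype.ext (hK _ (e₀ u).1.2 fun x hx => ?_)
    have := key x hx 0 V.zero_mem 0
    simpa [hs] using this
  exact e₀.injective (by rw [map_zero]; exact Prod.ext hd hs)

theorem IsOctonionic.exists_isInvariantForm (hg : IsOctonionic K V D c g₀ g₁)
    (hD : ∀ z, D 0 0 z = 0) (hc : c ≠ 0) {κ : ℂ} (hκ : κ ≠ 0)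
    (htr : ∀ d ∈ K, ∀ d' ∈ K, ∀ x ∈ V, ∀ y ∈ V, (∀ z, d' z = D x y z) →
      LinearMap.trace ℂ Oct (d * d') = κ * form (d x) y)
    (hV : ∀ x ∈ V, (∀ y ∈ V, form x y = 0) → x = 0) (hV' : ∃ x ∈ V, x ≠ 0)
    (hK : ∀ d ∈ K, (∀ x ∈ V, d x = 0) → d = 0) :
    ∃ (B₀ : LinearMap.BilinForm ℂ g₀) (B₁ : LinearMap.BilinForm ℂ g₁), IsInvariantForm B₀ B₁ := by
  have hmem := fun x (hx : x ∈ V) y (hy : y ∈ V) => hg.exists_mem hD hx hy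
  have hfaith : ∀ u : g₀, (∀ y : g₁, ⁅u, y⁆ = 0) → u = 0 :=
    fun u => hg.eq_zero_of_acts_trivially hV' hK
  obtain ⟨e₀, ρ₁, hρ, hr, h01, h11, h12⟩ := hg
  let p₁ : g₀ →ₗ[ℂ] Module.End ℂ Oct :=
    K.toSubmodule.subtype ∘ₗ LinearMap.fst ℂ _ _ ∘ₗ (e₀ : g₀ →ₗ[ℂ] K × sl2)
  let p₂ : g₀ →ₗ[ℂ] sl2 := LinearMap.snd ℂ _ _ ∘ₗ (e₀ : g₀ →ₗ[ℂ] K × sl2)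
  have hp₁ : ∀ u, p₁ u = (e₀ u).1 := fun u => rfl
  have hp₂ : ∀ u, p₂ u = (e₀ u).2 := fun u => rfl
  have hp₁' : ∀ u v, p₁ ⁅u, v⁆ = p₁ u * p₁ v - p₁ v * p₁ u := fun u v => by
    rw [hp₁, LieEquiv.map_lie]; rfl
  have hp₂' : ∀ u v, p₂ ⁅u, v⁆ = ⁅p₂ u, p₂ v⁆ := fun u v => by
    rw [hp₂, LieEquiv.map_lie]; rfl
  let T : LinearMap.BilinForm ℂ (Module.End ℂ Oct) :=
    (LinearMap.mul ℂ (Module.End ℂ Oct)).compr₂ (LinearMap.trace ℂ Oct)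
  have hT : ∀ d d', T d d' = LinearMap.trace ℂ Oct (d * d') := fun d d' => rfl
  -- The constant `κ` normalizes the trace form on `K` as in `htr`; the factor `-1 / (2 c)`
  -- compensates the `-2` of `trace_mul_sympSq` and the scale `c` of the odd bracket.
  let B₀ : LinearMap.BilinForm ℂ g₀ :=
    (1 / κ) • T.compl₁₂ p₁ p₁ + (-1 / (2 * c)) • sl2TraceForm.compl₁₂ p₂ p₂
  have hB₀ : ∀ u v, B₀ u v = 1 / κ * LinearMap.trace ℂ Oct (p₁ u * p₁ v) +
    (-1 / (2 * c)) * sl2TraceForm (p₂ u) (p₂ v) := fun u v => rfl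
  let q : Fin 2 → g₁ →ₗ[ℂ] Oct := fun i => LinearMap.proj i ∘ₗ ρ₁
  let B₁ : LinearMap.BilinForm ℂ g₁ :=
    formBilin.compl₁₂ (q 0) (q 1) - formBilin.compl₁₂ (q 1) (q 0)
  have hB₁ : ∀ x y, B₁ x y = form (ρ₁ x 0) (ρ₁ y 1) - form (ρ₁ x 1) (ρ₁ y 0) := fun x y => rfl
  have hρV : ∀ x i, ρ₁ x i ∈ V := fun x => by
    have : ρ₁ x ∈ Set.range ρ₁ := ⟨x, rfl⟩
    rwa [hr] at this
  refine ⟨B₀, B₁, IsInvariantForm.of_faithful (fun u v => ?_) (fun x y => ?_) (fun u v w => ?_)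
    (fun u x y => ?_) (fun x hx => ?_) hfaith⟩
  · rw [hB₀, hB₀, LinearMap.trace_mul_comm, sl2TraceForm_symm]
  · rw [hB₁, hB₁, form_comm (ρ₁ x 0), form_comm (ρ₁ x 1)]
    ring
  · rw [hB₀, hB₀, hp₁', hp₁', hp₂', hp₂', sl2TraceForm_lie, sub_mul, mul_sub, map_sub, map_sub,
      mul_assoc, mul_assoc, LinearMap.trace_mul_comm _ (p₁ v), mul_assoc]
  · obtain ⟨d₁, hd₁, hd₁'⟩ := hmem _ (hρV x 0) _ (hρV y 1)
    obtain ⟨d₂, hd₂, hd₂'⟩ := hmem _ (hρV x 1) _ (hρV y 0)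
    have h1 : p₁ (LieSuperalgebra.oddBracket x y) = d₁ - d₂ := by
      refine LinearMap.ext fun z => ?_
      rw [hp₁, h11, LinearMap.sub_apply, hd₁', hd₂']
      simp [symp_single, sub_eq_add_neg]
    have h2 : LinearMap.trace ℂ Oct (p₁ u * p₁ (LieSuperalgebra.oddBracket x y)) =
        κ * (form (p₁ u (ρ₁ x 0)) (ρ₁ y 1) - form (p₁ u (ρ₁ x 1)) (ρ₁ y 0)) := by
      rw [h1, mul_sub, map_sub, htr (p₁ u) (e₀ u).1.2 _ hd₁ _ (hρV x 0) _ (hρV y 1) hd₁',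
        htr (p₁ u) (e₀ u).1.2 _ hd₂ _ (hρV x 1) _ (hρV y 0) hd₂']
      ring
    rw [hB₁, hB₀, h2, sl2TraceForm_apply, hp₂ (LieSuperalgebra.oddBracket x y), h12]
    simp only [Matrix.mul_add, Matrix.mul_smul, trace_add, trace_smul, trace_mul_sympSq, h01,
      form_add_left, Fin.sum_univ_two, form_smul_left, ← hp₁, ← hp₂, smul_eq_mul]
    simp [symp]
    field_simp
    ring
  · refine hρ ?_
    rw [map_zero]
    ext1 i
    refine hV _ (hρV x i) fun y hy => ?_
    -- The symplectic form pairs component `i` with component `1 - i`.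
    obtain ⟨Y, hY⟩ : Pi.single (1 - i) y ∈ Set.range ρ₁ := by
      rw [hr]
      intro j
      by_cases h : j = 1 - i
      · subst h; simpa using hy
      · simp [Pi.single_eq_of_ne h]
    have h := hx Y
    rw [hB₁, hY] at h
    fin_cases i <;> simpa [form_zero_right] using h

theorem IsOctonionic.finrank_eq (hg : IsOctonionic K V D c g₀ g₁) :
    finrank ℂ g₁ = 2 * finrank ℂ V := by
  obtain ⟨e₀, ρ₁, hρ, hr, -⟩ := hg
  let ψ : (Fin 2 → V) →ₗ[ℂ] (Fin 2 → Oct) := V.subtype.compLeft (Fin 2)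
  have h1 : Function.Injective ψ := fun x y h => funext fun i => Subtype.ext (congrFun h i)
  have h2 : Set.range ψ = {f | ∀ i, f i ∈ V} := by
    ext f
    exact ⟨fun ⟨x, hx⟩ i => hx ▸ (x i).2, fun h => ⟨fun i => ⟨f i, h i⟩, rfl⟩⟩
  rw [finrank_eq_of_range_eq hρ h1 (hr.trans h2.symm), finrank_pi_fintype]
  simp

theorem IsOctonionic.exists_powerDisc_ne_zero [Module.Finite ℂ g₁]
    (hg : IsOctonionic K V D c g₀ g₁) {ι : Type*} [Fintype ι] {d : Module.End ℂ Oct} (hd : d ∈ K)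
    {w : ι → Oct} {μ : ι → ℂ} (hwV : ∀ k, w k ∈ V) (hw0 : ∀ k, w k ≠ 0)
    (hw : ∀ k, d (w k) = μ k • w k) {s : ℂ}
    (hinj : Function.Injective fun k : Fin 2 × ι => μ k.2 + ![s, -s] k.1)
    (hcard : Fintype.card ι = finrank ℂ V) :
    ∃ u : g₀, powerDisc (LieModule.toEnd ℂ g₀ g₁ u) ≠ 0 := by
  have hfr := hg.finrank_eq
  obtain ⟨e₀, ρ₁, hρ, hr, h01, -⟩ := hg
  refine ⟨e₀.symm (⟨d, hd⟩, sl2Diagonal s), powerDisc_toEnd_ne_zero hρ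
    (w := fun k : Fin 2 × ι => Pi.single k.1 (w k.2)) (fun k => ?_) (fun k h => ?_)
    (fun k x hx => ?_) hinj ?_⟩
  · rw [hr]
    intro j
    by_cases h : j = k.1
    · subst h; simpa using hwV k.2
    · simp [Pi.single_eq_of_ne h]
  · exact hw0 k.2 (by simpa using h)
  · ext1 i
    rw [h01, hx, LieEquiv.apply_symm_apply]
    obtain ⟨j, k⟩ := k
    fin_cases i <;> fin_cases j <;> simp [sl2Diagonal, hw, add_smul]
  · rw [hfr, ← hcard]
    simp

end Octonionic

end LieSuper
end

/-! ### The superalgebra `G(3)` -/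

noncomputable section

namespace LieSuper

attribute [local instance] LieRing.ofAssociativeRing

namespace Oct

/-- The trace `x + conj x` of an octonion. -/
def tr (x : Oct) : ℂ := x.1 + x.2.2.2

/-- Right multiplication by an octonion. -/
def mulRight (y : Oct) : Module.End ℂ Oct where
  toFun x := mul x y
  map_add' x z := add_mul x z y
  map_smul' c x := smul_mul c x y

theorem mulLeft_apply (x y : Oct) : mulLeft x y = mul x y := rfl

theorem mulRight_apply (x y : Oct) : mulRight x y = mul y x := rfl

section Coordinates

variable (x y : Oct)

theorem mul_fst : (mul x y).1 =
    x.1 * y.1 + (x.2.1 0 * y.2.2.1 0 + x.2.1 1 * y.2.2.1 1 + x.2.1 2 * y.2.2.1 2) := by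
  simp only [mul, dotProduct, Fin.sum_univ_three]

theorem mul_snd : (mul x y).2.2.2 =
    x.2.2.2 * y.2.2.2 + (x.2.2.1 0 * y.2.1 0 + x.2.2.1 1 * y.2.1 1 + x.2.2.1 2 * y.2.1 2) := by
  simp only [mul, dotProduct, Fin.sum_univ_three]

theorem mul_vec_zero : (mul x y).2.1 0 =
    x.1 * y.2.1 0 + y.2.2.2 * x.2.1 0 - (x.2.2.1 1 * y.2.2.1 2 - x.2.2.1 2 * y.2.2.1 1) := by
  simp [mul, cross_apply, -Matrix.smul_cons, -Matrix.cons_sub, -Matrix.sub_cons]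

theorem mul_vec_one : (mul x y).2.1 1 =
    x.1 * y.2.1 1 + y.2.2.2 * x.2.1 1 - (x.2.2.1 2 * y.2.2.1 0 - x.2.2.1 0 * y.2.2.1 2) := by
  simp [mul, cross_apply, -Matrix.smul_cons, -Matrix.cons_sub, -Matrix.sub_cons]

theorem mul_vec_two : (mul x y).2.1 2 =
    x.1 * y.2.1 2 + y.2.2.2 * x.2.1 2 - (x.2.2.1 0 * y.2.2.1 1 - x.2.2.1 1 * y.2.2.1 0) := by
  simp [mul, cross_apply, -Matrix.smul_cons, -Matrix.cons_sub, -Matrix.sub_cons]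

theorem mul_covec_zero : (mul x y).2.2.1 0 =
    y.1 * x.2.2.1 0 + x.2.2.2 * y.2.2.1 0 + (x.2.1 1 * y.2.1 2 - x.2.1 2 * y.2.1 1) := by
  simp [mul, cross_apply, -Matrix.smul_cons, -Matrix.cons_add, -Matrix.add_cons]

theorem mul_covec_one : (mul x y).2.2.1 1 =
    y.1 * x.2.2.1 1 + x.2.2.2 * y.2.2.1 1 + (x.2.1 2 * y.2.1 0 - x.2.1 0 * y.2.1 2) := by
  simp [mul, cross_apply, -Matrix.smul_cons, -Matrix.cons_add, -Matrix.add_cons]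

theorem mul_covec_two : (mul x y).2.2.1 2 =
    y.1 * x.2.2.1 2 + x.2.2.2 * y.2.2.1 2 + (x.2.1 0 * y.2.1 1 - x.2.1 1 * y.2.1 0) := by
  simp [mul, cross_apply, -Matrix.smul_cons, -Matrix.cons_add, -Matrix.add_cons]

theorem form_eq : form x y = x.1 * y.2.2.2 + x.2.2.2 * y.1 -
    (x.2.1 0 * y.2.2.1 0 + x.2.1 1 * y.2.2.1 1 + x.2.1 2 * y.2.2.1 2) -
    (x.2.2.1 0 * y.2.1 0 + x.2.2.1 1 * y.2.1 1 + x.2.2.1 2 * y.2.1 2) := by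
  simp only [form, dotProduct, Fin.sum_univ_three]

end Coordinates

theorem ext_coords {x y : Oct} (h1 : x.1 = y.1) (h2 : x.2.1 0 = y.2.1 0) (h3 : x.2.1 1 = y.2.1 1)
    (h4 : x.2.1 2 = y.2.1 2) (h5 : x.2.2.1 0 = y.2.2.1 0) (h6 : x.2.2.1 1 = y.2.2.1 1)
    (h7 : x.2.2.1 2 = y.2.2.1 2) (h8 : x.2.2.2 = y.2.2.2) : x = y := by
  refine Prod.ext h1 (Prod.ext (funext fun i => ?_) (Prod.ext (funext fun i => ?_) h8))
  · fin_cases i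
    exacts [h2, h3, h4]
  · fin_cases i
    exacts [h5, h6, h7]

theorem trace_mulLeft_mul_mulLeft (x y : Oct) :
    LinearMap.trace ℂ Oct (mulLeft x * mulLeft y) = 4 * tr (mul x y) := by
  rw [trace_eq]
  simp only [Fin.sum_univ_three, Module.End.mul_apply, mulLeft_apply, mul_fst, mul_snd,
    mul_vec_zero, mul_vec_one, mul_vec_two, mul_covec_zero, mul_covec_one, mul_covec_two]
  simp [tr, mul_fst, mul_snd]
  ring

theorem trace_mulRight_mul_mulRight (x y : Oct) :
    LinearMap.trace ℂ Oct (mulRight x * mulRight y) = 4 * tr (mul x y) := by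
  rw [trace_eq]
  simp only [Fin.sum_univ_three, Module.End.mul_apply, mulRight_apply, mul_fst, mul_snd,
    mul_vec_zero, mul_vec_one, mul_vec_two, mul_covec_zero, mul_covec_one, mul_covec_two]
  simp [tr, mul_fst, mul_snd]
  ring

theorem trace_mulLeft_mul_mulRight (x y : Oct) :
    LinearMap.trace ℂ Oct (mulLeft x * mulRight y) = 2 * form x y + tr x * tr y := by
  rw [trace_eq]
  simp only [Fin.sum_univ_three, Module.End.mul_apply, mulLeft_apply, mulRight_apply, mul_fst,
    mul_snd, mul_vec_zero, mul_vec_one, mul_vec_two, mul_covec_zero, mul_covec_one, mul_covec_two]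
  simp [tr, form_eq]
  ring

theorem tr_mul (x y : Oct) : tr (mul x y) = tr x * tr y - form x y := by
  simp only [tr, mul, form]
  ring

/-- Written through multiplication operators, the derivation becomes a sum of commutators, whose
traces against another derivation are computable. -/
theorem stdDer_eq (x y z : Oct) : stdDer x y z =
    (⁅mulLeft x, mulLeft y⁆ + ⁅mulRight x, mulRight y⁆ + ⁅mulLeft x, mulRight y⁆) z := by
  simp only [stdDer, comm, assoc, Ring.lie_def, LinearMap.add_apply, LinearMap.sub_apply,
    Module.End.mul_apply, mulLeft_apply, mulRight_apply]
  apply ext_coords <;> simp only [Prod.fst_add, Prod.snd_add, Prod.fst_sub, Prod.snd_sub,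
    Prod.smul_fst, Prod.smul_snd, Pi.add_apply, Pi.sub_apply, Pi.smul_apply, smul_eq_mul, mul_fst,
    mul_snd, mul_vec_zero, mul_vec_one, mul_vec_two, mul_covec_zero, mul_covec_one,
    mul_covec_two] <;> ring

theorem form_mul_left_of_mem_imag {a : Oct} (ha : a ∈ imag) (x y : Oct) :
    form (mul a x) y = -form x (mul a y) := by
  have h := congrArg (form x y * ·) (show a.1 + a.2.2.2 = 0 from ha)
  simp only [form_eq, mul_fst, mul_snd, mul_vec_zero, mul_vec_one, mul_vec_two, mul_covec_zero,
    mul_covec_one, mul_covec_two] at h ⊢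
  linear_combination h

theorem mem_imag {x : Oct} : x ∈ imag ↔ tr x = 0 := Iff.rfl

theorem tr_add (x y : Oct) : tr (x + y) = tr x + tr y := by
  simp only [tr, Prod.fst_add, Prod.snd_add]
  ring

/-- The unit octonion. -/
def unit : Oct := (1, 0, 0, 1)

theorem mul_unit (x : Oct) : mul x unit = x := by
  apply ext_coords <;> simp [unit, mul_fst, mul_snd, mul_vec_zero, mul_vec_one, mul_vec_two,
    mul_covec_zero, mul_covec_one, mul_covec_two]

theorem eq_zero_of_form_eq_zero {x : Oct} (h : ∀ y, form x y = 0) : x = 0 := by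
  refine ext_coords ?_ ?_ ?_ ?_ ?_ ?_ ?_ ?_
  · simpa [form] using h (0, 0, 0, 1)
  · simpa [form] using h (0, 0, Pi.single 0 1, 0)
  · simpa [form] using h (0, 0, Pi.single 1 1, 0)
  · simpa [form] using h (0, 0, Pi.single 2 1, 0)
  · simpa [form] using h (0, Pi.single 0 1, 0, 0)
  · simpa [form] using h (0, Pi.single 1 1, 0, 0)
  · simpa [form] using h (0, Pi.single 2 1, 0, 0)
  · simpa [form] using h (1, 0, 0, 0)

theorem form_unit (x : Oct) : form x unit = tr x := by
  simp [form, unit, tr]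

theorem sub_smul_unit_mem_imag (x : Oct) : x - (tr x / 2) • unit ∈ imag := by
  rw [mem_imag]
  simp [tr, unit]
  ring

theorem eq_zero_of_mem_imag {x : Oct} (hx : x ∈ imag) (h : ∀ y ∈ imag, form x y = 0) : x = 0 := by
  refine eq_zero_of_form_eq_zero fun y => ?_
  have h1 := h _ (sub_smul_unit_mem_imag y)
  rw [form_sub_right, form_smul_right, form_unit, mem_imag.1 hx] at h1
  linear_combination h1

section Derivations

variable {d : Module.End ℂ Oct}

theorem apply_mul_of_mem (hd : d ∈ derivations) (x y : Oct) :
    d (mul x y) = mul (d x) y + mul x (d y) := hd x y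

theorem apply_unit_of_mem (hd : d ∈ derivations) : d unit = 0 := by
  have h := apply_mul_of_mem hd unit unit
  rw [mul_unit, mul_unit] at h
  have h2 : mul unit (d unit) = 0 := left_eq_add.1 h
  have h3 : mul unit (d unit) = d unit := by
    apply ext_coords <;> simp [unit, mul_fst, mul_snd, mul_vec_zero, mul_vec_one, mul_vec_two,
      mul_covec_zero, mul_covec_one, mul_covec_two]
  rw [← h3, h2]

theorem mul_mulLeft_of_mem (hd : d ∈ derivations) (x : Oct) :
    d * mulLeft x = mulLeft x * d + mulLeft (d x) :=
  LinearMap.ext fun z => (apply_mul_of_mem hd x z).trans (add_comm _ _)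

theorem mul_mulRight_of_mem (hd : d ∈ derivations) (x : Oct) :
    d * mulRight x = mulRight x * d + mulRight (d x) :=
  LinearMap.ext fun z => apply_mul_of_mem hd z x

/-- A derivation satisfies `[d, L_x] = L_{d x}`, and likewise for right multiplications, so
cyclicity turns the trace into `tr (L_{dx} L_y) + tr (R_{dx} R_y) + tr (L_{dx} R_y)`. For imaginary
`y` these contribute `-4`, `-4` and `2` times the form. -/
theorem trace_mul_stdDer (hd : d ∈ derivations) {d' : Module.End ℂ Oct} {x y : Oct}
    (hy : y ∈ imag) (hd' : ∀ z, d' z = stdDer x y z) :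
    LinearMap.trace ℂ Oct (d * d') = -6 * form (d x) y := by
  have h : d' = ⁅mulLeft x, mulLeft y⁆ + ⁅mulRight x, mulRight y⁆ + ⁅mulLeft x, mulRight y⁆ :=
    LinearMap.ext fun z => (hd' z).trans (stdDer_eq x y z)
  have key : ∀ f g f' : Module.End ℂ Oct, d * f = f * d + f' →
      LinearMap.trace ℂ Oct (d * ⁅f, g⁆) = LinearMap.trace ℂ Oct (f' * g) := by
    intro f g f' hf
    have h1 : LinearMap.trace ℂ Oct (d * (g * f)) = LinearMap.trace ℂ Oct (f * (d * g)) := by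
      rw [← mul_assoc, LinearMap.trace_mul_comm]
    rw [Ring.lie_def, mul_sub, map_sub, h1, ← mul_assoc, ← mul_assoc, ← map_sub, hf,
      _root_.add_mul, add_sub_cancel_left]
  rw [h, _root_.mul_add, _root_.mul_add, map_add, map_add, key _ _ _ (mul_mulLeft_of_mem hd x),
    key _ _ _ (mul_mulRight_of_mem hd x), key _ _ _ (mul_mulLeft_of_mem hd x),
    trace_mulLeft_mul_mulLeft, trace_mulRight_mul_mulRight, trace_mulLeft_mul_mulRight, tr_mul,
    mem_imag.1 hy]
  ring

theorem eq_zero_of_eq_zero_on_imag (hd : d ∈ derivations) (h : ∀ x ∈ imag, d x = 0) : d = 0 := by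
  refine LinearMap.ext fun x => ?_
  have h1 := h _ (sub_smul_unit_mem_imag x)
  rwa [map_sub, map_smul, apply_unit_of_mem hd, smul_zero, sub_zero] at h1

/-- A derivation in the Cartan subalgebra of `G₂`. -/
def torusDerivation : Module.End ℂ Oct where
  -- The entries `1, 2, -3` sum to zero, as compatibility with the cross product requires.
  toFun x := (0, ![1, 2, -3] * x.2.1, -(![1, 2, -3] * x.2.2.1), 0)
  map_add' x y := by
    apply ext_coords <;> simp <;> ring
  map_smul' c x := by
    apply ext_coords <;> simp <;> ring

theorem torusDerivation_apply (x : Oct) :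
    torusDerivation x = (0, ![1, 2, -3] * x.2.1, -(![1, 2, -3] * x.2.2.1), 0) := rfl

theorem torusDerivation_mem : torusDerivation ∈ derivations := by
  intro x y
  apply ext_coords <;> simp [torusDerivation_apply, mul_fst, mul_snd, mul_vec_zero, mul_vec_one,
    mul_vec_two, mul_covec_zero, mul_covec_one, mul_covec_two] <;> ring

theorem stdDer_zero (z : Oct) : stdDer 0 0 z = 0 := by
  have h1 : mulLeft 0 = 0 := LinearMap.ext fun z => by simp [mulLeft, mul]
  have h2 : mulRight 0 = 0 := LinearMap.ext fun z => by simp [mulRight, mul]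
  simp [stdDer_eq, h1, h2]

end Derivations

/-- The standard basis of the imaginary octonions. -/
def imagBasis : Fin 3 ⊕ Fin 3 ⊕ Unit → Oct :=
  Sum.elim (fun i => (0, Pi.single i 1, 0, 0))
    (Sum.elim (fun i => (0, 0, Pi.single i 1, 0)) fun _ => (1, 0, 0, -1))

theorem finrank_imag : Module.finrank ℂ imag = 7 := by
  let φ : Oct →ₗ[ℂ] ℂ :=
    { toFun := tr
      map_add' := tr_add
      map_smul' := fun c x => by simp [tr]; ring }
  have h1 : LinearMap.ker φ = imag := by
    ext x
    exact Iff.rfl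
  have h2 : LinearMap.range φ = ⊤ := LinearMap.range_eq_top.2 fun c => ⟨(c, 0, 0, 0), by
    simp [φ, tr]⟩
  have h3 := φ.finrank_range_add_finrank_ker
  rw [h1, h2] at h3
  simp at h3
  omega

end Oct

section GThree

open Oct

variable {g₀ g₁ : Type*} [LieRing g₀] [LieAlgebra ℂ g₀] [AddCommGroup g₁]
    [Module ℂ g₁] [LieRingModule g₀ g₁] [LieModule ℂ g₀ g₁] [LieSuperalgebra g₀ g₁]

theorem isQuadraticWithSimpleSpectrum_g3 [Module.Finite ℂ g₁] (hg : IsG3 g₀ g₁) :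
    IsQuadraticWithSimpleSpectrum g₀ g₁ := by
  have hg : IsOctonionic derivations imag stdDer (-2) g₀ g₁ := hg
  have hV : ∃ x ∈ imag, x ≠ 0 := ⟨(1, 0, 0, -1), by simp [mem_imag, tr], by simp⟩
  have hK : ∀ d ∈ derivations, (∀ x ∈ imag, d x = 0) → d = 0 :=
    fun d hd => eq_zero_of_eq_zero_on_imag hd
  refine ⟨hg.exists_isInvariantForm stdDer_zero (by norm_num) (κ := -6) (by norm_num)
    (fun d hd d' _ x _ y hy hd' => trace_mul_stdDer hd hy hd') (fun x => eq_zero_of_mem_imag) hV hK,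
    ?_, Or.inr fun u v h => hg.eq_zero_of_acts_trivially hV hK h⟩
  let μ : Fin 3 ⊕ Fin 3 ⊕ Unit → ℤ := Sum.elim ![1, 2, -3] (Sum.elim ![-1, -2, 3] fun _ => 0)
  -- The weights `0, ±1, ±2, ±3` are distinct, and `s = 10` moves the two copies of `V` into
  -- disjoint ranges.
  refine hg.exists_powerDisc_ne_zero torusDerivation_mem (w := imagBasis)
    (μ := fun k => (μ k : ℂ)) (s := 10) ?_ ?_ ?_ ?_ ?_
  · rintro (i | i | i) <;> simp [imagBasis, mem_imag, tr]
  · rintro (i | i | i) <;> simp [imagBasis]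
  · rintro (i | i | i)
    · fin_cases i <;> apply ext_coords <;> simp [imagBasis, torusDerivation_apply, μ]
    · fin_cases i <;> apply ext_coords <;> simp [imagBasis, torusDerivation_apply, μ]
    · apply ext_coords <;> simp [imagBasis, torusDerivation_apply, μ]
  · have h : (fun k : Fin 2 × (Fin 3 ⊕ Fin 3 ⊕ Unit) => (μ k.2 : ℂ) + ![(10 : ℂ), -10] k.1) =
        Int.cast ∘ fun k => μ k.2 + ![10, -10] k.1 := by
      ext ⟨i, k⟩
      fin_cases i <;> simp
    rw [h]
    exact Int.cast_injective.comp (by decide)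
  · rw [finrank_imag]
    simp

end GThree

end LieSuper
end

/-! ### The superalgebra `F(4)` -/

noncomputable section

namespace LieSuper

attribute [local instance] LieRing.ofAssociativeRing

namespace Oct

theorem trace_lie_mulLeft_mul_mulLeft (a b x : Oct) :
    LinearMap.trace ℂ Oct (⁅mulLeft a, mulLeft b⁆ * mulLeft x) = 0 := by
  rw [trace_eq]
  simp only [Fin.sum_univ_three, Ring.lie_def, LinearMap.sub_apply, Module.End.mul_apply,
    mulLeft_apply, mul_fst, mul_snd, Prod.fst_sub, Prod.snd_sub, Pi.sub_apply,
    mul_vec_zero, mul_vec_one, mul_vec_two, mul_covec_zero, mul_covec_one, mul_covec_two]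
  simp
  ring

theorem trace_lie_mulLeft_mul_mulRight (a b x y : Oct) :
    LinearMap.trace ℂ Oct (⁅mulLeft a, mulLeft b⁆ * (mulRight x * mulRight (conj y))) =
      2 * form (⁅mulLeft a, mulLeft b⁆ x) y := by
  rw [trace_eq]
  simp only [Fin.sum_univ_three, Ring.lie_def, LinearMap.sub_apply, Module.End.mul_apply,
    mulLeft_apply, mulRight_apply, mul_fst, mul_snd, Prod.fst_sub, Prod.snd_sub, Pi.sub_apply,
    mul_vec_zero, mul_vec_one, mul_vec_two, mul_covec_zero, mul_covec_one, mul_covec_two, form_eq,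
    conj]
  simp
  ring

theorem form_apply_of_mem_spin7 {d : Module.End ℂ Oct} (hd : d ∈ spin7) :
    ∀ x y : Oct, form (d x) y = -form x (d y) := by
  induction hd using LieSubalgebra.lieSpan_induction with
  | mem d h =>
    obtain ⟨a, ha, b, hb, rfl⟩ := h
    intro x y
    simp only [Ring.lie_def, LinearMap.sub_apply, Module.End.mul_apply, mulLeft_apply,
      form_sub_left, form_sub_right, form_mul_left_of_mem_imag ha, form_mul_left_of_mem_imag hb]
    ring
  | zero =>
    intro x y
    simp [form_zero_left, form_zero_right]
  | add d e _ _ hd he =>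
    intro x y
    rw [LinearMap.add_apply, LinearMap.add_apply, form_add_left, form_add_right, hd, he]
    ring
  | smul c d _ hd =>
    intro x y
    rw [LinearMap.smul_apply, LinearMap.smul_apply, form_smul_left, form_smul_right, hd]
    ring
  | lie d e _ _ hd he =>
    intro x y
    simp only [Ring.lie_def, LinearMap.sub_apply, Module.End.mul_apply, form_sub_left,
      form_sub_right, hd _ _, he _ _]
    ring

/-- The rank-one terms contribute `6` times the form by skewness of the generator, and the double
right multiplication contributes `2`; left multiplications are trace-orthogonal to the generator. -/
theorem trace_mul_spinMap {a b x y : Oct} (ha : a ∈ imag) (hb : b ∈ imag) {d : Module.End ℂ Oct}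
    (hd : ∀ z, d z = spinMap x y z) :
    LinearMap.trace ℂ Oct (⁅mulLeft a, mulLeft b⁆ * d) =
      8 * form (⁅mulLeft a, mulLeft b⁆ x) y := by
  have hmem : ⁅mulLeft a, mulLeft b⁆ ∈ spin7 :=
    LieSubalgebra.subset_lieSpan ⟨a, ha, b, hb, rfl⟩
  have hrank : ∀ (e : Module.End ℂ Oct) (z w : Oct),
      LinearMap.trace ℂ Oct (e * (formBilin z).smulRight w) = form z (e w) := by
    intro e z w
    have h : e * (formBilin z).smulRight w = (formBilin z).smulRight (e w) :=
      LinearMap.ext fun v => e.map_smul _ _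
    rw [h, LinearMap.trace_smulRight]
    rfl
  have h : d = (3 : ℂ) • ((formBilin y).smulRight x - (formBilin x).smulRight y) -
      (mulLeft (mul x (conj y)) - mulRight x * mulRight (conj y)) :=
    LinearMap.ext fun z => hd z
  rw [h, mul_sub, mul_sub, mul_smul_comm, mul_sub, map_sub, map_sub, map_smul, map_sub, hrank,
    hrank, trace_lie_mulLeft_mul_mulLeft, trace_lie_mulLeft_mul_mulRight, form_comm y, smul_eq_mul]
  have := form_apply_of_mem_spin7 hmem x y
  linear_combination -3 * this

theorem spinMap_zero (z : Oct) : spinMap 0 0 z = 0 := by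
  have h1 : mulLeft 0 = 0 := LinearMap.ext fun z => by simp [mulLeft, mul]
  have h2 : mulRight 0 = 0 := LinearMap.ext fun z => by simp [mulRight, mul]
  have h3 : ∀ z, mul 0 z = 0 := fun z => by rw [← mulLeft_apply, h1, LinearMap.zero_apply]
  have h4 : ∀ z, mul z 0 = 0 := fun z => by rw [← mulRight_apply, h2, LinearMap.zero_apply]
  simp [spinMap, h3, h4]

/-- The standard basis of the octonions. -/
def stdBasis : Unit ⊕ Fin 3 ⊕ Fin 3 ⊕ Unit → Oct :=
  Sum.elim (fun _ => (1, 0, 0, 0)) (Sum.elim (fun i => (0, Pi.single i 1, 0, 0))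
    (Sum.elim (fun i => (0, 0, Pi.single i 1, 0)) fun _ => (0, 0, 0, 1)))

/-- The commutator of the left multiplications by two dual imaginary basis vectors. -/
def spinTorus (i : Fin 3) : Module.End ℂ Oct :=
  ⁅mulLeft (0, Pi.single i 1, 0, 0), mulLeft (0, 0, Pi.single i 1, 0)⁆

/-- A regular element of a Cartan subalgebra of `spin7`. -/
def spinRegular : Module.End ℂ Oct := spinTorus 0 + (2 : ℂ) • spinTorus 1 + (4 : ℂ) • spinTorus 2

theorem spinTorus_mem (i : Fin 3) : spinTorus i ∈ spin7 :=
  LieSubalgebra.subset_lieSpan ⟨_, by simp [mem_imag, tr], _, by simp [mem_imag, tr], rfl⟩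

theorem spinRegular_mem : spinRegular ∈ spin7 :=
  add_mem (add_mem (spinTorus_mem 0) (spin7.smul_mem _ (spinTorus_mem 1)))
    (spin7.smul_mem _ (spinTorus_mem 2))

theorem spinRegular_apply (x : Oct) :
    -- The entries are the eight sums `±1 ± 2 ± 4`, the weights of the spin representation at the
    -- element with coefficients `1, 2, 4`.
    spinRegular x = (7 * x.1, ![-5, -3, 1] * x.2.1, ![5, 3, -1] * x.2.2.1, -7 * x.2.2.2) := by
  simp only [spinRegular, spinTorus, Ring.lie_def, LinearMap.add_apply, LinearMap.smul_apply,
    LinearMap.sub_apply, Module.End.mul_apply, mulLeft_apply]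
  apply ext_coords <;> simp only [Prod.fst_add, Prod.snd_add, Prod.fst_sub, Prod.snd_sub,
    Prod.smul_fst, Prod.smul_snd, Pi.add_apply, Pi.sub_apply, Pi.smul_apply, smul_eq_mul, mul_fst,
    mul_snd, mul_vec_zero, mul_vec_one, mul_vec_two, mul_covec_zero, mul_covec_one,
    mul_covec_two] <;> simp <;> ring

end Oct

section FFour

open Oct

variable {g₀ g₁ : Type*} [LieRing g₀] [LieAlgebra ℂ g₀] [AddCommGroup g₁]
    [Module ℂ g₁] [LieRingModule g₀ g₁] [LieModule ℂ g₀ g₁] [LieSuperalgebra g₀ g₁]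

theorem IsF4.trace_mul_spinMap (hg : IsF4 g₀ g₁) {d : Module.End ℂ Oct} (hd : d ∈ spin7) :
    ∀ (d' : Module.End ℂ Oct) (x y : Oct), (∀ z, d' z = spinMap x y z) →
      LinearMap.trace ℂ Oct (d * d') = 8 * form (d x) y := by
  have hg : IsOctonionic spin7 ⊤ spinMap 3 g₀ g₁ := hg
  induction hd using LieSubalgebra.lieSpan_induction with
  | mem d h =>
    obtain ⟨a, ha, b, hb, rfl⟩ := h
    exact fun d' x y hd' => Oct.trace_mul_spinMap ha hb hd'
  | zero =>
    intro d' x y _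
    simp [form_zero_left]
  | add d e _ _ hd he =>
    intro d' x y h
    rw [_root_.add_mul, map_add, hd d' x y h, he d' x y h, LinearMap.add_apply, form_add_left]
    ring
  | smul c d _ hd =>
    intro d' x y h
    rw [smul_mul_assoc, map_smul, hd d' x y h, LinearMap.smul_apply, form_smul_left, smul_eq_mul]
    ring
  -- The trace identity passes to brackets: `tr ([d, e] d') = tr (d [e, d'])`, where equivariance
  -- writes `[e, d']` as a sum of two spin maps and skewness of `e` recombines them.
  | lie d e hd' he' hd he =>
    intro d' x y h
    obtain ⟨d₁, -, h₁⟩ := hg.exists_mem spinMap_zero (x := e x) (y := y) trivial trivial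
    obtain ⟨d₂, -, h₂⟩ := hg.exists_mem spinMap_zero (x := x) (y := e y) trivial trivial
    have h3 : e * d' - d' * e = d₁ + d₂ := LinearMap.ext fun z => by
      rw [LinearMap.add_apply, h₁, h₂]
      exact hg.lie_apply spinMap_zero he' trivial trivial h z
    have h4 : LinearMap.trace ℂ Oct (⁅d, e⁆ * d') =
        LinearMap.trace ℂ Oct (d * (e * d' - d' * e)) := by
      rw [Ring.lie_def, sub_mul, mul_sub, map_sub, map_sub, mul_assoc, mul_assoc,
        LinearMap.trace_mul_comm ℂ e (d * d'), mul_assoc]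
    rw [h4, h3, _root_.mul_add, map_add, hd _ _ _ h₁, hd _ _ _ h₂, Ring.lie_def,
      LinearMap.sub_apply, Module.End.mul_apply, Module.End.mul_apply, form_sub_left,
      form_apply_of_mem_spin7 he' (d x) y]
    ring

theorem isQuadraticWithSimpleSpectrum_f4 [Module.Finite ℂ g₁] (hF : IsF4 g₀ g₁) :
    IsQuadraticWithSimpleSpectrum g₀ g₁ := by
  have hg : IsOctonionic spin7 ⊤ spinMap 3 g₀ g₁ := hF
  have hV : ∃ x ∈ (⊤ : Submodule ℂ Oct), x ≠ 0 := ⟨(1, 0, 0, 0), trivial, by simp⟩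
  have hK : ∀ d ∈ spin7, (∀ x ∈ (⊤ : Submodule ℂ Oct), d x = 0) → d = 0 :=
    fun d _ h => LinearMap.ext fun x => h x trivial
  refine ⟨hg.exists_isInvariantForm spinMap_zero (by norm_num) (κ := 8) (by norm_num)
    (fun d hd d' _ x _ y _ hd' => hF.trace_mul_spinMap hd d' x y hd')
    (fun x _ h => eq_zero_of_form_eq_zero fun y => h y trivial) hV hK,
    ?_, Or.inr fun u v h => hg.eq_zero_of_acts_trivially hV hK h⟩
  let μ : Unit ⊕ Fin 3 ⊕ Fin 3 ⊕ Unit → ℤ :=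
    Sum.elim (fun _ => 7) (Sum.elim ![-5, -3, 1] (Sum.elim ![5, 3, -1] fun _ => -7))
  -- The spin weights lie between `-7` and `7`, so the shifts by `±16` cannot collide.
  refine hg.exists_powerDisc_ne_zero spinRegular_mem (w := stdBasis)
    (μ := fun k => (μ k : ℂ)) (s := 16) (fun _ => trivial) ?_ ?_ ?_ ?_
  · rintro (i | i | i | i) <;> simp [stdBasis]
  · rintro (i | i | i | i)
    · apply ext_coords <;> simp [stdBasis, spinRegular_apply, μ]
    · fin_cases i <;> apply ext_coords <;> simp [stdBasis, spinRegular_apply, μ]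
    · fin_cases i <;> apply ext_coords <;> simp [stdBasis, spinRegular_apply, μ]
    · apply ext_coords <;> simp [stdBasis, spinRegular_apply, μ]
  · have h : (fun k : Fin 2 × (Unit ⊕ Fin 3 ⊕ Fin 3 ⊕ Unit) =>
        (μ k.2 : ℂ) + ![(16 : ℂ), -16] k.1) = Int.cast ∘ fun k => μ k.2 + ![16, -16] k.1 := by
      ext ⟨i, k⟩
      fin_cases i <;> simp
    rw [h]
    exact Int.cast_injective.comp (by decide)
  · rw [finrank_top]
    simp

end FFour

/-! ### Assembling the families and the main theorem -/

section Classification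

variable {g₀ g₁ : Type*} [LieRing g₀] [LieAlgebra ℂ g₀] [AddCommGroup g₁]
    [Module ℂ g₁] [LieRingModule g₀ g₁] [LieModule ℂ g₀ g₁] [LieSuperalgebra g₀ g₁]

theorem IsBasicClassical.isQuadraticWithSimpleSpectrum [Module.Finite ℂ g₁]
    (hg : IsBasicClassical g₀ g₁) : IsQuadraticWithSimpleSpectrum g₀ g₁ := by
  rcases hg with ⟨m, n, hmn, h⟩ | ⟨m, n, h⟩ | ⟨m, n, h⟩ | ⟨a, ha, ha', h⟩ | h | h
  · exact isQuadraticWithSimpleSpectrum_sl hmn h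
  · exact isQuadraticWithSimpleSpectrum_gl h
  · exact isQuadraticWithSimpleSpectrum_osp h
  · exact isQuadraticWithSimpleSpectrum_d21 ha ha' h
  · exact isQuadraticWithSimpleSpectrum_f4 h
  · exact isQuadraticWithSimpleSpectrum_g3 h

end Classification

end LieSuper
end

theorem theorem5p7 (g₀ g₁ : Type*) [LieRing g₀] [LieAlgebra ℂ g₀] [AddCommGroup g₁] [Module ℂ g₁]
    [LieRingModule g₀ g₁] [LieModule ℂ g₀ g₁] [Module.Finite ℂ g₀] [Module.Finite ℂ g₁]
    [LieSuper.LieSuperalgebra g₀ g₁] (hg : LieSuper.IsBasicClassical g₀ g₁)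
    (t : LieSubalgebra ℂ g₀) [t.IsCartanSubalgebra]
    (A : Finset (Module.Dual ℂ t)) (hA : LieSuper.IsIsoSet t g₁ A)
    (x : Module.Dual ℂ t → g₁)
    (hx : ∀ β ∈ A, x β ∈ LieModule.weightSpace g₁ (β : t → ℂ) ∧ x β ≠ 0) :
    (∀ y ∈ LieSuper.orbit g₀ (∑ β ∈ A, x β), LieSuper.LieSuperalgebra.oddBracket y y = (0 : g₀)) ∧
    (∃ (B₀ : LinearMap.BilinForm ℂ g₀) (B₁ : LinearMap.BilinForm ℂ g₁),
      LieSuper.IsInvariantForm B₀ B₁) ∧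
    ∀ (B₀ : LinearMap.BilinForm ℂ g₀) (B₁ : LinearMap.BilinForm ℂ g₁),
      LieSuper.IsInvariantForm B₀ B₁ →
      ∃ d : ℕ, LieSuper.algDim (LieSuper.orbit g₀ (∑ β ∈ A, x β)) = (d : WithBot ℕ∞) ∧
        (d : ℚ) = ((LieSuper.rootSet t g₁ \ LieSuper.perp t B₀ A).ncard : ℚ) / 2 + (A.card : ℚ) := by
  have hQ := hg.isQuadraticWithSimpleSpectrum
  have hxw : ∀ β ∈ A, ∀ τ : t, ⁅(τ : g₀), x β⁆ = β τ • x β := fun β hβ =>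
    (LieModule.mem_weightSpace _ _).1 (hx β hβ).1
  exact ⟨fun y hy => LieSuper.oddBracket_self_of_mem_orbit g₀ (hA.oddBracket_sum_self hxw) hy,
    hQ.exists_form, fun B₀ B₁ hB => LieSuper.exists_algDim_orbit_eq hQ.exists_simple hQ.lie_eq_zero
      hB hA hxw fun β hβ => (hx β hβ).2⟩
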